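/- **Theorem.** Let $k$ be a field of characteristic zero and let $H_c$, $H_o$ be $\mathbb Z$-graded $k$-vector spaces. Signs are Koszul signs; $|x|$ is the degree of a homogeneous element $x$. *Coalgebra.* Let $C=\Lambda^c H_c\otimes T^c H_o$, where $\Lambda^cH_c$ is the graded symmetric coalgebra with the unshuffle coproduct and $T^cH_o$ is the tensor coalgebra with the deconcatenation coproduct; thus $$\Delta\big((u_1\wedge\dots\wedge u_m)\otimes(v_1\otimes\dots\otimes v_n)\big)=\sum_{p,q}\sum_{\sigma}(-1)^{\epsilon(\sigma)+\eta}\,\big(u_{\sigma(1)}\wedge\dots\wedge u_{\sigma(p)}\otimes v_1\otimes\dots\otimes v_q\big)\otimes\big(u_{\sigma(p+1)}\wedge\dots\wedge u_{\sigma(m)}\otimes v_{q+1}\otimes\dots\otimes v_n\big),$$ where $\sigma$ runs over the $(p,m-p)$-unshuffles, $(-1)^{\epsilon(\sigma)}$ is the Koszul sign of $\sigma$ and $\eta=(|u_{\sigma(p+1)}|+\dots+|u_{\sigma(m)}|)(|v_1|+\dots+|v_q|)$. Let $\varepsilon:C\to k$ be the counit and $1\in C$ the unit of $\Lambda^0\otimes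 T^0=k$. A *degree one coderivation* of $C$ is a linear map $D:C\to C$ of internal degree one with $(D\otimes 1+1\otimes D)\Delta=\Delta D$, $\varepsilon D=0$ and $D(1)=0$. *OCHA structures.* An OCHA structure on $(H_c,H_o)$ consists of degree one multilinear operations $l_n:H_c^{\wedge n}\to H_c$ $(n\ge 1)$ and $n_{p,q}:H_c^{\wedge p}\otimes H_o^{\otimes q}\to H_o$ $(p+q\ge1)$, graded symmetric in the arguments from $H_c$, which satisfy, for all homogeneous $u_1,\dots,u_n\in H_c$ and $a_1,\dots,a_m\in H_o$, the $L_\infty$ relations $$\sum_{p+r=n,\ p\ge1}\ \sum_\sigma(-1)^{\epsilon(\sigma)}\,l_{1+r}\big(l_p(u_{\sigma(1)},\dots,u_{\sigma(p)}),u_{\sigma(p+1)},\dots,u_{\sigma(n)}\big)=0$$ and the compatibility relations $$\sum_{p+r=n,\ p\ge 1}\ \sum_\sigma(-1)^{\epsilon(\sigma)}\,n_{1+r,m}\big(l_p(u_{\sigma(1)},\dots,u_{\sigma(p)}),u_{\sigma(p+1)},\dots,u_{\sigma(n)};a_1,\dots,a_m\big)$$ $$+\sum_{\substack{p+r=n\\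 i+s+j=m}}\ \sum_\sigma(-1)^{\mu_{p,i}(\sigma)}\,n_{p,i+1+j}\big(u_{\sigma(1)},\dots,u_{\sigma(p)};a_1,\dots,a_i,\,n_{r,s}(u_{\sigma(p+1)},\dots,u_{\sigma(n)};a_{i+1},\dots,a_{i+s}),\,a_{i+s+1},\dots,a_m\big)=0,$$ where $\sigma$ runs over the $(p,r)$-unshuffles, $l_0=0$ and $n_{0,0}=0$ by convention, and $$\mu_{p,i}(\sigma)=\epsilon(\sigma)+\sum_{t\le p}|u_{\sigma(t)}|+\sum_{t\le i}|a_t|+\Big(\sum_{t\le i}|a_t|\Big)\Big(\sum_{t>p}|u_{\sigma(t)}|\Big).$$ *Lifts.* For degree one families $l=(l_n)$, $n=(n_{p,q})$ of operations as above (not necessarily satisfying the relations), let $\mathfrak l+\mathfrak n=\sum_n\hat l_n+\sum_{p,q}\hat n_{p,q}:C\to C$ be the sum of their lifts: $$(\mathfrak l+\mathfrak n)(u_1\wedge\dots\wedge u_r\otimes a_1\otimes\dots\otimes a_m)=\sum_{p}\sum_\sigma(-1)^{\epsilon(\sigma)}\,l_p(u_{\sigma(1)},\dots,u_{\sigma(p)})\wedge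 u_{\sigma(p+1)}\wedge\dots\wedge u_{\sigma(r)}\otimes a_1\otimes\dots\otimes a_m$$ $$+\sum_{p,i,s}\sum_\sigma(-1)^{\mu_{p,i}(\sigma)}\,u_{\sigma(1)}\wedge\dots\wedge u_{\sigma(p)}\otimes a_1\otimes\dots\otimes a_i\otimes n_{r-p,s}(u_{\sigma(p+1)},\dots,u_{\sigma(r)};a_{i+1},\dots,a_{i+s})\otimes a_{i+s+1}\otimes\dots\otimes a_m,$$ where $\sigma$ runs over the $(p,r-p)$-unshuffles. A linear map $D:C\to C$ *satisfies the OCHA constraint* if it is of the form $\mathfrak l+\mathfrak n$ for some such families. Then: 1. $(l,n)\mapsto\mathfrak l+\mathfrak n$ is a bijection from the set of OCHA structures on $(H_c,H_o)$ onto the set of degree one coderivations $D$ of $C$ that satisfy the OCHA constraint and $D^2=0$. 2. If $\dim_k H_o\neq1$ or $H_c=0$ (where $\dim_k$ is the total dimension), then $(l,n)\mapsto\mathfrak l+\mathfrak n$ is a bijection from the set of OCHA structures on $(H_c,H_o)$ onto the set of all degree one coderivations $D$ of $C$ with $D^2=0$. -/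

import Mathlib

open scoped TensorProduct DirectSum

noncomputable section

namespace OCHA

section Algebras

variable {k V : Type*} [Field k] [AddCommGroup V] [Module k V]

/-- The homogeneous elements of internal degree `i` of the tensor (co)algebra of the
`ℤ`-graded space `(V, 𝒱)`: the span of the `v₁ ⊗ ⋯ ⊗ vₙ`, `n ≥ 0`, with `vₜ` homogeneous of
degree `d t` and `∑ d t = i`. -/
def tensorDeg (𝒱 : ℤ → Submodule k V) (i : ℤ) : Submodule k (TensorAlgebra k V) :=
  Submodule.span k {x | ∃ (n : ℕ) (d : Fin n → ℤ) (v : Fin n → V),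
    (∀ t, v t ∈ 𝒱 (d t)) ∧ ∑ t, d t = i ∧ x = TensorAlgebra.tprod k V n v}

/-- The relations `x ∧ y = (-1)^{|x||y|} y ∧ x` for homogeneous `x`, `y` in `V`. -/
inductive SymRel (𝒱 : ℤ → Submodule k V) : TensorAlgebra k V → TensorAlgebra k V → Prop
  | swap {i j : ℤ} {x y : V} (hx : x ∈ 𝒱 i) (hy : y ∈ 𝒱 j) :
      SymRel 𝒱 (TensorAlgebra.ι k x * TensorAlgebra.ι k y)
        ((i * j).negOnePow • (TensorAlgebra.ι k y * TensorAlgebra.ι k x))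

/-- The underlying graded space of the graded symmetric coalgebra `Λᶜ V`: the quotient of the
tensor algebra by graded commutativity. -/
abbrev Sym (𝒱 : ℤ → Submodule k V) : Type _ := RingQuot (SymRel 𝒱)

/-- The quotient map `v₁ ⊗ ⋯ ⊗ vₙ ↦ v₁ ∧ ⋯ ∧ vₙ`. -/
def symMk (𝒱 : ℤ → Submodule k V) : TensorAlgebra k V →ₐ[k] Sym 𝒱 :=
  RingQuot.mkAlgHom k (SymRel 𝒱)

/-- For `S = {s₁ < ⋯ < sₚ} ⊆ {1, …, n}`, the sub-family `(v_{s₁}, …, v_{sₚ})` of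
`(v₁, …, vₙ)`. A `(p, n - p)`-unshuffle `σ` is the same thing as the subset
`S = {σ(1), …, σ(p)}`; then `block v S = (v_{σ(1)}, …, v_{σ(p)})` and
`block v Sᶜ = (v_{σ(p+1)}, …, v_{σ(n)})`. -/
def block {X : Type*} {n : ℕ} (v : Fin n → X) (S : Finset (Fin n)) : Fin S.card → X :=
  fun t => v (S.orderEmbOfFin rfl t)

/-- The Koszul sign `(-1)^{ε(σ)}` of the unshuffle `σ` corresponding to `S`, acting on homogeneous
elements of degrees `d 1, …, d n`: the product of `(-1)^{d i d j}` over the inversions, that is,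
the pairs `j < i` with `i ∈ S` and `j ∉ S`. -/
def unshuffleSign {n : ℕ} (d : Fin n → ℤ) (S : Finset (Fin n)) : ℤˣ :=
  ∏ i ∈ S, ∏ j ∈ Sᶜ, if j < i then (d i * d j).negOnePow else 1

/-- The Koszul sign `(-1)^{ε(σ)}` of a permutation `σ` acting on homogeneous elements of degrees
`d 1, …, d n`. -/
def permSign {n : ℕ} (d : Fin n → ℤ) (σ : Equiv.Perm (Fin n)) : ℤˣ :=
  ∏ i, ∏ j, if i < j ∧ σ j < σ i then (d (σ i) * d (σ j)).negOnePow else 1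

/-- `v₁ ∧ ⋯ ∧ vₙ`. -/
def wedge (𝒱 : ℤ → Submodule k V) {n : ℕ} (v : Fin n → V) : Sym 𝒱 :=
  symMk 𝒱 (TensorAlgebra.tprod k V n v)

/-- The homogeneous elements of internal degree `i` of `Λᶜ V`. -/
def symDeg (𝒱 : ℤ → Submodule k V) (i : ℤ) : Submodule k (Sym 𝒱) :=
  (tensorDeg 𝒱 i).map (symMk 𝒱).toLinearMap

theorem units_smul_eq {M : Type*} [AddCommGroup M] [Module k M] (w : ℤˣ) (x : M) :
    w • x = ((w : ℤ) : k) • x := by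
  rw [Units.smul_def, Int.cast_smul_eq_zsmul]

theorem symMk_mem_symDeg {𝒱 : ℤ → Submodule k V} {i : ℤ} {x : TensorAlgebra k V}
    (hx : x ∈ tensorDeg 𝒱 i) : symMk 𝒱 x ∈ symDeg 𝒱 i :=
  Submodule.mem_map_of_mem hx

theorem tprod_mul_tprod {m n : ℕ} (v : Fin m → V) (w : Fin n → V) :
    TensorAlgebra.tprod k V m v * TensorAlgebra.tprod k V n w =
      TensorAlgebra.tprod k V (m + n) (Fin.append v w) := by
  simp only [TensorAlgebra.tprod_apply, ← List.prod_append]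
  congr 1
  rw [← List.ofFn_fin_append]
  congr 1
  funext i
  refine Fin.addCases (fun i => ?_) (fun i => ?_) i <;> simp

theorem tprod_one (x : V) :
    TensorAlgebra.tprod k V 1 (fun _ => x) = TensorAlgebra.ι k x := by
  simp [TensorAlgebra.tprod_apply]

/-- The inclusion of `V` in `Λᶜ V`. -/
def symι (𝒱 : ℤ → Submodule k V) : V →ₗ[k] Sym 𝒱 :=
  (symMk 𝒱).toLinearMap ∘ₗ TensorAlgebra.ι k

theorem symι_apply (𝒱 : ℤ → Submodule k V) (x : V) :
    symι 𝒱 x = symMk 𝒱 (TensorAlgebra.ι k x) := rfl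

theorem symι_mul_symι {𝒱 : ℤ → Submodule k V} {i j : ℤ} {x y : V} (hx : x ∈ 𝒱 i)
    (hy : y ∈ 𝒱 j) :
    symι 𝒱 x * symι 𝒱 y = (i * j).negOnePow • (symι 𝒱 y * symι 𝒱 x) := by
  have := RingQuot.mkAlgHom_rel k (SymRel.swap hx hy)
  rw [Units.smul_def, ← Int.cast_smul_eq_zsmul k] at this ⊢
  simpa [symι, symMk] using this

theorem ι_mem_tensorDeg {𝒱 : ℤ → Submodule k V} {i : ℤ} {x : V} (hx : x ∈ 𝒱 i) :
    TensorAlgebra.ι k x ∈ tensorDeg 𝒱 i :=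
  Submodule.subset_span ⟨1, fun _ => i, fun _ => x, fun _ => hx, by simp, (tprod_one x).symm⟩

theorem symι_mem_symDeg {𝒱 : ℤ → Submodule k V} {i : ℤ} {x : V} (hx : x ∈ 𝒱 i) :
    symι 𝒱 x ∈ symDeg 𝒱 i :=
  symMk_mem_symDeg (ι_mem_tensorDeg hx)

instance tensorDeg_gradedMonoid (𝒱 : ℤ → Submodule k V) :
    SetLike.GradedMonoid (tensorDeg 𝒱) where
  one_mem := Submodule.subset_span ⟨0, Fin.elim0, Fin.elim0, fun t => t.elim0, by simp,
    by simp [TensorAlgebra.tprod_apply]⟩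
  mul_mem i j x y hx hy := by
    unfold tensorDeg at hx hy
    induction hx, hy using Submodule.span_induction₂ with
    | mem_mem x y hx hy =>
      obtain ⟨m, d, v, hv, hd, rfl⟩ := hx
      obtain ⟨n, e, w, hw, he, rfl⟩ := hy
      refine Submodule.subset_span ⟨m + n, Fin.append d e, Fin.append v w, ?_, ?_,
        tprod_mul_tprod v w⟩
      · intro t
        refine Fin.addCases (fun t => ?_) (fun t => ?_) t <;> simp [hv, hw]
      · simp [Fin.sum_univ_add, hd, he]
    | zero_left y hy => simp
    | zero_right x hx => simp
    | add_left x y z _ _ _ h1 h2 => rw [add_mul]; exact add_mem h1 h2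
    | add_right x y z _ _ _ h1 h2 => rw [mul_add]; exact add_mem h1 h2
    | smul_left r x y _ _ h => rw [smul_mul_assoc]; exact Submodule.smul_mem _ _ h
    | smul_right r x y _ _ h => rw [mul_smul_comm]; exact Submodule.smul_mem _ _ h

instance symDeg_gradedMonoid (𝒱 : ℤ → Submodule k V) :
    SetLike.GradedMonoid (symDeg 𝒱) where
  one_mem := ⟨1, SetLike.GradedOne.one_mem, map_one (symMk 𝒱)⟩
  mul_mem := by
    rintro i j _ _ ⟨x, hx, rfl⟩ ⟨y, hy, rfl⟩
    exact ⟨x * y, SetLike.GradedMul.mul_mem hx hy, map_mul (symMk 𝒱) _ _⟩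

variable (𝒱 : ℤ → Submodule k V)

theorem tprod_mem_tensorDeg {n : ℕ} {d : Fin n → ℤ} {v : Fin n → V}
    (hv : ∀ t, v t ∈ 𝒱 (d t)) : TensorAlgebra.tprod k V n v ∈ tensorDeg 𝒱 (∑ t, d t) :=
  Submodule.subset_span ⟨n, d, v, hv, rfl, rfl⟩

theorem tprod_succ {n : ℕ} (v : Fin (n + 1) → V) :
    TensorAlgebra.tprod k V (n + 1) v =
      TensorAlgebra.ι k (v 0) * TensorAlgebra.tprod k V n (fun t => v t.succ) := by
  simp [TensorAlgebra.tprod_apply]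

/-- Auxiliary: an algebra map to `⨁ 𝒢 i` lifting `V → 𝒢` sends homogeneous tensors to the
expected component. -/
theorem lift_homogeneous {A : Type*} [Ring A] [Algebra k A] (𝒢 : ℤ → Submodule k A)
    [SetLike.GradedMonoid 𝒢] (q : TensorAlgebra k V →ₐ[k] A)
    (hq : ∀ i, ∀ x ∈ tensorDeg 𝒱 i, q x ∈ 𝒢 i) (φ : TensorAlgebra k V →ₐ[k] ⨁ i, 𝒢 i)
    (hφ : ∀ i, ∀ x, ∀ hx : x ∈ 𝒱 i, φ (TensorAlgebra.ι k x) =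
      DirectSum.of (fun i => 𝒢 i) i ⟨q (TensorAlgebra.ι k x), hq _ _ (ι_mem_tensorDeg hx)⟩)
    {i : ℤ} {x : TensorAlgebra k V} (hx : x ∈ tensorDeg 𝒱 i) :
    φ x = DirectSum.of (fun i => 𝒢 i) i ⟨q x, hq i x hx⟩ := by
  have key : ∀ (n : ℕ) (d : Fin n → ℤ) (v : Fin n → V) (hv : ∀ t, v t ∈ 𝒱 (d t)),
      φ (TensorAlgebra.tprod k V n v) = DirectSum.of (fun i => 𝒢 i) (∑ t, d t)
        ⟨q (TensorAlgebra.tprod k V n v), hq _ _ (tprod_mem_tensorDeg 𝒱 hv)⟩ := by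
    intro n
    induction n with
    | zero =>
      intro d v hv
      have h1 : TensorAlgebra.tprod k V 0 v = 1 := by simp [TensorAlgebra.tprod_apply]
      refine (congrArg φ h1).trans ?_
      rw [map_one, DirectSum.one_def]
      refine DirectSum.of_eq_of_gradedMonoid_eq (Sigma.subtype_ext ?_ ?_)
      · change (0 : ℤ) = ∑ t, d t
        simp
      · change (1 : A) = q (TensorAlgebra.tprod k V 0 v)
        rw [h1, map_one]
    | succ n ih =>
      intro d v hv
      have h1 := ih (fun t => d t.succ) (fun t => v t.succ) (fun t => hv t.succ)
      refine (congrArg φ (tprod_succ v)).trans ?_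
      rw [map_mul, h1, hφ (d 0) (v 0) (hv 0), DirectSum.of_mul_of]
      refine DirectSum.of_eq_of_gradedMonoid_eq (Sigma.subtype_ext ?_ ?_)
      · change d 0 + ∑ t : Fin n, d t.succ = ∑ t, d t
        rw [Fin.sum_univ_succ]
      · change q _ * q _ = q _
        rw [tprod_succ, map_mul]
  have hx' := hx
  unfold tensorDeg at hx'
  induction hx' using Submodule.span_induction with
  | mem x h =>
    obtain ⟨n, d, v, hv, rfl, rfl⟩ := h
    exact key n d v hv
  | zero =>
    rw [map_zero, eq_comm]
    convert map_zero (DirectSum.of (fun i => 𝒢 i) i)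
    simp
  | add x y hx1 hy1 h1 h2 =>
    rw [map_add, h1 hx1, h2 hy1, ← map_add]
    congr 1
    exact Subtype.ext (map_add q x y).symm
  | smul r x hx1 h1 =>
    rw [map_smul, h1 hx1, ← DirectSum.lof_eq_of k, ← DirectSum.lof_eq_of k]
    exact ((DirectSum.lof k ℤ (fun i => 𝒢 i) i).map_smul r ⟨q x, hq i x hx1⟩).symm.trans
      (congrArg _ (Subtype.ext (map_smul q r x).symm))

theorem wedge_block {n : ℕ} (v : Fin n → V) (S : Finset (Fin n)) :
    wedge 𝒱 (block v S) = ((S.sort (· ≤ ·)).map fun i => symι 𝒱 (v i)).prod := by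
  rw [wedge, TensorAlgebra.tprod_apply, map_list_prod, ← Finset.listMap_orderEmbOfFin_finRange S rfl,
    List.ofFn_eq_map, List.map_map, List.map_map]
  rfl

theorem sort_map_succ {n : ℕ} (S : Finset (Fin n)) :
    (S.map (Fin.succEmb n)).sort (· ≤ ·) = (S.sort (· ≤ ·)).map Fin.succ :=
  ((Finset.map_sort (f := Fin.succEmb n) (r := (· ≤ ·)) (r' := (· ≤ ·)) (s := S)
    (by simp)).symm)

theorem wedge_block_map_succ {n : ℕ} (v : Fin (n + 1) → V) (S : Finset (Fin n)) :
    wedge 𝒱 (block v (S.map (Fin.succEmb n))) = wedge 𝒱 (block (fun t => v t.succ) S) := by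
  rw [wedge_block, wedge_block, sort_map_succ, List.map_map]
  rfl

theorem wedge_block_cons {n : ℕ} (v : Fin (n + 1) → V) (S : Finset (Fin n)) :
    wedge 𝒱 (block v (insert 0 (S.map (Fin.succEmb n)))) =
      symι 𝒱 (v 0) * wedge 𝒱 (block (fun t => v t.succ) S) := by
  rw [wedge_block, wedge_block, Finset.sort_insert, sort_map_succ, List.map_cons, List.prod_cons,
    List.map_map]
  · rfl
  · simp
  · simp

theorem sum_finset_fin_succ {M : Type*} [AddCommMonoid M] {n : ℕ}
    (f : Finset (Fin (n + 1)) → M) :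
    ∑ S, f S = ∑ S : Finset (Fin n), (f (insert 0 (S.map (Fin.succEmb n))) +
      f (S.map (Fin.succEmb n))) := by
  have key : ∀ g : Finset (Fin (n + 1)) → M,
      ∑ S ∈ (Finset.univ.map (Fin.succEmb n)).powerset, g S =
        ∑ S : Finset (Fin n), g (S.map (Fin.succEmb n)) := by
    intro g
    refine (Finset.sum_bij (fun S _ => S.map (Fin.succEmb n)) ?_ ?_ ?_ ?_).symm
    · intro S _
      exact Finset.mem_powerset.2 (Finset.map_subset_map.2 (Finset.subset_univ S))
    · intro S _ T _ h
      exact Finset.map_injective _ h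
    · intro T hT
      obtain ⟨S, _, rfl⟩ := Finset.subset_map_iff.1 (Finset.mem_powerset.1 hT)
      exact ⟨S, Finset.mem_univ _, rfl⟩
    · intro S _
      rfl
  rw [← Finset.powerset_univ, Fin.univ_succ, Finset.cons_eq_insert,
    Finset.sum_powerset_insert (by simp), add_comm, Finset.sum_add_distrib]
  exact congrArg₂ _ (key fun S => f (insert 0 S)) (key f)

theorem compl_map_succ {n : ℕ} (S : Finset (Fin n)) :
    (S.map (Fin.succEmb n))ᶜ = insert 0 (Sᶜ.map (Fin.succEmb n)) := by
  ext i
  refine Fin.cases ?_ (fun i => ?_) i <;> simp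

theorem compl_insert_map_succ {n : ℕ} (S : Finset (Fin n)) :
    (insert 0 (S.map (Fin.succEmb n)))ᶜ = Sᶜ.map (Fin.succEmb n) := by
  ext i
  refine Fin.cases ?_ (fun i => ?_) i <;> simp

theorem unshuffleSign_insert {n : ℕ} (d : Fin (n + 1) → ℤ) (S : Finset (Fin n)) :
    unshuffleSign d (insert 0 (S.map (Fin.succEmb n))) =
      unshuffleSign (fun t => d t.succ) S := by
  rw [unshuffleSign, compl_insert_map_succ, Finset.prod_insert (by simp)]
  simp [unshuffleSign]

theorem unshuffleSign_map {n : ℕ} (d : Fin (n + 1) → ℤ) (S : Finset (Fin n)) :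
    unshuffleSign d (S.map (Fin.succEmb n)) =
      (d 0 * ∑ i ∈ S, d i.succ).negOnePow * unshuffleSign (fun t => d t.succ) S := by
  have : ∀ S : Finset (Fin n), (d 0 * ∑ i ∈ S, d i.succ).negOnePow =
      ∏ i ∈ S, (d i.succ * d 0).negOnePow := by
    intro S
    induction S using Finset.induction_on with
    | empty => simp
    | insert a S ha ih =>
      rw [Finset.sum_insert ha, Finset.prod_insert ha, mul_add, Int.negOnePow_add, ih,
        mul_comm (d 0)]
  rw [unshuffleSign, compl_map_succ, this, unshuffleSign, ← Finset.prod_mul_distrib]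
  simp

theorem wedge_block_mem {n : ℕ} {d : Fin n → ℤ} {v : Fin n → V} (hv : ∀ t, v t ∈ 𝒱 (d t))
    (S : Finset (Fin n)) : wedge 𝒱 (block v S) ∈ symDeg 𝒱 (∑ i ∈ S, d i) := by
  have h := symMk_mem_symDeg (tprod_mem_tensorDeg 𝒱 (d := block d S) (v := block v S)
    (fun t => hv _))
  have hs : ∑ t, block d S t = ∑ i ∈ S, d i := by
    conv_rhs => rw [← Finset.map_orderEmbOfFin_univ S rfl, Finset.sum_map]
    rfl
  rwa [hs] at h

variable [DirectSum.Decomposition 𝒱]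

/-- Auxiliary: the linear map `V → ⨁ 𝒢 i` induced by a degree preserving linear map `V → A`. -/
def gradedLift {A : Type*} [Ring A] [Algebra k A] (𝒢 : ℤ → Submodule k A)
    (f : V →ₗ[k] A) (hf : ∀ i, ∀ x ∈ 𝒱 i, f x ∈ 𝒢 i) : V →ₗ[k] ⨁ i, 𝒢 i :=
  (DirectSum.toModule k ℤ _ fun i =>
      DirectSum.lof k ℤ (fun i => 𝒢 i) i ∘ₗ (f ∘ₗ (𝒱 i).subtype).codRestrict (𝒢 i)
        (fun x => hf i x x.2)) ∘ₗ
    (DirectSum.decomposeLinearEquiv 𝒱).toLinearMap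

theorem gradedLift_apply {A : Type*} [Ring A] [Algebra k A] (𝒢 : ℤ → Submodule k A)
    (f : V →ₗ[k] A) (hf : ∀ i, ∀ x ∈ 𝒱 i, f x ∈ 𝒢 i) {i : ℤ} {x : V} (hx : x ∈ 𝒱 i) :
    gradedLift 𝒱 𝒢 f hf x = DirectSum.of (fun i => 𝒢 i) i ⟨f x, hf i x hx⟩ := by
  lift x to 𝒱 i using hx
  simp [gradedLift, ← DirectSum.lof_eq_of k]
  rfl

theorem coe_gradedLift {A : Type*} [Ring A] [Algebra k A] (𝒢 : ℤ → Submodule k A)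
    [SetLike.GradedMonoid 𝒢]
    (f : V →ₗ[k] A) (hf : ∀ i, ∀ x ∈ 𝒱 i, f x ∈ 𝒢 i) (x : V) :
    DirectSum.coeAlgHom 𝒢 (gradedLift 𝒱 𝒢 f hf x) = f x := by
  induction x using DirectSum.Decomposition.inductionOn 𝒱 with
  | zero => simp
  | homogeneous x => rw [gradedLift_apply 𝒱 𝒢 f hf x.2, DirectSum.coeAlgHom_of]
  | add x y hx hy => simp only [map_add, hx, hy]

instance tensorDeg_gradedAlgebra : GradedAlgebra (tensorDeg 𝒱) :=
  GradedAlgebra.ofAlgHom (tensorDeg 𝒱)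
    (TensorAlgebra.lift k (gradedLift 𝒱 (tensorDeg 𝒱) (TensorAlgebra.ι k)
      fun _ _ hx => ι_mem_tensorDeg hx))
    (by
      ext x
      simp [coe_gradedLift])
    (fun i x => lift_homogeneous 𝒱 (tensorDeg 𝒱) (AlgHom.id k _) (fun _ _ h => h) _
      (fun i x hx => by
        rw [TensorAlgebra.lift_ι_apply]
        exact gradedLift_apply 𝒱 _ _ _ hx) x.2)

/-- Auxiliary: the algebra map `Λᶜ V → ⨁ᵢ (Λᶜ V)ᵢ` giving the decomposition by degree. -/
def symDecomp : Sym 𝒱 →ₐ[k] ⨁ i, symDeg 𝒱 i :=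
  RingQuot.liftAlgHom k ⟨TensorAlgebra.lift k (gradedLift 𝒱 (symDeg 𝒱) (symι 𝒱)
      fun _ _ hx => symι_mem_symDeg hx), by
    rintro _ _ ⟨hx, hy⟩
    rename_i i j x y
    rw [Units.smul_def, ← Int.cast_smul_eq_zsmul k]
    simp only [map_mul, map_smul, TensorAlgebra.lift_ι_apply]
    rw [gradedLift_apply 𝒱 _ _ _ hx, gradedLift_apply 𝒱 _ _ _ hy, DirectSum.of_mul_of,
      DirectSum.of_mul_of, ← DirectSum.lof_eq_of k, ← DirectSum.lof_eq_of k, ← map_smul,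
      DirectSum.lof_eq_of, DirectSum.lof_eq_of]
    refine DirectSum.of_eq_of_gradedMonoid_eq (Sigma.subtype_ext (add_comm i j) ?_)
    have := symι_mul_symι hx hy
    rw [Units.smul_def, ← Int.cast_smul_eq_zsmul k] at this
    exact this⟩

theorem symDecomp_symι (x : V) : symDecomp 𝒱 (symι 𝒱 x) =
    gradedLift 𝒱 (symDeg 𝒱) (symι 𝒱) (fun _ _ hx => symι_mem_symDeg hx) x := by
  simp [symDecomp, symMk, symι_apply]

instance symDeg_gradedAlgebra : GradedAlgebra (symDeg 𝒱) :=
  GradedAlgebra.ofAlgHom (symDeg 𝒱) (symDecomp 𝒱)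
    (by
      apply RingQuot.ringQuot_ext'
      ext x
      change DirectSum.coeAlgHom _ (symDecomp 𝒱 (symι 𝒱 x)) = _
      rw [symDecomp_symι, coe_gradedLift]
      rfl)
    (by
      rintro i ⟨_, x, hx, rfl⟩
      exact lift_homogeneous 𝒱 (symDeg 𝒱) (symMk 𝒱)
        (fun _ _ h => symMk_mem_symDeg h) ((symDecomp 𝒱).comp (symMk 𝒱))
        (fun i x hx => by
          exact (symDecomp_symι 𝒱 x).trans (gradedLift_apply 𝒱 _ _ _ hx)) hx)

open GradedTensorProduct in
theorem includeRight_mul_includeLeft {i j : ℤ} {x y : V} (hx : x ∈ 𝒱 i) (hy : y ∈ 𝒱 j) :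
    includeRight (symDeg 𝒱) (symDeg 𝒱) (symι 𝒱 x) *
        includeLeft (symDeg 𝒱) (symDeg 𝒱) (symι 𝒱 y) =
      (i * j).negOnePow • (includeLeft (symDeg 𝒱) (symDeg 𝒱) (symι 𝒱 y) *
        includeRight (symDeg 𝒱) (symDeg 𝒱) (symι 𝒱 x)) := by
  have h := tmul_coe_mul_coe_tmul (R := k) (symDeg 𝒱) (symDeg 𝒱) (1 : Sym 𝒱)
    (⟨_, symι_mem_symDeg hx⟩ : symDeg 𝒱 i) (⟨_, symι_mem_symDeg hy⟩ : symDeg 𝒱 j) (1 : Sym 𝒱)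
  have h' := tmul_one_mul_one_tmul (R := k) (symDeg 𝒱) (symDeg 𝒱) (symι 𝒱 y) (symι 𝒱 x)
  rw [one_mul, mul_one] at h
  simp only [includeRight_apply, includeLeft_apply, h']
  exact h

open GradedTensorProduct in
/-- The coproduct of `Λᶜ V`, as the algebra map to the graded tensor product of `Λᶜ V` with
itself (multiplied with Koszul signs) such that `v ↦ v ⊗ 1 + 1 ⊗ v` for `v` in `V`. -/
def symComulAlg : Sym 𝒱 →ₐ[k] (symDeg 𝒱 ᵍ⊗[k] symDeg 𝒱) :=
  RingQuot.liftAlgHom k ⟨TensorAlgebra.lift k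
      (((includeLeft (symDeg 𝒱) (symDeg 𝒱)).toLinearMap +
        (includeRight (symDeg 𝒱) (symDeg 𝒱)).toLinearMap) ∘ₗ symι 𝒱), by
    rintro _ _ ⟨hx, hy⟩
    rename_i i j x y
    have h := symι_mul_symι hx hy
    have hL := congrArg (includeLeft (R := k) (symDeg 𝒱) (symDeg 𝒱)) h
    have hR := congrArg (includeRight (R := k) (symDeg 𝒱) (symDeg 𝒱)) h
    have h1 := includeRight_mul_includeLeft 𝒱 hx hy
    have h2 := includeRight_mul_includeLeft 𝒱 hy hx
    have hs : ((i * j).negOnePow : ℤ) * (i * j).negOnePow = 1 := by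
      rw [← Units.val_mul, Int.units_mul_self, Units.val_one]
    rw [mul_comm j i] at h2
    generalize (i * j).negOnePow = u at *
    simp only [Units.smul_def, map_zsmul, map_mul] at *
    simp only [TensorAlgebra.lift_ι_apply, LinearMap.comp_apply, LinearMap.add_apply,
      AlgHom.toLinearMap_apply, mul_add, add_mul, smul_add]
    rw [hL, hR, h1, h2, smul_smul, hs, one_smul]
    abel⟩

/-- The coproduct of `Λᶜ V` (see `symComul_wedge` for the formula). -/
def symComul : Sym 𝒱 →ₗ[k] Sym 𝒱 ⊗[k] Sym 𝒱 :=
  (GradedTensorProduct.of k (symDeg 𝒱) (symDeg 𝒱)).symm.toLinearMap ∘ₗ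
    (symComulAlg 𝒱).toLinearMap

theorem symComulAlg_symι (x : V) : symComulAlg 𝒱 (symι 𝒱 x) =
    GradedTensorProduct.tmul k (symι 𝒱 x) 1 + GradedTensorProduct.tmul k 1 (symι 𝒱 x) := by
  simp [symComulAlg, symι_apply, symMk]

/-- The unshuffle formula for the coproduct of `Λᶜ V`. -/
theorem symComul_wedge {n : ℕ} (d : Fin n → ℤ) (v : Fin n → V) (hv : ∀ t, v t ∈ 𝒱 (d t)) :
    symComul 𝒱 (wedge 𝒱 v) = ∑ S : Finset (Fin n),
      ((unshuffleSign d S : ℤ) : k) •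
        (wedge 𝒱 (block v S) ⊗ₜ[k] wedge 𝒱 (block v Sᶜ)) := by
  suffices h : symComulAlg 𝒱 (wedge 𝒱 v) = ∑ S : Finset (Fin n),
      ((unshuffleSign d S : ℤ) : k) •
      GradedTensorProduct.tmul k (wedge 𝒱 (block v S)) (wedge 𝒱 (block v Sᶜ)) by
    rw [symComul, LinearMap.comp_apply, AlgHom.toLinearMap_apply, h]
    rfl
  induction n with
  | zero =>
    have h1 : ∀ S : Finset (Fin 0), wedge 𝒱 (block v S) = 1 := by
      intro S
      obtain rfl : S = ∅ := Subsingleton.elim _ _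
      rw [wedge_block]
      simp
    have h2 : wedge 𝒱 v = 1 := by simp [wedge, TensorAlgebra.tprod_apply]
    have h3 : ∀ S : Finset (Fin 0), unshuffleSign d S = 1 := by
      intro S
      obtain rfl : S = ∅ := Subsingleton.elim _ _
      simp [unshuffleSign]
    simp only [h1, h2, h3, map_one, Units.val_one, Int.cast_one, one_smul, Finset.sum_const, Finset.card_univ]
    simp
    rfl
  | succ n ih =>
    have h0 : wedge 𝒱 v = symι 𝒱 (v 0) * wedge 𝒱 (fun t => v t.succ) := by
      rw [wedge, tprod_succ, map_mul]
      rfl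
    rw [h0, map_mul, ih (fun t => d t.succ) _ (fun t => hv t.succ), sum_finset_fin_succ,
      Finset.mul_sum]
    refine Finset.sum_congr rfl fun S _ => ?_
    rw [compl_map_succ, compl_insert_map_succ, wedge_block_cons, wedge_block_cons,
      wedge_block_map_succ, wedge_block_map_succ, unshuffleSign_insert, unshuffleSign_map,
      symComulAlg_symι, add_mul]
    have e1 := GradedTensorProduct.tmul_one_mul_coe_tmul (R := k) (symDeg 𝒱) (symDeg 𝒱)
      (symι 𝒱 (v 0))
      ⟨_, wedge_block_mem 𝒱 (d := fun t => d t.succ) (fun t => hv t.succ) S⟩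
      (wedge 𝒱 (block (fun t => v t.succ) Sᶜ))
    have e2 := GradedTensorProduct.tmul_coe_mul_coe_tmul (R := k) (symDeg 𝒱) (symDeg 𝒱) 1
      ⟨_, symι_mem_symDeg (hv 0)⟩
      ⟨_, wedge_block_mem 𝒱 (d := fun t => d t.succ) (fun t => hv t.succ) S⟩
      (wedge 𝒱 (block (fun t => v t.succ) Sᶜ))
    rw [one_mul] at e2
    rw [units_smul_eq (k := k)] at e2
    rw [mul_smul_comm, mul_smul_comm]
    refine congrArg₂ _ (congrArg _ e1) ((congrArg _ e2).trans ?_)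
    rw [smul_smul, mul_comm, Units.val_mul, Int.cast_mul]
    rfl

variable (k V) in
/-- Auxiliary: `v ↦ ((X, w) ↦ ((v ⊗ 1) X + 1 ⊗ v w, v w))`. -/
def deconcatStep : V →ₗ[k] Module.End k
    ((TensorAlgebra k V ⊗[k] TensorAlgebra k V) × TensorAlgebra k V) :=
  LinearMap.mk₂ k
    (fun v Xw => ((TensorAlgebra.ι k v ⊗ₜ[k] 1) * Xw.1 +
      1 ⊗ₜ[k] (TensorAlgebra.ι k v * Xw.2), TensorAlgebra.ι k v * Xw.2))
    (fun v v' x => by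
      ext <;> simp [TensorProduct.add_tmul, TensorProduct.tmul_add, add_mul]
      abel)
    (fun r v x => by
      ext <;> simp [← TensorProduct.smul_tmul'])
    (fun v x y => by
      ext <;> simp [TensorProduct.tmul_add, mul_add]
      abel)
    (fun r v x => by
      ext <;> simp)

variable (k V) in
/-- The deconcatenation coproduct of the tensor coalgebra `Tᶜ V`, constructed by the recursion
`Δ 1 = 1 ⊗ 1`, `Δ (v ⊗ w) = (v ⊗ 1) Δ w + 1 ⊗ (v ⊗ w)`
(see `deconcat_tprod` for the formula). -/
def deconcat : TensorAlgebra k V →ₗ[k] TensorAlgebra k V ⊗[k] TensorAlgebra k V :=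
  LinearMap.fst k _ _ ∘ₗ (LinearMap.applyₗ ((1 : TensorAlgebra k V ⊗[k] TensorAlgebra k V),
    (1 : TensorAlgebra k V))) ∘ₗ
    (TensorAlgebra.lift k (deconcatStep k V)).toLinearMap

theorem deconcat_tprod (n : ℕ) (v : Fin n → V) :
    deconcat k V (TensorAlgebra.tprod k V n v) = ∑ i : Fin (n + 1),
      TensorAlgebra.tprod k V i (fun t => v ⟨t, by omega⟩) ⊗ₜ[k]
        TensorAlgebra.tprod k V (n - i) (fun t => v ⟨i + t, by omega⟩) := by
  have key : ∀ (n : ℕ) (v : Fin n → V),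
      TensorAlgebra.lift k (deconcatStep k V) (TensorAlgebra.tprod k V n v)
        (1, 1) = (∑ i : Fin (n + 1),
      TensorAlgebra.tprod k V i (fun t => v ⟨t, by omega⟩) ⊗ₜ[k]
        TensorAlgebra.tprod k V (n - i) (fun t => v ⟨i + t, by omega⟩),
        TensorAlgebra.tprod k V n v) := by
    intro n
    induction n with
    | zero =>
      intro v
      simp [TensorAlgebra.tprod_apply, Algebra.TensorProduct.one_def]
    | succ n ih =>
      intro v
      rw [tprod_succ, map_mul, Module.End.mul_apply, ih, TensorAlgebra.lift_ι_apply]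
      refine Prod.ext ?_ rfl
      rw [Fin.sum_univ_succ (n := n + 1)]
      change TensorAlgebra.ι k (v 0) ⊗ₜ[k] (1 : TensorAlgebra k V) * (∑ i : Fin (n + 1), _) +
        (1 : TensorAlgebra k V) ⊗ₜ[k] (TensorAlgebra.ι k (v 0) * _) = _
      rw [add_comm, Finset.mul_sum]
      refine congrArg₂ _ ?_ (Finset.sum_congr rfl fun i _ => ?_)
      · rw [← tprod_succ]
        refine congrArg₂ (fun x y => x ⊗ₜ[k] y) ?_ ?_
        · exact (by simp [TensorAlgebra.tprod_apply] : ∀ w : Fin 0 → V,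
            (1 : TensorAlgebra k V) = TensorAlgebra.tprod k V 0 w) _
        · exact congrArg (TensorAlgebra.tprod k V (n + 1)) (funext fun t => by simp)
      · rw [Algebra.TensorProduct.tmul_mul_tmul, one_mul]
        simp only [Fin.val_succ]
        rw [tprod_succ]
        refine congrArg₂ (fun x y => x ⊗ₜ[k] y) rfl ?_
        simp only [TensorAlgebra.tprod_apply]
        rw [List.ofFn_congr (show n - i.val = n + 1 - (i.val + 1) by omega)]
        congr 2
        funext t
        congr 2
        ext
        simp
        omega
  exact congrArg Prod.fst (key n v)

/-- The counit of `Λᶜ V`: the projection to `Λ⁰ = k`. -/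
def symCounit : Sym 𝒱 →ₗ[k] k :=
  (RingQuot.liftAlgHom k ⟨TensorAlgebra.algebraMapInv, by
    rintro _ _ ⟨hx, hy⟩
    simp [TensorAlgebra.algebraMapInv, Units.smul_def]⟩ : Sym 𝒱 →ₐ[k] k).toLinearMap

/-- The Koszul sign operator `x ↦ (-1)^{|x|} x` on a graded vector space. -/
def parity {M : Type*} [AddCommGroup M] [Module k M] (𝒟 : ℤ → Submodule k M)
    [DirectSum.Decomposition 𝒟] : M →ₗ[k] M :=
  (DirectSum.toModule k ℤ M fun i => ((i.negOnePow : ℤ) : k) • (𝒟 i).subtype) ∘ₗ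
    (DirectSum.decomposeLinearEquiv 𝒟).toLinearMap

theorem parity_apply {M : Type*} [AddCommGroup M] [Module k M] (𝒟 : ℤ → Submodule k M)
    [DirectSum.Decomposition 𝒟] {i : ℤ} {x : M} (hx : x ∈ 𝒟 i) :
    parity 𝒟 x = ((i.negOnePow : ℤ) : k) • x := by
  lift x to 𝒟 i using hx
  rw [parity, LinearMap.comp_apply, LinearEquiv.coe_coe, DirectSum.decomposeLinearEquiv_apply,
    DirectSum.decompose_coe, ← DirectSum.lof_eq_of k, DirectSum.toModule_lof]
  rfl

end Algebras

section OpenClosed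

variable {k Hc Ho : Type*} [Field k] [AddCommGroup Hc] [Module k Hc]
  [AddCommGroup Ho] [Module k Ho]

/-- The underlying space of the coalgebra `Λᶜ Hc ⊗ Tᶜ Ho`. -/
abbrev OC (𝒜 : ℤ → Submodule k Hc) (_ℬ : ℤ → Submodule k Ho) : Type _ :=
  Sym 𝒜 ⊗[k] TensorAlgebra k Ho

/-- The homogeneous elements of internal degree `i` of `Λᶜ Hc ⊗ Tᶜ Ho`. -/
def ocDeg (𝒜 : ℤ → Submodule k Hc) (ℬ : ℤ → Submodule k Ho) (i : ℤ) :
    Submodule k (OC 𝒜 ℬ) :=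
  Submodule.span k {x | ∃ a b : ℤ, a + b = i ∧ ∃ s ∈ symDeg 𝒜 a, ∃ t ∈ tensorDeg ℬ b,
    x = s ⊗ₜ[k] t}

variable (𝒜 : ℤ → Submodule k Hc) (ℬ : ℤ → Submodule k Ho)

/-- `(u₁ ∧ ⋯ ∧ uₚ) ⊗ (v₁ ⊗ ⋯ ⊗ v_q)`. -/
def ocMk {p q : ℕ} (u : Fin p → Hc) (v : Fin q → Ho) : OC 𝒜 ℬ :=
  wedge 𝒜 u ⊗ₜ[k] TensorAlgebra.tprod k Ho q v

/-- The counit of `Λᶜ Hc ⊗ Tᶜ Ho`: the projection to `Λ⁰ Hc ⊗ T⁰ Ho = k`. -/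
def ocCounit : OC 𝒜 ℬ →ₗ[k] k :=
  LinearMap.mul' k k ∘ₗ
    TensorProduct.map (symCounit 𝒜) (TensorAlgebra.algebraMapInv (M := Ho)).toLinearMap

variable [DirectSum.Decomposition 𝒜] [DirectSum.Decomposition ℬ]

/-- The Koszul flip `s ⊗ t ↦ (-1)^{|s||t|} t ⊗ s` from `Λᶜ Hc ⊗ Tᶜ Ho` to
`Tᶜ Ho ⊗ Λᶜ Hc`. -/
def koszulFlip : Sym 𝒜 ⊗[k] TensorAlgebra k Ho →ₗ[k] TensorAlgebra k Ho ⊗[k] Sym 𝒜 :=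
  (GradedTensorProduct.of k (tensorDeg ℬ) (symDeg 𝒜)).symm.toLinearMap ∘ₗ
    (GradedTensorProduct.comm (symDeg 𝒜) (tensorDeg ℬ)).toLinearMap ∘ₗ
    (GradedTensorProduct.of k (symDeg 𝒜) (tensorDeg ℬ)).toLinearMap

theorem koszulFlip_tmul {i j : ℤ} {x : Sym 𝒜} {y : TensorAlgebra k Ho}
    (hx : x ∈ symDeg 𝒜 i) (hy : y ∈ tensorDeg ℬ j) :
    koszulFlip 𝒜 ℬ (x ⊗ₜ[k] y) = (((i * j).negOnePow : ℤ) : k) • (y ⊗ₜ[k] x) := by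
  have h := GradedTensorProduct.comm_coe_tmul_coe (R := k) (symDeg 𝒜) (tensorDeg ℬ)
    ⟨x, hx⟩ ⟨y, hy⟩
  rw [mul_comm]
  exact h.trans (units_smul_eq (M := tensorDeg ℬ ᵍ⊗[k] symDeg 𝒜) _ _)

/-- `(s ⊗ s') ⊗ (t ⊗ t') ↦ (-1)^{|s'||t|} (s ⊗ t) ⊗ (s' ⊗ t')`. -/
def middleFlip : (Sym 𝒜 ⊗[k] Sym 𝒜) ⊗[k] (TensorAlgebra k Ho ⊗[k] TensorAlgebra k Ho) →ₗ[k]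
    OC 𝒜 ℬ ⊗[k] OC 𝒜 ℬ :=
  (TensorProduct.assoc k (Sym 𝒜) (TensorAlgebra k Ho) (OC 𝒜 ℬ)).symm.toLinearMap ∘ₗ
  LinearMap.lTensor (Sym 𝒜)
    ((TensorProduct.assoc k (TensorAlgebra k Ho) (Sym 𝒜) (TensorAlgebra k Ho)).toLinearMap ∘ₗ
      LinearMap.rTensor (TensorAlgebra k Ho) (koszulFlip 𝒜 ℬ) ∘ₗ
      (TensorProduct.assoc k (Sym 𝒜) (TensorAlgebra k Ho)
        (TensorAlgebra k Ho)).symm.toLinearMap) ∘ₗ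
  (TensorProduct.assoc k (Sym 𝒜) (Sym 𝒜)
    (TensorAlgebra k Ho ⊗[k] TensorAlgebra k Ho)).toLinearMap

theorem middleFlip_tmul {i j : ℤ} (x : Sym 𝒜) {x' : Sym 𝒜} {y : TensorAlgebra k Ho}
    (y' : TensorAlgebra k Ho) (hx : x' ∈ symDeg 𝒜 i) (hy : y ∈ tensorDeg ℬ j) :
    middleFlip 𝒜 ℬ ((x ⊗ₜ[k] x') ⊗ₜ[k] (y ⊗ₜ[k] y')) =
      (((i * j).negOnePow : ℤ) : k) • ((x ⊗ₜ[k] y) ⊗ₜ[k] (x' ⊗ₜ[k] y')) := by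
  simp only [middleFlip, LinearMap.comp_apply, LinearEquiv.coe_coe, TensorProduct.assoc_tmul,
    LinearMap.lTensor_tmul, TensorProduct.assoc_symm_tmul, LinearMap.rTensor_tmul]
  rw [koszulFlip_tmul 𝒜 ℬ hx hy, ← TensorProduct.smul_tmul', map_smul, TensorProduct.tmul_smul,
    map_smul]
  rfl

/-- The coproduct of `Λᶜ Hc ⊗ Tᶜ Ho`: the coproducts of the two factors followed by the Koszul
flip of the two middle factors (see `ocComul_mk` for the formula). -/
def ocComul : OC 𝒜 ℬ →ₗ[k] OC 𝒜 ℬ ⊗[k] OC 𝒜 ℬ :=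
  middleFlip 𝒜 ℬ ∘ₗ TensorProduct.map (symComul 𝒜) (deconcat k Ho)

/-- The formula for the coproduct of `Λᶜ Hc ⊗ Tᶜ Ho` on homogeneous elements. -/
theorem ocComul_mk {p q : ℕ} (d : Fin p → ℤ) (e : Fin q → ℤ) (u : Fin p → Hc) (a : Fin q → Ho)
    (hu : ∀ t, u t ∈ 𝒜 (d t)) (ha : ∀ t, a t ∈ ℬ (e t)) :
    ocComul 𝒜 ℬ (ocMk 𝒜 ℬ u a) = ∑ S : Finset (Fin p), ∑ i : Fin (q + 1),
      (((unshuffleSign d S *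
        ((∑ j ∈ Sᶜ, d j) * ∑ t : Fin i, e ⟨t, by omega⟩).negOnePow : ℤˣ) : ℤ) : k) •
      (ocMk 𝒜 ℬ (block u S) (fun t : Fin i => a ⟨t, by omega⟩) ⊗ₜ[k]
        ocMk 𝒜 ℬ (block u Sᶜ) (fun t : Fin (q - i) => a ⟨i + t, by omega⟩)) := by
  rw [ocComul, ocMk, LinearMap.comp_apply, TensorProduct.map_tmul,
    symComul_wedge 𝒜 d u hu, deconcat_tprod, TensorProduct.sum_tmul]
  simp only [TensorProduct.tmul_sum, map_sum]
  refine Finset.sum_congr rfl fun S _ => Finset.sum_congr rfl fun i _ => ?_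
  have h := middleFlip_tmul 𝒜 ℬ (wedge 𝒜 (block u S))
    (TensorAlgebra.tprod k Ho (q - i) (fun t => a ⟨i + t, by omega⟩))
    (wedge_block_mem 𝒜 hu Sᶜ)
    (tprod_mem_tensorDeg ℬ (d := fun t : Fin i => e ⟨t, by omega⟩)
      (v := fun t : Fin i => a ⟨t, by omega⟩) (fun t => ha _))
  rw [Units.val_mul, Int.cast_mul, mul_smul, ← TensorProduct.smul_tmul', map_smul]
  exact congrArg _ h

/-- The Koszul sign operator `x ↦ (-1)^{|x|} x` on `Λᶜ Hc ⊗ Tᶜ Ho`. -/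
def ocParity : OC 𝒜 ℬ →ₗ[k] OC 𝒜 ℬ :=
  TensorProduct.map (parity (symDeg 𝒜)) (parity (tensorDeg ℬ))

/-- Coderivations of degree one of the coalgebra `Λᶜ Hc ⊗ Tᶜ Ho` vanishing on
`1 ∈ Λ⁰ Hc ⊗ T⁰ Ho`. By the Koszul rule, `1 ⊗ D` sends `x ⊗ y` to `(-1)^{|x|} x ⊗ D y`. -/
structure IsCoderivation (D : OC 𝒜 ℬ →ₗ[k] OC 𝒜 ℬ) : Prop where
  degree_one : ∀ i, ∀ x ∈ ocDeg 𝒜 ℬ i, D x ∈ ocDeg 𝒜 ℬ (i + 1)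
  coleibniz : (TensorProduct.map D LinearMap.id + TensorProduct.map (ocParity 𝒜 ℬ) D) ∘ₗ
    ocComul 𝒜 ℬ = ocComul 𝒜 ℬ ∘ₗ D
  counit : ocCounit 𝒜 ℬ ∘ₗ D = 0
  map_one : D (1 ⊗ₜ[k] 1) = 0

/-- Degree one coderivations with square zero. -/
structure IsCoderivationDifferential (D : OC 𝒜 ℬ →ₗ[k] OC 𝒜 ℬ) : Prop
    extends IsCoderivation 𝒜 ℬ D where
  square_zero : D ∘ₗ D = 0

end OpenClosed

section Structures

variable {k Hc Ho : Type*} [Field k] [AddCommGroup Hc] [Module k Hc]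
  [AddCommGroup Ho] [Module k Ho]

/-- Two families of graded symmetric multilinear operations of degree one,
`lₙ : Hc^{∧ n} → Hc` for `n ≥ 1` and `n_{p,q} : Hc^{∧ p} ⊗ Ho^{⊗ q} → Ho` for `p + q ≥ 1`.
The families are indexed by all `n` and all `p, q`, with `l₀ = 0` and `n_{0,0} = 0`. -/
structure Operations (𝒜 : ℤ → Submodule k Hc) (ℬ : ℤ → Submodule k Ho) where
  l : ∀ p : ℕ, MultilinearMap k (fun _ : Fin p => Hc) Hc
  n : ∀ p q : ℕ, MultilinearMap k (fun _ : Fin p => Hc)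
    (MultilinearMap k (fun _ : Fin q => Ho) Ho)
  l_zero : l 0 = 0
  n_zero : n 0 0 = 0
  l_degree : ∀ (p : ℕ) (d : Fin p → ℤ) (u : Fin p → Hc), (∀ t, u t ∈ 𝒜 (d t)) →
    l p u ∈ 𝒜 (∑ t, d t + 1)
  n_degree : ∀ (p q : ℕ) (d : Fin p → ℤ) (e : Fin q → ℤ) (u : Fin p → Hc) (a : Fin q → Ho),
    (∀ t, u t ∈ 𝒜 (d t)) → (∀ t, a t ∈ ℬ (e t)) →
    n p q u a ∈ ℬ (∑ t, d t + ∑ t, e t + 1)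
  l_symm : ∀ (p : ℕ) (d : Fin p → ℤ) (u : Fin p → Hc) (σ : Equiv.Perm (Fin p)),
    (∀ t, u t ∈ 𝒜 (d t)) → l p u = ((permSign d σ : ℤ) : k) • l p (fun t => u (σ t))
  n_symm : ∀ (p q : ℕ) (d : Fin p → ℤ) (u : Fin p → Hc) (a : Fin q → Ho)
    (σ : Equiv.Perm (Fin p)),
    (∀ t, u t ∈ 𝒜 (d t)) → n p q u a = ((permSign d σ : ℤ) : k) • n p q (fun t => u (σ t)) a

/-- `(a_{j+1}, …, a_{j+s})`. -/
def segment {X : Type*} {m : ℕ} (a : Fin m → X) (j s : ℕ) (h : j + s ≤ m) : Fin s → X :=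
  fun t => a ⟨j + t, by omega⟩

/-- `(a₁, …, a_j, x, a_{j+s+1}, …, a_m)`. -/
def insertAt {X : Type*} {m : ℕ} (a : Fin m → X) (j s : ℕ) (h : j + s ≤ m) (x : X) :
    Fin (j + 1 + (m - (j + s))) → X :=
  Fin.append (Fin.append (fun t : Fin j => a ⟨t, by omega⟩) (fun _ : Fin 1 => x))
    (fun t : Fin (m - (j + s)) => a ⟨j + s + t, by omega⟩)

/-- The Koszul sign `(-1)^μ` of moving an operation of degree one past `u_S` and `a₁, …, a_j`,
and its closed arguments `u_{Sᶜ}` past `a₁, …, a_j`: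
`μ = ε(σ) + |u_S| + |a₁| + ⋯ + |a_j| + (|a₁| + ⋯ + |a_j|) |u_{Sᶜ}|`. -/
def openSign {p q : ℕ} (d : Fin p → ℤ) (e : Fin q → ℤ) (S : Finset (Fin p)) (j : ℕ) : ℤˣ :=
  unshuffleSign d S *
    ((∑ i ∈ S, d i) + (∑ t with t.val < j, e t) +
      (∑ t with t.val < j, e t) * (∑ i ∈ Sᶜ, d i)).negOnePow

/-- An OCHA structure on `(Hc, Ho)`. The sums over `S` are the sums over all unshuffles, see
`block`; the terms with `S = ∅` in the sums that involve `O.l S.card` vanish. -/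
structure OCHAStructure (𝒜 : ℤ → Submodule k Hc) (ℬ : ℤ → Submodule k Ho)
    extends Operations 𝒜 ℬ where
  /-- the `L∞` relations -/
  l_rel : ∀ (p : ℕ) (d : Fin p → ℤ) (u : Fin p → Hc), (∀ t, u t ∈ 𝒜 (d t)) →
    ∑ S : Finset (Fin p), ((unshuffleSign d S : ℤ) : k) •
      l (Sᶜ.card + 1) (Matrix.vecCons (l S.card (block u S)) (block u Sᶜ)) = 0
  /-- the compatibility relations -/
  n_rel : ∀ (p q : ℕ) (d : Fin p → ℤ) (e : Fin q → ℤ) (u : Fin p → Hc) (a : Fin q → Ho),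
    (∀ t, u t ∈ 𝒜 (d t)) → (∀ t, a t ∈ ℬ (e t)) →
    ∑ S : Finset (Fin p), ((unshuffleSign d S : ℤ) : k) •
        n (Sᶜ.card + 1) q (Matrix.vecCons (l S.card (block u S)) (block u Sᶜ)) a +
      ∑ S : Finset (Fin p), ∑ j : Fin (q + 1), ∑ s : Fin (q + 1 - j), ((openSign d e S j : ℤ) : k) •
        n S.card (j + 1 + (q - (j + s))) (block u S)
          (insertAt a j s (by omega)
            (n Sᶜ.card s (block u Sᶜ) (segment a j s (by omega)))) = 0

/-- `D` is the sum `∑ₙ l̂ₙ + ∑_{p,q} n̂_{p,q}` of the lifts of the operations to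
`Λᶜ Hc ⊗ Tᶜ Ho`, where, for homogeneous arguments,
`l̂ₙ` sends `u₁ ∧ ⋯ ∧ uᵣ ⊗ a` to the sum of `± lₙ(u_S) ∧ u_{Sᶜ} ⊗ a` over `|S| = n`, and
`n̂_{p,q}` sends `u₁ ∧ ⋯ ∧ uᵣ ⊗ a₁ ⊗ ⋯ ⊗ aₘ` to the sum of
`± u_S ⊗ a₁ ⊗ ⋯ ⊗ a_j ⊗ n_{p,q}(u_{Sᶜ}, a_{j+1}, …, a_{j+q}) ⊗ a_{j+q+1} ⊗ ⋯ ⊗ aₘ`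
over `|Sᶜ| = p` and `0 ≤ j ≤ m - q`. -/
def Operations.IsLift {𝒜 : ℤ → Submodule k Hc} {ℬ : ℤ → Submodule k Ho}
    (O : Operations 𝒜 ℬ) (D : OC 𝒜 ℬ →ₗ[k] OC 𝒜 ℬ) : Prop :=
  ∀ (r m : ℕ) (d : Fin r → ℤ) (e : Fin m → ℤ) (u : Fin r → Hc) (a : Fin m → Ho),
    (∀ t, u t ∈ 𝒜 (d t)) → (∀ t, a t ∈ ℬ (e t)) →
    D (ocMk 𝒜 ℬ u a) =
      ∑ S : Finset (Fin r), ((unshuffleSign d S : ℤ) : k) •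
        ocMk 𝒜 ℬ (Matrix.vecCons (O.l S.card (block u S)) (block u Sᶜ)) a +
      ∑ S : Finset (Fin r), ∑ j : Fin (m + 1), ∑ s : Fin (m + 1 - j), ((openSign d e S j : ℤ) : k) •
        ocMk 𝒜 ℬ (block u S)
          (insertAt a j s (by omega)
            (O.n Sᶜ.card s (block u Sᶜ) (segment a j s (by omega))))

/-- The OCHA constraint: `D = ∑ ĝₚ + ∑ f̂_{p,q}` for operations `gₚ : Hc^{∧ p} → Hc` and
`f_{p,q} : Hc^{∧ p} ⊗ Ho^{⊗ q} → Ho`. -/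
def SatisfiesOCHAConstraint (𝒜 : ℤ → Submodule k Hc) (ℬ : ℤ → Submodule k Ho)
    (D : OC 𝒜 ℬ →ₗ[k] OC 𝒜 ℬ) : Prop :=
  ∃ O : Operations 𝒜 ℬ, O.IsLift D

end Structures

end OCHA

end

/-! A coderivation of Λᶜ Hc ⊗ Tᶜ Ho is determined by its two components, the composites with the
projections to Hc = Λ¹ ⊗ T⁰ and Ho = Λ⁰ ⊗ T¹. A family of operations is the same as a pair of degree
one components, vanishing on 1, whose Hc-part is zero on words with an open letter; its lift is the
coderivation with these components. If D is a lift, D ∘ D is again a coderivation, so it vanishes as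
soon as its components do, and these components are the left sides of the L∞ and compatibility
relations. This gives the first bijection.

Existence (`Operations.exists_isLift`). The coalgebra is generated from 1 by left multiplication by
closed and open letters. The coproduct obeys a recursion along these generators: Δ(g x) is the sum
of g acting on the left factor and, up to sign, on the right factor, except that for an open letter
the second term first projects the left factor to Λ ⊗ T⁰ by an idempotent e. Coassociativity, the
counit axiom, and graded cocommutativity with one factor projected by e follow by induction;
`OpCoalgebra` isolates what is needed. A component f is extended by x ↦ f(x₁) · x₂. For f with
values in Hc that factors through e this is a coderivation. For values in Ho it inserts f at the
leftmost place only and is a coderivation "along e"; summing over all places gives a genuine one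
(`Δ_of_recursion`).

Uniqueness (`eq_zero_of_components`). Extending the projections themselves gives Euler operators,
whose sum multiplies a word with p closed and q open letters by p if q = 0 and by p + 1 otherwise.
In characteristic zero its kernel is k · 1. By induction on word length it kills every value of a
coderivation with zero components.

The second bijection needs the Hc-component of any coderivation D to vanish on u ⊗ a₁ ⋯ aₘ, m ≥ 1.
By partial cocommutativity (`map_comp_swap`), evaluating that component on one factor of the
coproduct of u ⊗ a₁ ⋯ aₘ b and a functional φ of Ho on the other gives the same result in either
order. If φ(a₁) = 0 and φ(b) = 1, one order gives zero and the other the wanted value. Such b and φ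
exist when a₁ ≠ 0 does not span Ho, hence when dim Ho ≠ 1; for Hc = 0 there is nothing to show. -/

noncomputable section

namespace OCHA

/-! ### Parity projections, sign twists and the Koszul flip -/

section Parity

variable {k M : Type*} [Field k] [AddCommGroup M] [Module k M]

/-- The projection to the even part, for an involution `θ` with sign operator `x ↦ (-1)^{|x|} x`. -/
def evenPart (θ : M →ₗ[k] M) : M →ₗ[k] M := (2⁻¹ : k) • (LinearMap.id + θ)

/-- The projection to the odd part, for an involution `θ` with sign operator `x ↦ (-1)^{|x|} x`. -/
def oddPart (θ : M →ₗ[k] M) : M →ₗ[k] M := (2⁻¹ : k) • (LinearMap.id - θ)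

/-- The operator `x ↦ s^{|x|} x` for a sign `s = ± 1`. -/
def twist (θ : M →ₗ[k] M) (s : k) : M →ₗ[k] M := evenPart θ + s • oddPart θ

/-- The Koszul flip `x ⊗ y ↦ (-1)^{|x||y|} y ⊗ x`. -/
def signedSwap (θ : M →ₗ[k] M) : M ⊗[k] M →ₗ[k] M ⊗[k] M :=
  (TensorProduct.map (evenPart θ) LinearMap.id + TensorProduct.map (oddPart θ) θ) ∘ₗ
    (TensorProduct.comm k M M).toLinearMap

theorem signedSwap_tmul (θ : M →ₗ[k] M) (x y : M) :
    signedSwap θ (x ⊗ₜ[k] y) = evenPart θ y ⊗ₜ[k] x + oddPart θ y ⊗ₜ[k] θ x := rfl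

theorem evenPart_apply (θ : M →ₗ[k] M) (x : M) : evenPart θ x = (2⁻¹ : k) • (x + θ x) := rfl

theorem oddPart_apply (θ : M →ₗ[k] M) (x : M) : oddPart θ x = (2⁻¹ : k) • (x - θ x) := rfl

theorem twist_apply (θ : M →ₗ[k] M) (s : k) (x : M) :
    twist θ s x = evenPart θ x + s • oddPart θ x := rfl

end Parity

section ParityCharZero

variable {k M : Type*} [Field k] [CharZero k] [AddCommGroup M] [Module k M] (θ : M →ₗ[k] M)

theorem evenPart_add_oddPart (x : M) : evenPart θ x + oddPart θ x = x := by
  rw [evenPart_apply, oddPart_apply]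
  module

theorem evenPart_sub_oddPart (x : M) : evenPart θ x - oddPart θ x = θ x := by
  rw [evenPart_apply, oddPart_apply]
  module

theorem twist_one : twist θ (1 : k) = LinearMap.id := by
  ext x
  simpa [twist] using evenPart_add_oddPart θ x

theorem twist_neg_one : twist θ (-1 : k) = θ := by
  ext x
  simpa [twist, sub_eq_add_neg] using evenPart_sub_oddPart θ x

end ParityCharZero

/-- A coalgebra with sign operator `θ` and an idempotent `e`, generated from a group-like element
by operators `g` of sign `s` satisfying `Δ g = (g ⊗ 1 + s^{|·|} q ⊗ g) Δ`, where `q = 1` and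
`e g = g e`, or `q = e` and `e g = 0`. -/
structure OpCoalgebra (k C : Type*) [Field k] [AddCommGroup C] [Module k C] where
  Δ : C →ₗ[k] C ⊗[k] C
  θ : C →ₗ[k] C
  e : C →ₗ[k] C
  ε : C →ₗ[k] k
  one : C
  IsGen : (C →ₗ[k] C) → k → (C →ₗ[k] C) → Prop
  θ_θ : ∀ x, θ (θ x) = x
  e_e : ∀ x, e (e x) = e x
  θ_e : ∀ x, θ (e x) = e (θ x)
  θ_one : θ one = one
  e_one : e one = one
  Δ_one : Δ one = one ⊗ₜ[k] one
  ε_one : ε one = 1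
  sign : ∀ {g s q}, IsGen g s q → s = 1 ∨ s = -1
  θ_gen : ∀ {g s q}, IsGen g s q → ∀ x, θ (g x) = s • g (θ x)
  e_gen : ∀ {g s q}, IsGen g s q →
    (q = LinearMap.id ∧ ∀ x, e (g x) = g (e x)) ∨ (q = e ∧ ∀ x, e (g x) = 0)
  ε_gen : ∀ {g s q}, IsGen g s q → ∀ x, ε (g x) = 0
  Δ_gen : ∀ {g s q}, IsGen g s q → ∀ x, Δ (g x) =
    TensorProduct.map g LinearMap.id (Δ x) + TensorProduct.map (twist θ s ∘ₗ q) g (Δ x)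
  induction : ∀ P : Submodule k C, one ∈ P →
    (∀ {g s q}, IsGen g s q → ∀ x ∈ P, g x ∈ P) → P = ⊤

/-! ### Coalgebra axioms from the recursion along generators -/

namespace OpCoalgebra

variable {k C : Type*} [Field k] [AddCommGroup C] [Module k C] (A : OpCoalgebra k C)

/-- Two linear maps out of `C` agree if they agree at `1` and satisfy the same recursion. -/
theorem hom_ext {N : Type*} [AddCommGroup N] [Module k N] {F G : C →ₗ[k] N}
    (h1 : F A.one = G A.one)
    (hg : ∀ {g s q}, A.IsGen g s q → ∀ x, F x = G x → F (g x) = G (g x)) (x : C) : F x = G x := by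
  have h := A.induction (LinearMap.eqLocus F G) h1 (fun hgen x hx => hg hgen x hx)
  have hx : x ∈ LinearMap.eqLocus F G := h ▸ Submodule.mem_top
  exact hx

variable [CharZero k]

/-- In each term of the recursion exactly one tensor factor carries g, so θ ⊗ θ produces the sign s
once, just as θ g = s g θ does. -/
theorem Δ_θ (x : C) : A.Δ (A.θ x) = TensorProduct.map A.θ A.θ (A.Δ x) := by
  refine A.hom_ext (F := A.Δ ∘ₗ A.θ) (G := TensorProduct.map A.θ A.θ ∘ₗ A.Δ) ?_ ?_ x
  · simp [A.θ_one, A.Δ_one]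
  · intro g s q hg x hx
    simp only [LinearMap.comp_apply] at hx ⊢
    rw [A.θ_gen hg, map_smul, A.Δ_gen hg, A.Δ_gen hg, hx, map_add, smul_add]
    have hq : ∀ x, q (A.θ x) = A.θ (q x) := by
      rcases A.e_gen hg with ⟨rfl, -⟩ | ⟨rfl, -⟩
      · simp
      · simp [A.θ_e]
    have ht : ∀ x, twist A.θ s (A.θ x) = A.θ (twist A.θ s x) := by
      rcases A.sign hg with rfl | rfl <;> simp [twist_one, twist_neg_one]
    refine congrArg₂ _ ?_ ?_
    · generalize A.Δ x = z
      induction z with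
      | zero => simp
      | add a b ha hb => simp only [map_add, smul_add, ha, hb]
      | tmul a b => simp [A.θ_gen hg, TensorProduct.smul_tmul']
    · generalize A.Δ x = z
      induction z with
      | zero => simp
      | add a b ha hb => simp only [map_add, smul_add, ha, hb]
      | tmul a b => simp [A.θ_gen hg, hq, ht]

/-- For a generator commuting with e the recursion passes through e ⊗ e. For one with e g = 0 both
sides vanish, since each term of Δ (g x) has g in some factor. -/
theorem Δ_e (x : C) : A.Δ (A.e x) = TensorProduct.map A.e A.e (A.Δ x) := by
  refine A.hom_ext (F := A.Δ ∘ₗ A.e) (G := TensorProduct.map A.e A.e ∘ₗ A.Δ) ?_ ?_ x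
  · simp [A.e_one, A.Δ_one]
  · intro g s q hg x hx
    simp only [LinearMap.comp_apply] at hx ⊢
    have ht : ∀ x, twist A.θ s (A.e x) = A.e (twist A.θ s x) := by
      rcases A.sign hg with rfl | rfl <;> simp [twist_one, twist_neg_one, A.θ_e]
    rcases A.e_gen hg with ⟨rfl, he⟩ | ⟨rfl, he⟩
    · rw [he, A.Δ_gen hg, A.Δ_gen hg, hx, map_add]
      refine congrArg₂ _ ?_ ?_
      · generalize A.Δ x = z
        induction z with
        | zero => simp
        | add a b ha hb => simp only [map_add, ha, hb]
        | tmul a b => simp [he]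
      · generalize A.Δ x = z
        induction z with
        | zero => simp
        | add a b ha hb => simp only [map_add, ha, hb]
        | tmul a b => simp [he, ht]
    · rw [he, A.Δ_gen hg, map_zero, map_add]
      symm
      generalize A.Δ x = z
      induction z with
      | zero => simp
      | add a b ha hb =>
        simp only [map_add]
        rw [add_add_add_comm, ha, hb, add_zero]
      | tmul a b => simp [he]

theorem counit_left (x : C) : TensorProduct.lid k C (TensorProduct.map A.ε LinearMap.id (A.Δ x)) =
    x := by
  refine A.hom_ext (F := (TensorProduct.lid k C).toLinearMap ∘ₗ
    TensorProduct.map A.ε LinearMap.id ∘ₗ A.Δ) (G := LinearMap.id) ?_ ?_ x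
  · simp [A.Δ_one, A.ε_one]
  · intro g s q hg x hx
    -- As ε kills the image of every generator, it does not see e or θ; under ε the coefficient of
    -- the second term of `Δ_gen` may therefore be dropped.
    have hεe : ∀ x, A.ε (A.e x) = A.ε x :=
      A.hom_ext (F := A.ε ∘ₗ A.e) (by simp [A.e_one]) (fun {g s q} hg x hx => by
        simp only [LinearMap.comp_apply] at hx ⊢
        rcases A.e_gen hg with ⟨rfl, he⟩ | ⟨rfl, he⟩ <;> simp [he, A.ε_gen hg])
    have hεθ : ∀ x, A.ε (A.θ x) = A.ε x :=
      A.hom_ext (F := A.ε ∘ₗ A.θ) (by simp [A.θ_one]) (fun {g s q} hg x hx => by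
        simp [A.θ_gen hg, A.ε_gen hg])
    have hq : ∀ x, A.ε (twist A.θ s (q x)) = A.ε x := by
      intro x
      rcases A.sign hg with rfl | rfl <;> rcases A.e_gen hg with ⟨rfl, -⟩ | ⟨rfl, -⟩ <;>
        simp [twist_one, twist_neg_one, hεe, hεθ]
    simp only [LinearMap.comp_apply, LinearMap.id_apply] at hx ⊢
    conv_rhs => rw [← hx]
    rw [A.Δ_gen hg]
    generalize A.Δ x = z
    induction z with
    | zero => simp
    | add a b ha hb =>
      simp only [map_add] at ha hb ⊢
      rw [← ha, ← hb]
      abel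
    | tmul a b => simp [hq, A.ε_gen hg]

/-- Coassociativity. -/
theorem coassoc (x : C) :
    TensorProduct.assoc k C C C (TensorProduct.map A.Δ LinearMap.id (A.Δ x)) =
      TensorProduct.map LinearMap.id A.Δ (A.Δ x) := by
  refine A.hom_ext (F := (TensorProduct.assoc k C C C).toLinearMap ∘ₗ
    TensorProduct.map A.Δ LinearMap.id ∘ₗ A.Δ) (G := TensorProduct.map LinearMap.id A.Δ ∘ₗ A.Δ)
    ?_ ?_ x
  · simp [A.Δ_one]
  · intro g s q hg x hx
    simp only [LinearMap.comp_apply, LinearEquiv.coe_coe] at hx ⊢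
    have hΔ : ∀ x, A.Δ (twist A.θ s (q x)) = TensorProduct.map (twist A.θ s ∘ₗ q)
        (twist A.θ s ∘ₗ q) (A.Δ x) := by
      intro x
      rcases A.sign hg with rfl | rfl <;> rcases A.e_gen hg with ⟨rfl, -⟩ | ⟨rfl, -⟩ <;>
        simp [twist_one, twist_neg_one, A.Δ_e, A.Δ_θ, TensorProduct.map_comp]
    generalize ht : twist A.θ s ∘ₗ q = t at *
    have hΔ' : ∀ x, A.Δ (t x) = TensorProduct.map t t (A.Δ x) := fun x => by
      rw [← hΔ, ← ht]; rfl
    -- Both iterated coproducts obey the recursion with the same operator g ⊗ 1 ⊗ 1 + t ⊗ g ⊗ 1 + t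
    -- ⊗ t ⊗ g, because t is comultiplicative.
    obtain ⟨G, hG⟩ : ∃ G : C ⊗[k] (C ⊗[k] C) →ₗ[k] C ⊗[k] (C ⊗[k] C), G =
        TensorProduct.map g LinearMap.id + TensorProduct.map t (TensorProduct.map g LinearMap.id +
          TensorProduct.map t g) := ⟨_, rfl⟩
    have h1 : ∀ z, TensorProduct.assoc k C C C (TensorProduct.map A.Δ LinearMap.id
        (TensorProduct.map g LinearMap.id z + TensorProduct.map t g z)) =
        G (TensorProduct.assoc k C C C
            (TensorProduct.map A.Δ LinearMap.id z)) := by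
      intro z
      induction z with
      | zero => simp
      | add a b ha hb =>
        simp only [map_add] at ha hb ⊢
        rw [← ha, ← hb]
        abel
      | tmul a b =>
        simp only [TensorProduct.map_tmul, map_add, A.Δ_gen hg, ht, hΔ', LinearMap.id_apply]
        generalize A.Δ a = z
        induction z with
        | zero => simp
        | add a b ha hb =>
          simp only [map_add, TensorProduct.add_tmul] at ha hb ⊢
          rw [← ha, ← hb]
          abel
        | tmul a b =>
          simp [hG, TensorProduct.add_tmul, TensorProduct.tmul_add, add_assoc]
    have h2 : ∀ z, TensorProduct.map LinearMap.id A.Δ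
        (TensorProduct.map g LinearMap.id z + TensorProduct.map t g z) =
        G (TensorProduct.map LinearMap.id A.Δ z) := by
      intro z
      induction z with
      | zero => simp
      | add a b ha hb =>
        simp only [map_add] at ha hb ⊢
        rw [← ha, ← hb]
        abel
      | tmul a b =>
        simp [hG, A.Δ_gen hg, ht, TensorProduct.tmul_add]
    rw [A.Δ_gen hg, ht, h1, h2, hx]

theorem q_θ {g s q} (hg : A.IsGen g s q) (x : C) : q (A.θ x) = A.θ (q x) := by
  rcases A.e_gen hg with ⟨rfl, -⟩ | ⟨rfl, -⟩
  · simp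
  · simp [A.θ_e]

/-- After the flip, g has to pass the factor that now stands on the left; for g of sign s this costs
the twist by s. -/
theorem swap_map_id {g : C →ₗ[k] C} {s : k} (hs : s = 1 ∨ s = -1)
    (hg : ∀ x, A.θ (g x) = s • g (A.θ x)) (z : C ⊗[k] C) :
    signedSwap A.θ (TensorProduct.map g LinearMap.id z) =
      TensorProduct.map (twist A.θ s) g (signedSwap A.θ z) := by
  induction z with
  | zero => simp
  | add a b ha hb => simp only [map_add, ha, hb]
  | tmul a b =>
    rcases hs with rfl | rfl
    · simp [signedSwap_tmul, twist_one, hg]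
    · simp [signedSwap_tmul, twist_neg_one, hg, evenPart_apply, oddPart_apply, A.θ_θ,
        TensorProduct.tmul_neg, ← TensorProduct.neg_tmul, ← smul_neg, add_comm]

theorem swap_map_twist {g : C →ₗ[k] C} {s : k} (hs : s = 1 ∨ s = -1)
    (hg : ∀ x, A.θ (g x) = s • g (A.θ x)) (z : C ⊗[k] C) :
    signedSwap A.θ (TensorProduct.map (twist A.θ s) g z) =
      TensorProduct.map g LinearMap.id (signedSwap A.θ z) := by
  induction z with
  | zero => simp
  | add a b ha hb => simp only [map_add, ha, hb]
  | tmul a b =>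
    rcases hs with rfl | rfl
    · simp [signedSwap_tmul, twist_one, hg, evenPart_apply, oddPart_apply]
    · simp [signedSwap_tmul, twist_neg_one, hg, evenPart_apply, oddPart_apply, A.θ_θ,
        add_comm, sub_eq_add_neg]

theorem swap_map {q q' : C →ₗ[k] C} (hq : ∀ x, q (A.θ x) = A.θ (q x))
    (hq' : ∀ x, q' (A.θ x) = A.θ (q' x)) (z : C ⊗[k] C) :
    signedSwap A.θ (TensorProduct.map q q' z) =
      TensorProduct.map q' q (signedSwap A.θ z) := by
  induction z with
  | zero => simp
  | add a b ha hb => simp only [map_add, ha, hb]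
  | tmul a b => simp [signedSwap_tmul, hq, hq', evenPart_apply, oddPart_apply]

/-- Compared with `Δ_gen`, the projection q has moved from the term with g on the right to the term
with g on the left. This discrepancy is why only a partial cocommutativity holds. -/
theorem swap_Δ_gen {g s q} (hg : A.IsGen g s q) (x : C) : signedSwap A.θ (A.Δ (g x)) =
    TensorProduct.map (twist A.θ s) g (signedSwap A.θ (A.Δ x)) +
      TensorProduct.map g q (signedSwap A.θ (A.Δ x)) := by
  have h : ∀ z, TensorProduct.map (twist A.θ s ∘ₗ q) g z =
      TensorProduct.map (twist A.θ s) g (TensorProduct.map q LinearMap.id z) := fun z => by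
    rw [← LinearMap.comp_apply (TensorProduct.map _ _), ← TensorProduct.map_comp,
      LinearMap.comp_id]
  have h' : ∀ z, TensorProduct.map g q z =
      TensorProduct.map g LinearMap.id (TensorProduct.map LinearMap.id q z) := fun z => by
    rw [← LinearMap.comp_apply (TensorProduct.map _ _), ← TensorProduct.map_comp,
      LinearMap.comp_id, LinearMap.id_comp]
  rw [A.Δ_gen hg, map_add, A.swap_map_id (A.sign hg) (A.θ_gen hg), h,
    A.swap_map_twist (A.sign hg) (A.θ_gen hg), A.swap_map (A.q_θ hg) (by simp), h']

/-- Graded cocommutativity, when the left factor is projected to the image of `e`. -/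
theorem cocomm_left (x : C) : TensorProduct.map A.e LinearMap.id (signedSwap A.θ (A.Δ x)) =
    TensorProduct.map A.e LinearMap.id (A.Δ x) := by
  refine A.hom_ext (F := TensorProduct.map A.e LinearMap.id ∘ₗ signedSwap A.θ ∘ₗ A.Δ)
    (G := TensorProduct.map A.e LinearMap.id ∘ₗ A.Δ) ?_ ?_ x
  · simp [A.Δ_one, signedSwap_tmul, evenPart_apply, oddPart_apply, A.θ_one, A.e_one, ← two_smul k,
      smul_smul]
  · intro g s q hg x hx
    simp only [LinearMap.comp_apply] at hx ⊢
    have ht : ∀ x, A.e (twist A.θ s x) = twist A.θ s (A.e x) := by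
      rcases A.sign hg with rfl | rfl <;> simp [twist_one, twist_neg_one, A.θ_e]
    have h1 : ∀ z, TensorProduct.map A.e LinearMap.id (TensorProduct.map (twist A.θ s) g z) =
        TensorProduct.map (twist A.θ s) g (TensorProduct.map A.e LinearMap.id z) := by
      intro z
      induction z with
      | zero => simp
      | add a b ha hb => simp only [map_add, ha, hb]
      | tmul a b => simp [ht]
    have h2 : ∀ z, TensorProduct.map A.e LinearMap.id (TensorProduct.map (twist A.θ s ∘ₗ q) g z) =
        TensorProduct.map (twist A.θ s) g (TensorProduct.map A.e LinearMap.id z) := by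
      intro z
      induction z with
      | zero => simp
      | add a b ha hb => simp only [map_add, ha, hb]
      | tmul a b =>
        rcases A.e_gen hg with ⟨rfl, -⟩ | ⟨rfl, -⟩ <;> simp [ht, A.e_e]
    -- Once the left factor is projected, the terms with g on the right agree by induction. Those
    -- with g on the left agree by induction if q = 1, and vanish by e g = 0 if q = e.
    rw [A.swap_Δ_gen hg, A.Δ_gen hg, map_add, map_add, h1, h2, hx, add_comm]
    congr 1
    rcases A.e_gen hg with ⟨rfl, he⟩ | ⟨rfl, he⟩
    · have h3 : ∀ z : C ⊗[k] C, TensorProduct.map A.e LinearMap.id (TensorProduct.map g LinearMap.id z) =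
          TensorProduct.map g LinearMap.id (TensorProduct.map A.e LinearMap.id z) := by
        intro z
        induction z with
        | zero => simp
        | add a b ha hb => simp only [map_add, ha, hb]
        | tmul a b => simp [he]
      rw [h3, h3, hx]
    · have h3 : ∀ (q' : C →ₗ[k] C) (z : C ⊗[k] C),
          TensorProduct.map A.e LinearMap.id (TensorProduct.map g q' z) = 0 := by
        intro q' z
        induction z with
        | zero => simp
        | add a b ha hb => simp only [map_add, ha, hb, add_zero]
        | tmul a b => simp [he]
      rw [h3, h3]

theorem swap_swap (z : C ⊗[k] C) : signedSwap A.θ (signedSwap A.θ z) = z := by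
  induction z with
  | zero => simp
  | add a b ha hb => simp only [map_add, ha, hb]
  | tmul a b =>
    simp only [signedSwap_tmul, evenPart_apply, oddPart_apply, map_add, map_sub, map_smul, A.θ_θ,
      TensorProduct.tmul_add, TensorProduct.tmul_sub, TensorProduct.add_tmul,
      TensorProduct.sub_tmul, ← TensorProduct.smul_tmul', TensorProduct.tmul_smul]
    module

/-- Graded cocommutativity, when the right factor is projected to the image of `e`. -/
theorem cocomm_right (x : C) : TensorProduct.map LinearMap.id A.e (signedSwap A.θ (A.Δ x)) =
    TensorProduct.map LinearMap.id A.e (A.Δ x) := by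
  have h := congrArg (signedSwap A.θ) (A.cocomm_left x)
  rw [A.swap_map (fun x => (A.θ_e x).symm) (by simp), A.swap_map (fun x => (A.θ_e x).symm)
    (by simp), A.swap_swap] at h
  exact h.symm

/-! ### Extending a component to a coderivation -/

section Extension

variable {W : Type*} [AddCommGroup W] [Module k W]

/-- The map `x ↦ M (f x₁) x₂`, where `Δ x = x₁ ⊗ x₂`. -/
def extend (M : W →ₗ[k] C →ₗ[k] C) (f : C →ₗ[k] W) : C →ₗ[k] C :=
  TensorProduct.lift M ∘ₗ TensorProduct.map f LinearMap.id ∘ₗ A.Δ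

theorem extend_apply (M : W →ₗ[k] C →ₗ[k] C) (f : C →ₗ[k] W) (x : C) :
    A.extend M f x = TensorProduct.lift M (TensorProduct.map f LinearMap.id (A.Δ x)) := rfl

/-- The recursion `hM` splits Δ (M (f x₁) x₂) into M (f x₁) x₂ ⊗ x₃ and ± q x₂ ⊗ M (f x₁) x₃. The
first is handled by coassociativity. In the second `hcomm` exchanges x₁ and x₂; the flip absorbs
(-1)^{|x₁||x₂|}, and since f is odd the sign (-1)^{|x|} of the new left factor remains, which is θ.
-/
theorem Δ_extend (θW : W →ₗ[k] W) (M : W →ₗ[k] C →ₗ[k] C) (q : C →ₗ[k] C) (f : C →ₗ[k] W)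
    (hM : ∀ w x, A.Δ (M w x) = TensorProduct.map (M w) LinearMap.id (A.Δ x) +
      (TensorProduct.map (evenPart A.θ ∘ₗ q) (M w) (A.Δ x) +
        TensorProduct.map (oddPart A.θ ∘ₗ q) (M (θW w)) (A.Δ x)))
    (hf : ∀ x, θW (f x) = - f (A.θ x)) (hq : ∀ x, q (A.θ x) = A.θ (q x))
    (hcomm : ∀ x, TensorProduct.map f q (signedSwap A.θ (A.Δ x)) =
      TensorProduct.map f q (A.Δ x)) (x : C) :
    A.Δ (A.extend M f x) = TensorProduct.map (A.extend M f) LinearMap.id (A.Δ x) +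
      TensorProduct.map (A.θ ∘ₗ q) (A.extend M f) (A.Δ x) := by
  obtain ⟨μ, hμ⟩ : ∃ μ : C ⊗[k] C →ₗ[k] C,
    μ = TensorProduct.lift M ∘ₗ TensorProduct.map f LinearMap.id := ⟨_, rfl⟩
  -- B is the map w ⊗ x ⊗ y ↦ (-1)^{|w||x|} x ⊗ M w y, with the sign written through even and odd
  -- parts.
  obtain ⟨B, hB⟩ : ∃ B : (W ⊗[k] C) ⊗[k] C →ₗ[k] C ⊗[k] C, B =
    (TensorProduct.map (evenPart A.θ) (TensorProduct.lift M) +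
      TensorProduct.map (oddPart A.θ)
        (TensorProduct.lift M ∘ₗ TensorProduct.map θW LinearMap.id)) ∘ₗ
    (TensorProduct.assoc k C W C).toLinearMap ∘ₗ
    TensorProduct.map (TensorProduct.comm k W C).toLinearMap LinearMap.id := ⟨_, rfl⟩
  have h1 : ∀ z, A.Δ (μ z) =
      TensorProduct.map μ LinearMap.id ((TensorProduct.assoc k C C C).symm
          (TensorProduct.map LinearMap.id A.Δ z)) +
        B (TensorProduct.map (TensorProduct.map f q) LinearMap.id
          ((TensorProduct.assoc k C C C).symm (TensorProduct.map LinearMap.id A.Δ z))) := by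
    intro z
    induction z with
    | zero => simp
    | add a b ha hb =>
      simp only [map_add, ha, hb]
      abel
    | tmul a b =>
      simp only [hμ, LinearMap.comp_apply, TensorProduct.map_tmul, LinearMap.id_apply,
        TensorProduct.lift.tmul, hM]
      generalize A.Δ b = z
      induction z with
      | zero => simp
      | add c d hc hd =>
        simp only [map_add, TensorProduct.tmul_add] at hc hd ⊢
        linear_combination (norm := module) hc + hd
      | tmul c d => simp [hB]
  -- The flip followed by B moves x past an element and then past its image under the odd map f; the
  -- net sign is (-1)^{|x|}.
  have h2 : ∀ z, B (TensorProduct.map (TensorProduct.map f q) LinearMap.id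
      (TensorProduct.map (signedSwap A.θ) LinearMap.id z)) =
      TensorProduct.map (A.θ ∘ₗ q) μ (TensorProduct.assoc k C C C z) := by
    intro z
    induction z with
    | zero => simp
    | add a b ha hb => simp only [map_add, ha, hb]
    | tmul a b =>
      induction a with
      | zero => simp
      | add c d hc hd => simp only [map_add, TensorProduct.add_tmul, hc, hd]
      | tmul c d =>
        simp only [signedSwap_tmul, hB, hμ, evenPart_apply, oddPart_apply, map_add, map_sub,
          map_smul, A.θ_θ, TensorProduct.tmul_add, TensorProduct.tmul_sub, TensorProduct.add_tmul,
          TensorProduct.sub_tmul, ← TensorProduct.smul_tmul', TensorProduct.tmul_smul, hq, hf,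
          LinearMap.add_apply, LinearMap.comp_apply, TensorProduct.map_tmul, LinearMap.id_apply,
          LinearEquiv.coe_coe, TensorProduct.assoc_tmul, TensorProduct.comm_tmul,
          TensorProduct.lift.tmul, map_neg, LinearMap.neg_apply, TensorProduct.tmul_neg,
          LinearMap.sub_apply, LinearMap.smul_apply, TensorProduct.neg_tmul]
        module
  have h3 : ∀ z, TensorProduct.map (TensorProduct.map f q) LinearMap.id
      (TensorProduct.map (signedSwap A.θ) LinearMap.id (TensorProduct.map A.Δ LinearMap.id z)) =
      TensorProduct.map (TensorProduct.map f q) (LinearMap.id (M := C) (R := k))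
        (TensorProduct.map A.Δ LinearMap.id z) := by
    intro z
    induction z with
    | zero => simp
    | add a b ha hb => simp only [map_add, ha, hb]
    | tmul a b => simp [hcomm]
  have h4 : A.extend M f = μ ∘ₗ A.Δ := by rw [hμ]; rfl
  have h5 : ∀ z, TensorProduct.map μ LinearMap.id (TensorProduct.map A.Δ LinearMap.id z) =
      TensorProduct.map (μ ∘ₗ A.Δ) (LinearMap.id (M := C) (R := k)) z := fun z => by
    rw [← LinearMap.comp_apply (TensorProduct.map _ _), ← TensorProduct.map_comp,
      LinearMap.comp_id]
  have h6 : ∀ z, TensorProduct.map (A.θ ∘ₗ q) μ (TensorProduct.map LinearMap.id A.Δ z) =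
      TensorProduct.map (A.θ ∘ₗ q) (μ ∘ₗ A.Δ) z := fun z => by
    rw [← LinearMap.comp_apply (TensorProduct.map _ _), ← TensorProduct.map_comp,
      LinearMap.comp_id]
  rw [h4, LinearMap.comp_apply, h1, ← A.coassoc, LinearEquiv.symm_apply_apply,
    ← h3, h2, A.coassoc, h5, h6]

end Extension

end OpCoalgebra

end OCHA

namespace OCHA

/-! ### Odd coderivations: sums over insertion places, squares, comparison under the flip -/

namespace OpCoalgebra

variable {k C : Type*} [Field k] [CharZero k] [AddCommGroup C] [Module k C] (A : OpCoalgebra k C)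

/-- A map `N` that is obtained by moving `J` past generators is a coderivation if `J` is a
coderivation along `e`. -/
theorem Δ_of_recursion (J N : C →ₗ[k] C)
    (hind : ∀ P : Submodule k C, (∀ x, A.e x ∈ P) →
      (∀ {g s}, A.IsGen g s A.e → (∀ x, A.e (g x) = 0) → ∀ x ∈ P, g x ∈ P) → P = ⊤)
    (hJ : ∀ x, A.Δ (J x) = TensorProduct.map J LinearMap.id (A.Δ x) +
      TensorProduct.map (A.θ ∘ₗ A.e) J (A.Δ x))
    (hNe : ∀ x, N (A.e x) = J (A.e x)) (heN : ∀ x, A.e (N x) = 0)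
    (hNg : ∀ {g s}, A.IsGen g s A.e → (∀ x, A.e (g x) = 0) → ∀ x, N (g x) = s • g (N x) + J (g x))
    (x : C) : A.Δ (N x) = TensorProduct.map N LinearMap.id (A.Δ x) +
      TensorProduct.map A.θ N (A.Δ x) := by
  suffices h : LinearMap.eqLocus (A.Δ ∘ₗ N) ((TensorProduct.map N LinearMap.id +
      TensorProduct.map A.θ N) ∘ₗ A.Δ) = ⊤ by
    have hx : x ∈ LinearMap.eqLocus (A.Δ ∘ₗ N) ((TensorProduct.map N LinearMap.id +
      TensorProduct.map A.θ N) ∘ₗ A.Δ) := h ▸ Submodule.mem_top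
    exact hx
  refine hind _ (fun x => ?_) (fun {g s} hg he x hx => ?_)
  · change A.Δ (N (A.e x)) = TensorProduct.map N LinearMap.id (A.Δ (A.e x)) +
      TensorProduct.map A.θ N (A.Δ (A.e x))
    rw [hNe, hJ, A.Δ_e]
    generalize A.Δ x = z
    induction z with
    | zero => simp
    | add a b ha hb =>
      simp only [map_add] at ha hb ⊢
      linear_combination (norm := module) ha + hb
    | tmul a b => simp [hNe, A.e_e]
  · change A.Δ (N x) = TensorProduct.map N LinearMap.id (A.Δ x) +
      TensorProduct.map A.θ N (A.Δ x) at hx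
    change A.Δ (N (g x)) = TensorProduct.map N LinearMap.id (A.Δ (g x)) +
      TensorProduct.map A.θ N (A.Δ (g x))
    have ht : ∀ x, twist A.θ s (A.e x) = A.e (twist A.θ s x) := by
      rcases A.sign hg with rfl | rfl <;> simp [twist_one, twist_neg_one, A.θ_e]
    have ht' : ∀ x, twist A.θ s (A.θ x) = A.θ (twist A.θ s x) := by
      rcases A.sign hg with rfl | rfl <;> simp [twist_one, twist_neg_one]
    -- On pure tensors the terms containing e N or e g vanish, J agrees with N on the left factor
    -- because that factor lies in the image of e, and the remaining terms match by N g = s g N + J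
    -- g.
    rw [hNg hg he, map_add, map_smul, A.Δ_gen hg, hx, hJ, A.Δ_gen hg]
    generalize A.Δ x = z
    induction z with
    | zero => simp
    | add a b ha hb =>
      simp only [map_add, smul_add] at ha hb ⊢
      linear_combination (norm := module) ha + hb
    | tmul a b =>
      simp only [map_add, TensorProduct.map_tmul, LinearMap.comp_apply, LinearMap.id_apply, ht,
        heN, he, map_zero, TensorProduct.zero_tmul, hNe, A.θ_gen hg, hNg hg he,
        TensorProduct.add_tmul, TensorProduct.tmul_add, TensorProduct.tmul_smul, ht', A.e_e,
        ← A.θ_e, ← TensorProduct.smul_tmul']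
      module

/-- The square of an odd coderivation is a coderivation. -/
theorem Δ_sq (D : C →ₗ[k] C) (hD : ∀ x, A.Δ (D x) = TensorProduct.map D LinearMap.id (A.Δ x) +
      TensorProduct.map A.θ D (A.Δ x)) (hθ : ∀ x, A.θ (D x) = (-1 : k) • D (A.θ x)) (x : C) :
    A.Δ (D (D x)) = TensorProduct.map (D ∘ₗ D) LinearMap.id (A.Δ x) +
      TensorProduct.map LinearMap.id (D ∘ₗ D) (A.Δ x) := by
  replace hθ : ∀ x, A.θ (D x) = -D (A.θ x) := fun x => (hθ x).trans (neg_one_smul k _)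
  rw [hD, hD]
  generalize A.Δ x = z
  induction z with
  | zero => simp
  | add a b ha hb =>
    simp only [map_add] at ha hb ⊢
    linear_combination (norm := module) ha + hb
  -- The two mixed terms θ (D a) ⊗ D b and D (θ a) ⊗ D b cancel because D is odd.
  | tmul a b => simp [hθ, A.θ_θ, TensorProduct.neg_tmul]

/-- The comparison of the two ways to split off an odd coderivation. -/
theorem map_comp_swap {W W' : Type*} [AddCommGroup W] [Module k W] [AddCommGroup W'] [Module k W']
    (D : C →ₗ[k] C) (hD : ∀ x, A.Δ (D x) = TensorProduct.map D LinearMap.id (A.Δ x) +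
      TensorProduct.map A.θ D (A.Δ x)) (hθ : ∀ x, A.θ (D x) = (-1 : k) • D (A.θ x))
    (α : C →ₗ[k] W) (β : C →ₗ[k] W') (hα : ∀ x, α (A.e x) = α x) (x : C) :
    TensorProduct.map (α ∘ₗ D) β (signedSwap A.θ (A.Δ x)) =
      TensorProduct.map (α ∘ₗ D) β (A.Δ x) := by
  replace hθ : ∀ x, A.θ (D x) = -D (A.θ x) := fun x => (hθ x).trans (neg_one_smul k _)
  have h1 : ∀ (γ : C →ₗ[k] W') (z : C ⊗[k] C), TensorProduct.map α γ z =
      TensorProduct.map α γ (TensorProduct.map A.e LinearMap.id z) := by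
    intro γ z
    induction z with
    | zero => simp
    | add a b ha hb => simp only [map_add, ← ha, ← hb]
    | tmul a b => simp [hα]
  have h2 : ∀ (γ : C →ₗ[k] W') x, TensorProduct.map α γ (signedSwap A.θ (A.Δ x)) =
      TensorProduct.map α γ (A.Δ x) := fun γ x => by rw [h1, A.cocomm_left, ← h1]
  have h3 : ∀ (γ : C →ₗ[k] W') x, TensorProduct.map (α ∘ₗ A.θ) γ (signedSwap A.θ (A.Δ x)) =
      TensorProduct.map (α ∘ₗ A.θ) γ (A.Δ x) := by
    intro γ x
    have h4 : ∀ (z : C ⊗[k] C), TensorProduct.map (α ∘ₗ A.θ) γ z =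
        TensorProduct.map (α ∘ₗ A.θ) γ (TensorProduct.map A.e LinearMap.id z) := by
      intro z
      induction z with
      | zero => simp
      | add a b ha hb => simp only [map_add, ← ha, ← hb]
      | tmul a b => simp [hα, A.θ_e]
    rw [h4, A.cocomm_left, ← h4]
  -- Both Δ (D x) and its flip are evaluated by the co-Leibniz rule. As α and α ∘ θ factor through
  -- e, cocommutativity identifies the totals (`h2`) and the terms with D under β (`h3`); what
  -- remains is the claim.
  have h5 : TensorProduct.map α β (signedSwap A.θ (A.Δ (D x))) =
      TensorProduct.map (α ∘ₗ A.θ) (β ∘ₗ D) (signedSwap A.θ (A.Δ x)) +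
      TensorProduct.map (α ∘ₗ D) β (signedSwap A.θ (A.Δ x)) := by
    rw [hD]
    generalize A.Δ x = z
    induction z with
    | zero => simp
    | add a b ha hb =>
      simp only [map_add] at ha hb ⊢
      linear_combination (norm := module) ha + hb
    | tmul a b =>
      simp only [map_add, map_sub, map_smul, TensorProduct.map_tmul, LinearMap.comp_apply,
        LinearMap.id_apply, signedSwap_tmul, evenPart_apply, oddPart_apply, hθ, A.θ_θ,
        TensorProduct.add_tmul, TensorProduct.sub_tmul, TensorProduct.tmul_neg, map_neg,
        ← TensorProduct.smul_tmul', TensorProduct.neg_tmul, sub_neg_eq_add]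
      module
  have h6 : TensorProduct.map α β (A.Δ (D x)) =
      TensorProduct.map (α ∘ₗ A.θ) (β ∘ₗ D) (A.Δ x) + TensorProduct.map (α ∘ₗ D) β (A.Δ x) := by
    rw [hD]
    generalize A.Δ x = z
    induction z with
    | zero => simp
    | add a b ha hb =>
      simp only [map_add] at ha hb ⊢
      linear_combination (norm := module) ha + hb
    | tmul a b =>
      simp [add_comm]
  rw [h2, h6, h3] at h5
  exact (add_left_cancel h5).symm

end OpCoalgebra

/-! ### Signs and parity operators of graded algebras -/

section Sign

variable (k : Type*) [Field k]

/-- The sign `(-1)^i`. -/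
abbrev sgn (i : ℤ) : k := ((i.negOnePow : ℤ) : k)

theorem sgn_add (i j : ℤ) : sgn k (i + j) = sgn k i * sgn k j := by
  simp [sgn, Int.negOnePow_add]

theorem sgn_even {i : ℤ} (h : Even i) : sgn k i = 1 := by simp [sgn, Int.negOnePow_even i h]

theorem sgn_odd {i : ℤ} (h : Odd i) : sgn k i = -1 := by simp [sgn, Int.negOnePow_odd i h]

theorem sgn_eq (i : ℤ) : sgn k i = 1 ∨ sgn k i = -1 := by
  rcases Int.even_or_odd i with h | h
  · exact Or.inl (sgn_even k h)
  · exact Or.inr (sgn_odd k h)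

theorem sgn_mul_self (i : ℤ) : sgn k i * sgn k i = 1 := by
  rcases sgn_eq k i with h | h <;> simp [h]

end Sign

section ParityGraded

variable {k M : Type*} [Field k] [AddCommGroup M] [Module k M] (𝒟 : ℤ → Submodule k M)
  [DirectSum.Decomposition 𝒟]

theorem parity_parity (x : M) : parity 𝒟 (parity 𝒟 x) = x := by
  induction x using DirectSum.Decomposition.inductionOn 𝒟 with
  | zero => simp
  | @homogeneous i x =>
    rw [parity_apply 𝒟 x.2, map_smul, parity_apply 𝒟 x.2, smul_smul, sgn_mul_self, one_smul]
  | add x y hx hy => simp only [map_add, hx, hy]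

end ParityGraded

section ParityMul

variable {k R : Type*} [Field k] [Ring R] [Algebra k R] (𝒟 : ℤ → Submodule k R) [GradedAlgebra 𝒟]

theorem parity_one : parity 𝒟 1 = 1 := by
  rw [parity_apply 𝒟 (SetLike.GradedOne.one_mem (A := 𝒟))]
  simp

theorem parity_mul (x y : R) : parity 𝒟 (x * y) = parity 𝒟 x * parity 𝒟 y := by
  induction x using DirectSum.Decomposition.inductionOn 𝒟 with
  | zero => simp
  | @homogeneous i x =>
    induction y using DirectSum.Decomposition.inductionOn 𝒟 with
    | zero => simp
    | @homogeneous j y =>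
      rw [parity_apply 𝒟 x.2, parity_apply 𝒟 y.2, parity_apply 𝒟 (SetLike.GradedMul.mul_mem x.2 y.2),
        smul_mul_smul_comm, ← sgn_add]
    | add x y hx hy => simp only [map_add, mul_add, hx, hy]
  | add x y hx hy => simp only [map_add, add_mul, hx, hy]

end ParityMul

end OCHA

namespace OCHA

/-! ### Recursions for the coproducts of Λᶜ and Tᶜ -/

section Symmetric

variable {k V : Type*} [Field k] [AddCommGroup V] [Module k V] (𝒱 : ℤ → Submodule k V)
  [DirectSum.Decomposition 𝒱]

theorem parity_symι_mul {i : ℤ} {v : V} (hv : v ∈ 𝒱 i) (x : Sym 𝒱) :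
    parity (symDeg 𝒱) (symι 𝒱 v * x) = sgn k i • (symι 𝒱 v * parity (symDeg 𝒱) x) := by
  rw [parity_mul, parity_apply _ (symι_mem_symDeg hv), smul_mul_assoc]

theorem parity_ι_mul {i : ℤ} {v : V} (hv : v ∈ 𝒱 i) (x : TensorAlgebra k V) :
    parity (tensorDeg 𝒱) (TensorAlgebra.ι k v * x) =
      sgn k i • (TensorAlgebra.ι k v * parity (tensorDeg 𝒱) x) := by
  rw [parity_mul, parity_apply _ (ι_mem_tensorDeg hv), smul_mul_assoc]

theorem symComul_one : symComul 𝒱 1 = 1 ⊗ₜ[k] 1 := by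
  rw [symComul, LinearMap.comp_apply, AlgHom.toLinearMap_apply, map_one]
  rfl

theorem sgn_mul_eq_twist [CharZero k] {M : Type*} [AddCommGroup M] [Module k M]
    (𝒟 : ℤ → Submodule k M) [DirectSum.Decomposition 𝒟] (i : ℤ) {j : ℤ} {x : M} (hx : x ∈ 𝒟 j) :
    sgn k (i * j) • x = twist (parity 𝒟) (sgn k i) x := by
  rcases Int.even_or_odd i with h | h
  · rw [sgn_even k h, sgn_even k (h.mul_right j), twist_one, one_smul, LinearMap.id_apply]
  · rw [sgn_odd k h, twist_neg_one, parity_apply 𝒟 hx]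
    rcases Int.even_or_odd j with h' | h'
    · rw [sgn_even k (h'.mul_left i), show ((j.negOnePow : ℤ) : k) = 1 from sgn_even k h']
    · rw [sgn_odd k (h.mul h'), show ((j.negOnePow : ℤ) : k) = -1 from sgn_odd k h']

/-- The coproduct is an algebra map to the graded tensor product, so it multiplies by v ⊗ 1 + 1 ⊗ v;
the Koszul sign of moving v past the left factor is the twist. -/
theorem symComul_symι_mul [CharZero k] {i : ℤ} {v : V} (hv : v ∈ 𝒱 i) (x : Sym 𝒱) :
    symComul 𝒱 (symι 𝒱 v * x) =
      TensorProduct.map (LinearMap.mulLeft k (symι 𝒱 v)) LinearMap.id (symComul 𝒱 x) +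
      TensorProduct.map (twist (parity (symDeg 𝒱)) (sgn k i)) (LinearMap.mulLeft k (symι 𝒱 v))
        (symComul 𝒱 x) := by
  have key : ∀ z : Sym 𝒱 ⊗[k] Sym 𝒱,
      (GradedTensorProduct.of k (symDeg 𝒱) (symDeg 𝒱)).symm
        (symComulAlg 𝒱 (symι 𝒱 v) * GradedTensorProduct.of k (symDeg 𝒱) (symDeg 𝒱) z) =
      TensorProduct.map (LinearMap.mulLeft k (symι 𝒱 v)) LinearMap.id z +
      TensorProduct.map (twist (parity (symDeg 𝒱)) (sgn k i)) (LinearMap.mulLeft k (symι 𝒱 v))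
        z := by
    intro z
    induction z with
    | zero => simp
    | add a b ha hb =>
      simp only [map_add, mul_add] at ha hb ⊢
      linear_combination (norm := module) ha + hb
    | tmul a b =>
      induction a using DirectSum.Decomposition.inductionOn (symDeg 𝒱) with
      | zero => simp
      | add a c ha hc =>
        simp only [map_add, TensorProduct.add_tmul, mul_add] at ha hc ⊢
        linear_combination (norm := module) ha + hc
      | @homogeneous j a =>
        rw [symComulAlg_symι, add_mul, map_add]
        have e1 := GradedTensorProduct.tmul_one_mul_coe_tmul (R := k) (symDeg 𝒱) (symDeg 𝒱)
          (symι 𝒱 v) a b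
        have e2 := GradedTensorProduct.tmul_coe_mul_coe_tmul (R := k) (symDeg 𝒱) (symDeg 𝒱) 1
          ⟨_, symι_mem_symDeg hv⟩ a b
        rw [one_mul, units_smul_eq (k := k)] at e2
        refine congrArg₂ _ ?_ ?_
        · exact congrArg _ e1
        · refine (congrArg _ e2).trans ?_
          rw [TensorProduct.map_tmul, ← sgn_mul_eq_twist (symDeg 𝒱) i a.2,
            ← TensorProduct.smul_tmul']
          rfl
  rw [← key, symComul, LinearMap.comp_apply, AlgHom.toLinearMap_apply, map_mul]
  rfl

theorem symCounit_one : symCounit 𝒱 1 = 1 := by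
  rw [symCounit, AlgHom.toLinearMap_apply, map_one]

theorem symCounit_symι_mul (v : V) (x : Sym 𝒱) : symCounit 𝒱 (symι 𝒱 v * x) = 0 := by
  rw [symCounit, AlgHom.toLinearMap_apply, map_mul]
  simp [symι_apply, symMk, TensorAlgebra.algebraMapInv]

end Symmetric

section Tensor

variable {k V : Type*} [Field k] [AddCommGroup V] [Module k V]

theorem tensor_induction {P : Submodule k (TensorAlgebra k V)} (h1 : 1 ∈ P)
    (hι : ∀ v, ∀ x ∈ P, TensorAlgebra.ι k v * x ∈ P) : P = ⊤ := by
  rw [eq_top_iff]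
  intro x _
  have : ∀ x : TensorAlgebra k V, ∀ y ∈ P, x * y ∈ P := by
    intro x
    induction x using TensorAlgebra.induction with
    | algebraMap r =>
      intro y hy
      rw [← Algebra.smul_def]
      exact P.smul_mem r hy
    | ι v => exact hι v
    | mul a b ha hb =>
      intro y hy
      rw [mul_assoc]
      exact ha _ (hb _ hy)
    | add a b ha hb =>
      intro y hy
      rw [add_mul]
      exact add_mem (ha _ hy) (hb _ hy)
  simpa using this x 1 h1

theorem deconcat_one : deconcat k V 1 = 1 ⊗ₜ[k] 1 := by
  simp [deconcat, Algebra.TensorProduct.one_def]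

theorem deconcat_ι_mul (v : V) (x : TensorAlgebra k V) :
    deconcat k V (TensorAlgebra.ι k v * x) =
      TensorProduct.map (LinearMap.mulLeft k (TensorAlgebra.ι k v)) LinearMap.id (deconcat k V x) +
        1 ⊗ₜ[k] (TensorAlgebra.ι k v * x) := by
  -- The second coordinate of the defining recursion carries the word itself along, so it supplies
  -- the term 1 ⊗ v x.
  have h : ∀ x, (TensorAlgebra.lift k (deconcatStep k V) x (1, 1)).2 = x := by
    intro x
    have := tensor_induction (P := LinearMap.eqLocus (LinearMap.snd k
      (TensorAlgebra k V ⊗[k] TensorAlgebra k V) (TensorAlgebra k V) ∘ₗ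
      LinearMap.applyₗ (1, 1) ∘ₗ (TensorAlgebra.lift k (deconcatStep k V)).toLinearMap)
      LinearMap.id) (by simp) (fun v x hx => by
        simp only [LinearMap.mem_eqLocus, LinearMap.comp_apply, AlgHom.toLinearMap_apply,
          map_mul, TensorAlgebra.lift_ι_apply, LinearMap.id_apply] at hx ⊢
        change TensorAlgebra.ι k v * _ = _
        exact congrArg _ hx)
    exact LinearMap.mem_eqLocus.1 (this ▸ Submodule.mem_top : x ∈ _)
  change (TensorAlgebra.lift k (deconcatStep k V) (TensorAlgebra.ι k v * x) (1, 1)).1 = _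
  rw [map_mul, TensorAlgebra.lift_ι_apply]
  change (TensorAlgebra.ι k v ⊗ₜ[k] 1) * (TensorAlgebra.lift k (deconcatStep k V) x (1, 1)).1 +
    1 ⊗ₜ[k] (TensorAlgebra.ι k v * (TensorAlgebra.lift k (deconcatStep k V) x (1, 1)).2) = _
  rw [h]
  congr 1
  change _ = TensorProduct.map _ _ (TensorAlgebra.lift k (deconcatStep k V) x (1, 1)).1
  generalize (TensorAlgebra.lift k (deconcatStep k V) x (1, 1)).1 = z
  induction z with
  | zero => simp
  | add a b ha hb => simp only [mul_add, map_add, ha, hb]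
  | tmul a b => simp

variable (k V) in
/-- The projection of the tensor algebra to the scalars, as an endomorphism. -/
def tensorUnit : TensorAlgebra k V →ₗ[k] TensorAlgebra k V :=
  Algebra.linearMap k _ ∘ₗ (TensorAlgebra.algebraMapInv (M := V)).toLinearMap

theorem tensorUnit_apply (x : TensorAlgebra k V) :
    tensorUnit k V x = TensorAlgebra.algebraMapInv x • 1 := by
  simp [tensorUnit, Algebra.algebraMap_eq_smul_one]

theorem tensorUnit_one : tensorUnit k V 1 = 1 := by simp [tensorUnit_apply]

theorem tensorUnit_ι_mul (v : V) (x : TensorAlgebra k V) :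
    tensorUnit k V (TensorAlgebra.ι k v * x) = 0 := by
  simp [tensorUnit_apply, TensorAlgebra.algebraMapInv]

theorem tensorUnit_tensorUnit (x : TensorAlgebra k V) :
    tensorUnit k V (tensorUnit k V x) = tensorUnit k V x := by
  simp [tensorUnit_apply]

/-- This lets the term 1 ⊗ v x of the deconcatenation recursion be written as an operator applied to
Δ x, with the projection to T⁰ on the left factor. -/
theorem tensorUnit_deconcat (x : TensorAlgebra k V) :
    TensorProduct.map (tensorUnit k V) LinearMap.id (deconcat k V x) = 1 ⊗ₜ[k] x := by
  have := tensor_induction (P := LinearMap.eqLocus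
    (TensorProduct.map (tensorUnit k V) LinearMap.id ∘ₗ deconcat k V)
    (TensorProduct.mk k (TensorAlgebra k V) _ 1)) (by simp [deconcat_one, tensorUnit_one])
    (fun v x hx => by
      simp only [LinearMap.mem_eqLocus, LinearMap.comp_apply, TensorProduct.mk_apply] at hx ⊢
      rw [deconcat_ι_mul, map_add, TensorProduct.map_tmul, tensorUnit_one, LinearMap.id_apply]
      convert zero_add _
      generalize deconcat k V x = z
      induction z with
      | zero => simp
      | add a b ha hb => simp only [map_add, ha, hb, add_zero]
      | tmul a b => simp [tensorUnit_ι_mul])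
  exact LinearMap.mem_eqLocus.1 (this ▸ Submodule.mem_top : x ∈ _)

variable (𝒱 : ℤ → Submodule k V) [DirectSum.Decomposition 𝒱]

theorem parity_tensorUnit (x : TensorAlgebra k V) :
    parity (tensorDeg 𝒱) (tensorUnit k V x) = tensorUnit k V (parity (tensorDeg 𝒱) x) := by
  have := tensor_induction (P := LinearMap.eqLocus (parity (tensorDeg 𝒱) ∘ₗ tensorUnit k V)
    (tensorUnit k V ∘ₗ parity (tensorDeg 𝒱))) (by simp [tensorUnit_one, parity_one])
    (fun v x hx => by
      simp only [LinearMap.mem_eqLocus, LinearMap.comp_apply] at hx ⊢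
      rw [tensorUnit_ι_mul, map_zero]
      induction v using DirectSum.Decomposition.inductionOn 𝒱 with
      | zero => simp
      | homogeneous v => rw [parity_ι_mul 𝒱 v.2, map_smul, tensorUnit_ι_mul, smul_zero]
      | add v w hv hw => simp only [map_add, add_mul, ← hv, ← hw, add_zero])
  exact LinearMap.mem_eqLocus.1 (this ▸ Submodule.mem_top : x ∈ _)

end Tensor

theorem evenPart_apply' {k M : Type*} [Field k] [AddCommGroup M] [Module k M] (θ : M →ₗ[k] M)
    (x : M) : evenPart θ x = (2⁻¹ : k) • x + (2⁻¹ : k) • θ x := by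
  rw [evenPart_apply, smul_add]

theorem oddPart_apply' {k M : Type*} [Field k] [AddCommGroup M] [Module k M] (θ : M →ₗ[k] M)
    (x : M) : oddPart θ x = (2⁻¹ : k) • x + (-2⁻¹ : k) • θ x := by
  rw [oddPart_apply, smul_sub, neg_smul, sub_eq_add_neg]

/-! ### The coalgebra Λᶜ Hc ⊗ Tᶜ Ho and its generating operators -/

section OpenClosed

variable {k Hc Ho : Type*} [Field k] [CharZero k] [AddCommGroup Hc] [Module k Hc]
  [AddCommGroup Ho] [Module k Ho] (𝒜 : ℤ → Submodule k Hc) (ℬ : ℤ → Submodule k Ho)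
  [DirectSum.Decomposition 𝒜] [DirectSum.Decomposition ℬ]

instance symTensorAddCommGroup : AddCommGroup (Sym 𝒜 ⊗[k] Sym 𝒜) :=
  TensorProduct.addCommGroup (R := k) (M := Sym 𝒜) (N := Sym 𝒜)

instance ocTensorAddCommGroup : AddCommGroup (OC 𝒜 ℬ ⊗[k] OC 𝒜 ℬ) :=
  TensorProduct.addCommGroup (R := k) (M := OC 𝒜 ℬ) (N := OC 𝒜 ℬ)

/-- The sign (-1)^{|x'||y|} depends on y only through its parity, so even and odd parts of y give a
formula valid without homogeneity. -/
theorem middleFlip_apply (x x' : Sym 𝒜) (y y' : TensorAlgebra k Ho) :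
    middleFlip 𝒜 ℬ ((x ⊗ₜ[k] x') ⊗ₜ[k] (y ⊗ₜ[k] y')) =
      (x ⊗ₜ[k] evenPart (parity (tensorDeg ℬ)) y) ⊗ₜ[k] (x' ⊗ₜ[k] y') +
      (x ⊗ₜ[k] oddPart (parity (tensorDeg ℬ)) y) ⊗ₜ[k] (parity (symDeg 𝒜) x' ⊗ₜ[k] y') := by
  induction x' using DirectSum.Decomposition.inductionOn (symDeg 𝒜) with
  | zero => simp
  | add a c ha hc =>
    simp only [map_add, TensorProduct.add_tmul, TensorProduct.tmul_add] at ha hc ⊢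
    linear_combination (norm := module) ha + hc
  | @homogeneous i x' =>
    induction y using DirectSum.Decomposition.inductionOn (tensorDeg ℬ) with
    | zero => simp
    | add a c ha hc =>
      simp only [map_add, TensorProduct.add_tmul, TensorProduct.tmul_add] at ha hc ⊢
      linear_combination (norm := module) ha + hc
    | @homogeneous j y =>
      rw [middleFlip_tmul 𝒜 ℬ x y' x'.2 y.2, evenPart_apply, oddPart_apply, parity_apply _ y.2,
        parity_apply _ x'.2]
      rcases Int.even_or_odd j with h | h
      · rw [show ((j.negOnePow : ℤ) : k) = 1 from sgn_even k h,
          show (((i * j).negOnePow : ℤ) : k) = 1 from sgn_even k (h.mul_left i)]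
        simp [← two_smul k, smul_smul]
      · rw [show ((j.negOnePow : ℤ) : k) = -1 from sgn_odd k h,
          show (((i * j).negOnePow : ℤ) : k) = sgn k i by
            rcases Int.even_or_odd i with h' | h'
            · rw [sgn_even k h', ← sgn_even k (h'.mul_right j)]
            · rw [sgn_odd k h', ← sgn_odd k (h'.mul h)]]
        simp [← two_smul k, smul_smul, ← TensorProduct.smul_tmul']

/-- Left multiplication by a closed element. -/
def closedMul : Hc →ₗ[k] OC 𝒜 ℬ →ₗ[k] OC 𝒜 ℬ :=
  LinearMap.rTensorHom (TensorAlgebra k Ho) ∘ₗ LinearMap.mul k (Sym 𝒜) ∘ₗ symι 𝒜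

theorem closedMul_tmul (v : Hc) (x : Sym 𝒜) (t : TensorAlgebra k Ho) :
    closedMul 𝒜 ℬ v (x ⊗ₜ[k] t) = (symι 𝒜 v * x) ⊗ₜ[k] t := rfl

/-- Graded left multiplication by an element of the tensor algebra,
`s · (x ⊗ t) = (-1)^{|s||x|} x ⊗ s t`. -/
def openMul : TensorAlgebra k Ho →ₗ[k] OC 𝒜 ℬ →ₗ[k] OC 𝒜 ℬ :=
  TensorProduct.mapBilinear (RingHom.id k) _ _ _ _ (evenPart (parity (symDeg 𝒜))) ∘ₗ LinearMap.mul k _ +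
  TensorProduct.mapBilinear (RingHom.id k) _ _ _ _ (oddPart (parity (symDeg 𝒜))) ∘ₗ LinearMap.mul k _ ∘ₗ
    parity (tensorDeg ℬ)

theorem openMul_tmul (s : TensorAlgebra k Ho) (x : Sym 𝒜) (t : TensorAlgebra k Ho) :
    openMul 𝒜 ℬ s (x ⊗ₜ[k] t) = evenPart (parity (symDeg 𝒜)) x ⊗ₜ[k] (s * t) +
      oddPart (parity (symDeg 𝒜)) x ⊗ₜ[k] (parity (tensorDeg ℬ) s * t) := rfl

end OpenClosed

end OCHA

namespace OCHA

theorem sym_induction {k V : Type*} [Field k] [AddCommGroup V] [Module k V]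
    {𝒱 : ℤ → Submodule k V} {P : Submodule k (Sym 𝒱)} (h1 : 1 ∈ P)
    (hι : ∀ v, ∀ x ∈ P, symι 𝒱 v * x ∈ P) : P = ⊤ := by
  have h := tensor_induction (P := P.comap (symMk 𝒱).toLinearMap) (by simpa using h1)
    (fun v x hx => by
      simp only [Submodule.mem_comap, AlgHom.toLinearMap_apply, map_mul] at hx ⊢
      exact hι v _ hx)
  rw [eq_top_iff]
  intro x _
  obtain ⟨y, rfl⟩ := RingQuot.mkAlgHom_surjective k (SymRel 𝒱) x
  exact (h ▸ Submodule.mem_top : y ∈ P.comap (symMk 𝒱).toLinearMap)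

section OpenClosed

variable {k Hc Ho : Type*} [Field k] [CharZero k] [AddCommGroup Hc] [Module k Hc]
  [AddCommGroup Ho] [Module k Ho] (𝒜 : ℤ → Submodule k Hc) (ℬ : ℤ → Submodule k Ho)
  [DirectSum.Decomposition 𝒜] [DirectSum.Decomposition ℬ]

/-- The operator `x ↦ s^{|x|} x` on `Λᶜ Hc ⊗ Tᶜ Ho`, for a sign `s = ± 1`. -/
def ocTwist (s : k) : OC 𝒜 ℬ →ₗ[k] OC 𝒜 ℬ := twist (M := OC 𝒜 ℬ) (ocParity 𝒜 ℬ) s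

/-- The projection of `Λᶜ Hc ⊗ Tᶜ Ho` to `Λᶜ Hc ⊗ T⁰ Ho`. -/
def closedPart : OC 𝒜 ℬ →ₗ[k] OC 𝒜 ℬ := TensorProduct.map LinearMap.id (tensorUnit k Ho)

theorem closedPart_tmul (x : Sym 𝒜) (t : TensorAlgebra k Ho) :
    closedPart 𝒜 ℬ (x ⊗ₜ[k] t) = x ⊗ₜ[k] tensorUnit k Ho t := rfl

theorem ocParity_tmul (x : Sym 𝒜) (t : TensorAlgebra k Ho) :
    ocParity 𝒜 ℬ (x ⊗ₜ[k] t) = parity (symDeg 𝒜) x ⊗ₜ[k] parity (tensorDeg ℬ) t := rfl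

theorem ocComul_tmul (x : Sym 𝒜) (t : TensorAlgebra k Ho) :
    ocComul 𝒜 ℬ (x ⊗ₜ[k] t) = middleFlip 𝒜 ℬ (symComul 𝒜 x ⊗ₜ[k] deconcat k Ho t) := rfl

theorem openMul_ι_tmul {j : ℤ} {a : Ho} (ha : a ∈ ℬ j) (x : Sym 𝒜) (t : TensorAlgebra k Ho) :
    openMul 𝒜 ℬ (TensorAlgebra.ι k a) (x ⊗ₜ[k] t) =
      twist (parity (symDeg 𝒜)) (sgn k j) x ⊗ₜ[k] (TensorAlgebra.ι k a * t) := by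
  rw [openMul_tmul, parity_apply _ (ι_mem_tensorDeg ha), twist_apply, TensorProduct.add_tmul,
    smul_mul_assoc, TensorProduct.tmul_smul, TensorProduct.smul_tmul']

theorem ocTwist_tmul (s : k) (hs : s = 1 ∨ s = -1) (x : Sym 𝒜) (t : TensorAlgebra k Ho) :
    ocTwist 𝒜 ℬ s (x ⊗ₜ[k] t) =
      twist (parity (symDeg 𝒜)) s x ⊗ₜ[k] twist (parity (tensorDeg ℬ)) s t := by
  rcases hs with rfl | rfl
  · simp [ocTwist, twist_one]
  · simp [ocTwist, twist_neg_one, ocParity_tmul]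

/-- In the term where v acts on the right, v passes both the closed and the open part of the left
factor: the first sign comes from the coproduct of Λᶜ, the second from the middle flip, and together
they are the twist of the whole factor. -/
theorem ocComul_closedMul {i : ℤ} {v : Hc} (hv : v ∈ 𝒜 i) (x : OC 𝒜 ℬ) :
    ocComul 𝒜 ℬ (closedMul 𝒜 ℬ v x) =
      TensorProduct.map (closedMul 𝒜 ℬ v) LinearMap.id (ocComul 𝒜 ℬ x) +
      TensorProduct.map (ocTwist 𝒜 ℬ (sgn k i)) (closedMul 𝒜 ℬ v) (ocComul 𝒜 ℬ x) := by
  induction x using TensorProduct.induction_on with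
  | zero => simp
  | add a b ha hb =>
    simp only [map_add] at ha hb ⊢
    linear_combination (norm := module) ha + hb
  | tmul x t =>
    rw [closedMul_tmul, ocComul_tmul, ocComul_tmul, symComul_symι_mul 𝒜 hv]
    generalize symComul 𝒜 x = z
    generalize deconcat k Ho t = w
    induction z with
    | zero => simp
    | add a b ha hb =>
      simp only [map_add, TensorProduct.add_tmul] at ha hb ⊢
      linear_combination (norm := module) ha + hb
    | tmul x x' =>
      induction w with
      | zero => simp
      | add a b ha hb =>
        simp only [map_add, TensorProduct.tmul_add] at ha hb ⊢
        linear_combination (norm := module) ha + hb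
      | tmul t t' =>
        simp only [TensorProduct.map_tmul, TensorProduct.add_tmul, map_add, middleFlip_apply,
          LinearMap.mulLeft_apply, LinearMap.id_apply, closedMul_tmul, parity_symι_mul 𝒜 hv,
          ocTwist_tmul 𝒜 ℬ _ (sgn_eq k i)]
        congr 1
        rcases sgn_eq k i with h | h
        · rw [h, twist_one, twist_one]
          simp
        · rw [h, twist_neg_one, twist_neg_one]
          simp only [evenPart_apply', oddPart_apply', map_add, map_smul, parity_parity,
            TensorProduct.tmul_add, TensorProduct.add_tmul,
            ← TensorProduct.smul_tmul', TensorProduct.tmul_smul]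
          module

theorem symComul_parity (x : Sym 𝒜) : symComul 𝒜 (parity (symDeg 𝒜) x) =
    TensorProduct.map (parity (symDeg 𝒜)) (parity (symDeg 𝒜)) (symComul 𝒜 x) := by
  have := sym_induction (P := LinearMap.eqLocus (symComul 𝒜 ∘ₗ parity (symDeg 𝒜))
    (TensorProduct.map (parity (symDeg 𝒜)) (parity (symDeg 𝒜)) ∘ₗ symComul 𝒜))
    (by simp [parity_one, symComul_one])
    (fun v x hx => by
      simp only [LinearMap.mem_eqLocus, LinearMap.comp_apply] at hx ⊢
      induction v using DirectSum.Decomposition.inductionOn 𝒜 with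
      | zero => simp
      | add v w hv hw => simp only [map_add, add_mul, hv, hw]
      | @homogeneous i v =>
        rw [parity_symι_mul 𝒜 v.2, map_smul, symComul_symι_mul 𝒜 v.2, symComul_symι_mul 𝒜 v.2, hx]
        have ht : ∀ x, twist (parity (symDeg 𝒜)) (sgn k i) (parity (symDeg 𝒜) x) =
            parity (symDeg 𝒜) (twist (parity (symDeg 𝒜)) (sgn k i) x) := by
          rcases sgn_eq k i with h | h <;> rw [h] <;> simp [twist_one, twist_neg_one]
        have hs := parity_symι_mul 𝒜 v.2
        generalize symComul 𝒜 x = z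
        generalize sgn k i = s at *
        induction z with
        | zero => simp
        | add a b ha hb =>
          simp only [map_add, smul_add] at ha hb ⊢
          linear_combination (norm := module) ha + hb
        | tmul x x' =>
          simp [hs, ht, ← TensorProduct.smul_tmul'])
  exact LinearMap.mem_eqLocus.1 (this ▸ Submodule.mem_top : x ∈ _)

theorem symComul_twist {s : k} (hs : s = 1 ∨ s = -1) (x : Sym 𝒜) :
    symComul 𝒜 (twist (parity (symDeg 𝒜)) s x) =
    TensorProduct.map (twist (parity (symDeg 𝒜)) s) (twist (parity (symDeg 𝒜)) s)
      (symComul 𝒜 x) := by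
  rcases hs with rfl | rfl
  · simp [twist_one]
  · simp [twist_neg_one, symComul_parity]

/-- An open letter can reach the right factor only if no open letter precedes it, so that in this
term the left factor is projected to Λ ⊗ T⁰. -/
theorem ocComul_openMul {j : ℤ} {a : Ho} (ha : a ∈ ℬ j) (x : OC 𝒜 ℬ) :
    ocComul 𝒜 ℬ (openMul 𝒜 ℬ (TensorAlgebra.ι k a) x) =
      TensorProduct.map (openMul 𝒜 ℬ (TensorAlgebra.ι k a)) LinearMap.id (ocComul 𝒜 ℬ x) +
      TensorProduct.map (ocTwist 𝒜 ℬ (sgn k j) ∘ₗ closedPart 𝒜 ℬ)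
        (openMul 𝒜 ℬ (TensorAlgebra.ι k a)) (ocComul 𝒜 ℬ x) := by
  induction x using TensorProduct.induction_on with
  | zero => simp
  | add a b ha hb =>
    simp only [map_add] at ha hb ⊢
    linear_combination (norm := module) ha + hb
  | tmul x t =>
    rw [openMul_ι_tmul 𝒜 ℬ ha, ocComul_tmul, ocComul_tmul, symComul_twist 𝒜 (sgn_eq k j),
      deconcat_ι_mul, TensorProduct.tmul_add, map_add]
    refine congrArg₂ _ ?_ ?_
    · generalize symComul 𝒜 x = z
      generalize deconcat k Ho t = w
      induction z with
      | zero => simp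
      | add a b ha hb => simp only [map_add, TensorProduct.add_tmul, ha, hb]
      | tmul x x' =>
        induction w with
        | zero => simp
        | add a b ha hb => simp only [map_add, TensorProduct.tmul_add, ha, hb]
        | tmul t t' =>
          simp only [TensorProduct.map_tmul, map_add, middleFlip_apply,
            LinearMap.mulLeft_apply, LinearMap.id_apply, openMul_ι_tmul 𝒜 ℬ ha]
          rcases sgn_eq k j with h | h
          · rw [h, twist_one]
            simp [evenPart_apply, oddPart_apply, parity_ι_mul ℬ ha,
              show ((j.negOnePow : ℤ) : k) = 1 from h, mul_add, mul_sub]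
          · rw [h, twist_neg_one]
            simp only [evenPart_apply', oddPart_apply', parity_ι_mul ℬ ha,
              show ((j.negOnePow : ℤ) : k) = -1 from h, mul_add, map_add,
              map_smul, parity_parity, mul_smul_comm,
              TensorProduct.tmul_add, TensorProduct.add_tmul,
              ← TensorProduct.smul_tmul', TensorProduct.tmul_smul]
            module
    -- The projection on the left factor is moved inside the middle flip, to the deconcatenation
    -- coproduct, where `tensorUnit_deconcat` evaluates it.
    · have h1 : ∀ z : Sym 𝒜 ⊗[k] Sym 𝒜, ∀ w : TensorAlgebra k Ho ⊗[k] TensorAlgebra k Ho,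
        TensorProduct.map (ocTwist 𝒜 ℬ (sgn k j) ∘ₗ closedPart 𝒜 ℬ)
          (openMul 𝒜 ℬ (TensorAlgebra.ι k a)) (middleFlip 𝒜 ℬ (z ⊗ₜ[k] w)) =
        TensorProduct.map (ocTwist 𝒜 ℬ (sgn k j))
          (openMul 𝒜 ℬ (TensorAlgebra.ι k a)) (middleFlip 𝒜 ℬ (z ⊗ₜ[k]
            TensorProduct.map (tensorUnit k Ho) LinearMap.id w)) := by
        intro z w
        induction z with
        | zero => simp
        | add a b ha hb => simp only [map_add, TensorProduct.add_tmul, ha, hb]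
        | tmul x x' =>
          induction w with
          | zero => simp
          | add a b ha hb => simp only [map_add, TensorProduct.tmul_add, ha, hb]
          | tmul t t' =>
            simp [middleFlip_apply, closedPart_tmul, evenPart_apply, oddPart_apply,
              parity_tensorUnit]
      rw [h1, tensorUnit_deconcat]
      generalize symComul 𝒜 x = z
      induction z with
      | zero => simp
      | add a b ha hb => simp only [map_add, TensorProduct.add_tmul, ha, hb]
      | tmul x x' =>
        have ht : twist (parity (tensorDeg ℬ)) (sgn k j) 1 = 1 := by
          rcases sgn_eq k j with h | h <;> rw [h] <;> simp [twist_one, twist_neg_one, parity_one]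
        have ht' := ocTwist_tmul 𝒜 ℬ _ (sgn_eq k j)
        have hm := openMul_ι_tmul 𝒜 ℬ ha
        generalize sgn k j = s at *
        simp [middleFlip_apply, evenPart_apply, oddPart_apply, parity_one, hm, ← two_smul k, ht',
          ht]

/-- The open-closed coalgebra with its generating operators. -/
def ocCoalgebra : OpCoalgebra k (OC 𝒜 ℬ) where
  Δ := ocComul 𝒜 ℬ
  θ := ocParity 𝒜 ℬ
  e := closedPart 𝒜 ℬ
  ε := ocCounit 𝒜 ℬ
  one := 1 ⊗ₜ[k] 1
  IsGen g s q := (∃ i, ∃ v ∈ 𝒜 i, g = closedMul 𝒜 ℬ v ∧ s = sgn k i ∧ q = LinearMap.id) ∨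
    (∃ j, ∃ a ∈ ℬ j, g = openMul 𝒜 ℬ (TensorAlgebra.ι k a) ∧ s = sgn k j ∧ q = closedPart 𝒜 ℬ)
  θ_θ x := by
    induction x using TensorProduct.induction_on with
    | zero => simp
    | add a b ha hb => simp only [map_add, ha, hb]
    | tmul x t => simp [ocParity_tmul, parity_parity]
  e_e x := by
    induction x using TensorProduct.induction_on with
    | zero => simp
    | add a b ha hb => simp only [map_add, ha, hb]
    | tmul x t => simp [closedPart_tmul, tensorUnit_tensorUnit]
  θ_e x := by
    induction x using TensorProduct.induction_on with
    | zero => simp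
    | add a b ha hb => simp only [map_add, ha, hb]
    | tmul x t => simp [closedPart_tmul, ocParity_tmul, parity_tensorUnit]
  θ_one := by simp [ocParity_tmul, parity_one]
  e_one := by simp [closedPart_tmul, tensorUnit_one]
  Δ_one := by
    rw [ocComul_tmul, symComul_one, deconcat_one, middleFlip_apply]
    simp [evenPart_apply, oddPart_apply, parity_one, ← two_smul k]
  ε_one := by simp [ocCounit, symCounit_one]
  sign := by
    rintro g s q (⟨i, v, hv, rfl, rfl, rfl⟩ | ⟨j, a, ha, rfl, rfl, rfl⟩)
    · exact sgn_eq k i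
    · exact sgn_eq k j
  θ_gen := by
    rintro g s q (⟨i, v, hv, rfl, rfl, rfl⟩ | ⟨j, a, ha, rfl, rfl, rfl⟩) x
    · induction x using TensorProduct.induction_on with
      | zero => simp
      | add a b ha hb => simp only [map_add, smul_add, ha, hb]
      | tmul x t =>
        rw [closedMul_tmul, ocParity_tmul, ocParity_tmul, closedMul_tmul, parity_symι_mul 𝒜 hv,
          TensorProduct.smul_tmul']
    · induction x using TensorProduct.induction_on with
      | zero => simp
      | add a b ha hb => simp only [map_add, smul_add, ha, hb]
      | tmul x t =>
        have ht : ∀ x, twist (parity (symDeg 𝒜)) (sgn k j) (parity (symDeg 𝒜) x) =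
            parity (symDeg 𝒜) (twist (parity (symDeg 𝒜)) (sgn k j) x) := by
          rcases sgn_eq k j with h | h <;> rw [h] <;> simp [twist_one, twist_neg_one]
        rw [openMul_ι_tmul 𝒜 ℬ ha, ocParity_tmul, ocParity_tmul, openMul_ι_tmul 𝒜 ℬ ha,
          parity_ι_mul ℬ ha, TensorProduct.tmul_smul, ht]
  e_gen := by
    rintro g s q (⟨i, v, hv, rfl, rfl, rfl⟩ | ⟨j, a, ha, rfl, rfl, rfl⟩)
    · refine Or.inl ⟨rfl, fun x => ?_⟩
      induction x using TensorProduct.induction_on with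
      | zero => simp
      | add a b ha hb => simp only [map_add, ha, hb]
      | tmul x t => rfl
    · refine Or.inr ⟨rfl, fun x => ?_⟩
      induction x using TensorProduct.induction_on with
      | zero => simp
      | add a b ha hb => simp only [map_add, ha, hb, add_zero]
      | tmul x t => rw [openMul_ι_tmul 𝒜 ℬ ha, closedPart_tmul, tensorUnit_ι_mul,
          TensorProduct.tmul_zero]
  ε_gen := by
    rintro g s q (⟨i, v, hv, rfl, rfl, rfl⟩ | ⟨j, a, ha, rfl, rfl, rfl⟩) x
    · induction x using TensorProduct.induction_on with
      | zero => simp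
      | add a b ha hb => simp only [map_add, ha, hb, add_zero]
      | tmul x t =>
        rw [closedMul_tmul]
        simp [ocCounit, symCounit_symι_mul]
    · induction x using TensorProduct.induction_on with
      | zero => simp
      | add a b ha hb => simp only [map_add, ha, hb, add_zero]
      | tmul x t =>
        rw [openMul_ι_tmul 𝒜 ℬ ha]
        simp [ocCounit, TensorAlgebra.algebraMapInv]
  Δ_gen := by
    rintro g s q (⟨i, v, hv, rfl, rfl, rfl⟩ | ⟨j, a, ha, rfl, rfl, rfl⟩) x
    · exact ocComul_closedMul 𝒜 ℬ hv x
    · exact ocComul_openMul 𝒜 ℬ ha x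
  induction := by
    intro P h1 hg
    -- Open letters are put on first, over 1 ∈ Λ⁰, where left multiplication by them carries no
    -- sign; closed letters follow.
    have h2 : ∀ t : TensorAlgebra k Ho, (1 : Sym 𝒜) ⊗ₜ[k] t ∈ P := by
      intro t
      have := tensor_induction (P := P.comap (TensorProduct.mk k (Sym 𝒜) _ 1)) h1
        (fun v x hx => by
          simp only [Submodule.mem_comap, TensorProduct.mk_apply] at hx ⊢
          induction v using DirectSum.Decomposition.inductionOn ℬ with
          | zero => simp
          | add v w hv hw =>
            simp only [map_add, add_mul, TensorProduct.tmul_add]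
            exact add_mem hv hw
          | @homogeneous j v =>
            have := hg (Or.inr ⟨j, v, v.2, rfl, rfl, rfl⟩) _ hx
            rw [openMul_ι_tmul 𝒜 ℬ v.2] at this
            convert this using 2
            rcases sgn_eq k j with h | h <;> rw [h] <;>
              simp [twist_one, twist_neg_one, parity_one])
      exact (this ▸ Submodule.mem_top :
        t ∈ P.comap (TensorProduct.mk k (Sym 𝒜) (TensorAlgebra k Ho) 1))
    rw [eq_top_iff, ← TensorProduct.span_tmul_eq_top, Submodule.span_le]
    rintro _ ⟨x, t, rfl⟩
    have := sym_induction (P := P.comap ((TensorProduct.mk k (Sym 𝒜) _).flip t)) (h2 t)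
        (fun v x hx => by
          simp only [Submodule.mem_comap, LinearMap.flip_apply, TensorProduct.mk_apply] at hx ⊢
          induction v using DirectSum.Decomposition.inductionOn 𝒜 with
          | zero => simp
          | add v w hv hw =>
            simp only [map_add, add_mul, TensorProduct.add_tmul]
            exact add_mem hv hw
          | @homogeneous i v => exact hg (Or.inl ⟨i, v, v.2, rfl, rfl, rfl⟩) _ hx)
    exact (this ▸ Submodule.mem_top :
        x ∈ P.comap ((TensorProduct.mk k (Sym 𝒜) (TensorAlgebra k Ho)).flip t))

end OpenClosed

end OCHA

namespace OCHA

/-! ### Koszul signs of permutations -/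

section PermSign

variable {n : ℕ}

theorem permSign_eq_prod (d : Fin n → ℤ) (σ : Equiv.Perm (Fin n)) :
    permSign d σ = ∏ p : Fin n × Fin n with p.1 < p.2,
      if σ p.2 < σ p.1 then (d (σ p.1) * d (σ p.2)).negOnePow else 1 := by
  rw [permSign, ← Fintype.prod_prod_type', Finset.prod_filter]
  refine Finset.prod_congr rfl fun p _ => ?_
  by_cases h1 : p.1 < p.2 <;> simp [h1]

/-- The factors of σ are reindexed along τ as factors of unordered pairs. A pair inverted by τ and
inverted back by σ contributes its sign twice, which is 1; in all other cases the inversions add up.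
-/
theorem permSign_mul (d : Fin n → ℤ) (σ τ : Equiv.Perm (Fin n)) :
    permSign d (σ * τ) = permSign d σ * permSign (fun t => d (σ t)) τ := by
  have h : permSign d σ = ∏ p : Fin n × Fin n with p.1 < p.2,
      if τ p.1 < τ p.2 then
        (if σ (τ p.2) < σ (τ p.1) then (d (σ (τ p.1)) * d (σ (τ p.2))).negOnePow else 1)
      else (if σ (τ p.1) < σ (τ p.2) then (d (σ (τ p.1)) * d (σ (τ p.2))).negOnePow else 1) := by
    rw [permSign_eq_prod]
    symm
    refine Finset.prod_bij'
      (fun p _ => if τ p.1 < τ p.2 then (τ p.1, τ p.2) else (τ p.2, τ p.1))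
      (fun p _ => if τ.symm p.1 < τ.symm p.2 then (τ.symm p.1, τ.symm p.2)
        else (τ.symm p.2, τ.symm p.1)) ?_ ?_ ?_ ?_ ?_
    · rintro ⟨i, j⟩ h
      simp only [Finset.mem_filter, Finset.mem_univ, true_and] at h ⊢
      split_ifs with h1
      · exact h1
      · exact lt_of_le_of_ne (not_lt.1 h1) fun h2 => h.ne (τ.injective h2.symm)
    · rintro ⟨i, j⟩ h
      simp only [Finset.mem_filter, Finset.mem_univ, true_and] at h ⊢
      split_ifs with h1
      · exact h1
      · exact lt_of_le_of_ne (not_lt.1 h1) fun h2 => h.ne (τ.symm.injective h2.symm)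
    · rintro ⟨i, j⟩ h
      simp only [Finset.mem_filter, Finset.mem_univ, true_and] at h ⊢
      by_cases h1 : τ i < τ j <;> simp [h1, h, h.le]
    · rintro ⟨i, j⟩ h
      simp only [Finset.mem_filter, Finset.mem_univ, true_and] at h ⊢
      by_cases h1 : τ.symm i < τ.symm j <;> simp [h1, h, h.le]
    · rintro ⟨i, j⟩ h
      simp only [Finset.mem_filter, Finset.mem_univ, true_and] at h ⊢
      by_cases h1 : τ i < τ j
      · simp [h1]
      · simp [h1, mul_comm]
  rw [h, permSign_eq_prod, permSign_eq_prod, ← Finset.prod_mul_distrib]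
  refine Finset.prod_congr rfl ?_
  rintro ⟨i, j⟩ hij
  simp only [Finset.mem_filter, Finset.mem_univ, true_and] at hij
  simp only [Equiv.Perm.mul_apply]
  have hne : σ (τ i) ≠ σ (τ j) := fun h => hij.ne (τ.injective (σ.injective h))
  have hne' : τ i ≠ τ j := fun h => hij.ne (τ.injective h)
  by_cases h1 : τ i < τ j
  · simp only [h1, not_lt.2 h1.le, if_true, if_false, mul_one]
    congr
  · have h2 : τ j < τ i := lt_of_le_of_ne (not_lt.1 h1) hne'.symm
    by_cases h3 : σ (τ i) < σ (τ j)
    · simp [h1, h2, h3, not_lt.2 h3.le, Int.units_mul_self]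
    · have h4 : σ (τ j) < σ (τ i) := lt_of_le_of_ne (not_lt.1 h3) hne.symm
      simp [h1, h2, h3, h4]

theorem permSign_one (d : Fin n → ℤ) : permSign d 1 = 1 := by
  rw [permSign_eq_prod]
  refine Finset.prod_eq_one fun p hp => ?_
  simp only [Finset.mem_filter, Finset.mem_univ, true_and] at hp
  simp [hp.not_gt]

theorem permSign_swap (d : Fin n → ℤ) (a b : Fin n) (h : b.val = a.val + 1) :
    permSign d (Equiv.swap a b) = (d a * d b).negOnePow := by
  rw [permSign_eq_prod, Finset.prod_eq_single (a, b)]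
  · have : a < b := by rw [Fin.lt_def]; omega
    simp [this, mul_comm]
  · rintro ⟨i, j⟩ hij hne
    simp only [Finset.mem_filter, Finset.mem_univ, true_and] at hij
    rw [if_neg]
    simp only [ne_eq, Prod.mk.injEq, not_and] at hne
    simp only [Equiv.swap_apply_def, Fin.ext_iff, Fin.lt_def] at hij hne ⊢
    split_ifs <;> omega
  · intro hab
    simp only [Finset.mem_filter, Finset.mem_univ, true_and, Fin.lt_def] at hab
    omega

end PermSign

section Wedge

variable {k V : Type*} [Field k] [AddCommGroup V] [Module k V] (𝒱 : ℤ → Submodule k V)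

theorem wedge_succ {n : ℕ} (v : Fin (n + 1) → V) :
    wedge 𝒱 v = symι 𝒱 (v 0) * wedge 𝒱 (fun t => v t.succ) := by
  rw [wedge, tprod_succ, map_mul]
  rfl

theorem wedge_zero (v : Fin 0 → V) : wedge 𝒱 v = 1 := by
  simp [wedge, TensorAlgebra.tprod_apply]

theorem tprod_zero (v : Fin 0 → V) : TensorAlgebra.tprod k V 0 v = 1 := by
  simp [TensorAlgebra.tprod_apply]

theorem wedge_swap {n : ℕ} {d : Fin (n + 1) → ℤ} {v : Fin (n + 1) → V} (hv : ∀ t, v t ∈ 𝒱 (d t))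
    (i : Fin n) : wedge 𝒱 v = sgn k (d i.castSucc * d i.succ) •
      wedge 𝒱 (fun t => v (Equiv.swap i.castSucc i.succ t)) := by
  induction n with
  | zero => exact i.elim0
  | succ n ih =>
    refine Fin.cases ?_ (fun i => ?_) i
    · rw [wedge_succ, wedge_succ, wedge_succ, wedge_succ, ← mul_assoc, ← mul_assoc]
      have h := symι_mul_symι (hv 0) (hv 1)
      rw [units_smul_eq (k := k)] at h
      simp only [Fin.castSucc_zero, Fin.succ_zero_eq_one, Equiv.swap_apply_left,
        Equiv.swap_apply_right]
      rw [h, smul_mul_assoc]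
      congr 3
    · rw [wedge_succ, wedge_succ 𝒱 (fun t => v (Equiv.swap _ _ t)), ih (d := fun t => d t.succ)
        (fun t => hv t.succ) i, mul_smul_comm, Equiv.swap_apply_of_ne_of_ne]
      · simp only [Fin.succ_castSucc]
        congr 3
        funext t
        rw [← Fin.succ_castSucc]
        exact congrArg v (Function.Injective.map_swap (Fin.succ_injective (n + 1)) _ _ _)
      · exact fun h => absurd (congrArg Fin.val h) (by simp)
      · exact fun h => absurd (congrArg Fin.val h) (by simp)

/-- Adjacent transpositions generate the symmetric group, and the signs compose by the cocycle
identity `permSign_mul`. -/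
theorem wedge_perm {n : ℕ} {d : Fin n → ℤ} {v : Fin n → V} (hv : ∀ t, v t ∈ 𝒱 (d t))
    (σ : Equiv.Perm (Fin n)) :
    wedge 𝒱 v = ((permSign d σ : ℤ) : k) • wedge 𝒱 (fun t => v (σ t)) := by
  cases n with
  | zero =>
    rw [Subsingleton.elim σ 1, permSign_one]
    simp
  | succ n =>
    have hσ : σ ∈ Submonoid.closure
        (Set.range fun i : Fin n ↦ Equiv.swap i.castSucc i.succ) := by
      rw [Equiv.Perm.mclosure_swap_castSucc_succ]
      trivial
    induction hσ using Submonoid.closure_induction generalizing d v with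
    | mem x hx =>
      obtain ⟨i, rfl⟩ := hx
      rw [permSign_swap _ _ _ (by simp)]
      exact wedge_swap 𝒱 hv i
    | one =>
      rw [permSign_one]
      simp
    | mul x y _ _ hx hy =>
      rw [hx hv, hy (d := fun t => d (x t)) (v := fun t => v (x t)) (fun t => hv _), permSign_mul,
        smul_smul, Units.val_mul, Int.cast_mul]
      rfl

end Wedge

/-! ### Descent of graded symmetric families to Λᶜ -/

section Lifts

variable {k V : Type*} [Field k] [AddCommGroup V] [Module k V] {W : Type*} [AddCommGroup W]
  [Module k W]

/-- The linear map on the tensor algebra given by a family of multilinear maps. -/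
def tensorLift : (∀ n : ℕ, MultilinearMap k (fun _ : Fin n => V) W) →ₗ[k]
    (TensorAlgebra k V →ₗ[k] W) where
  toFun F := DirectSum.toModule k ℕ W (fun n => PiTensorProduct.lift (F n)) ∘ₗ
    (TensorAlgebra.equivDirectSum (R := k) (M := V)).toLinearMap
  map_add' F G := by
    rw [← LinearMap.add_comp]
    congr 1
    ext
    simp
  map_smul' r F := by
    rw [RingHom.id_apply, ← LinearMap.smul_comp]
    congr 1
    ext
    simp

theorem tensorLift_tprod (F : ∀ n : ℕ, MultilinearMap k (fun _ : Fin n => V) W) {n : ℕ}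
    (v : Fin n → V) : tensorLift F (TensorAlgebra.tprod k V n v) = F n v := by
  change DirectSum.toModule k ℕ W (fun n => PiTensorProduct.lift (F n))
    (TensorAlgebra.toDirectSum (TensorAlgebra.tprod k V n v)) = F n v
  rw [TensorAlgebra.toDirectSum_tensorPower_tprod, ← DirectSum.lof_eq_of k, DirectSum.toModule_lof]
  simp

variable (𝒱 : ℤ → Submodule k V)

/-- Λᶜ is a quotient by a two-sided ideal, so a merely linear map descends when it respects each
defining relation inside every context a · b. -/
theorem exists_descend (g : TensorAlgebra k V →ₗ[k] W)
    (hg : ∀ i j x y, x ∈ 𝒱 i → y ∈ 𝒱 j → ∀ a b,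
      g (a * (TensorAlgebra.ι k x * TensorAlgebra.ι k y) * b) =
        sgn k (i * j) • g (a * (TensorAlgebra.ι k y * TensorAlgebra.ι k x) * b)) :
    ∃ G : Sym 𝒱 →ₗ[k] W, ∀ x, G (symMk 𝒱 x) = g x := by
  -- The contexts a, b are kept universally quantified so that the induction passes through the
  -- multiplicative closure of the relation.
  have h1 : ∀ x y, RingQuot.Rel (SymRel 𝒱) x y → ∀ a b, g (a * x * b) = g (a * y * b) := by
    intro x y h
    induction h with
    | of h =>
      intro a b
      cases h with
      | swap hx hy =>
        rw [hg _ _ _ _ hx hy, units_smul_eq (k := k), mul_smul_comm, smul_mul_assoc, map_smul]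
    | add_left _ ih =>
      intro a b
      simp only [mul_add, add_mul, map_add, ih]
    | mul_left _ ih =>
      rename_i c _
      intro a b
      simpa only [mul_assoc] using ih a (c * b)
    | mul_right _ ih =>
      rename_i a b c _
      intro x y
      simpa only [mul_assoc] using ih (x * a) y
  have h2 : ∀ x y, symMk 𝒱 x = symMk 𝒱 y → g x = g y := by
    intro x y h
    have h3 : Quot.mk (RingQuot.Rel (SymRel 𝒱)) x = Quot.mk _ y := by
      simpa [symMk, RingQuot.mkAlgHom_def, RingQuot.mkRingHom_def] using h
    have h4 := Quot.eqvGen_exact h3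
    induction h4 with
    | rel x y h5 => simpa using h1 x y h5 1 1
    | refl => rfl
    | symm x y _ ih => exact (ih (h.symm) h3.symm).symm
    | trans x y z hxy hyz ih1 ih2 =>
      have e1 : Quot.mk (RingQuot.Rel (SymRel 𝒱)) x = Quot.mk _ y := Quot.eqvGen_sound hxy
      have e2 : symMk 𝒱 x = symMk 𝒱 y := by
        simpa [symMk, RingQuot.mkAlgHom_def, RingQuot.mkRingHom_def] using e1
      exact (ih1 e2 e1).trans (ih2 (e2.symm.trans h) (e1.symm.trans h3))
  have hs : Function.Surjective (symMk 𝒱).toLinearMap := RingQuot.mkAlgHom_surjective k (SymRel 𝒱)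
  refine ⟨(LinearMap.ker (symMk 𝒱).toLinearMap).liftQ g (fun x hx => ?_) ∘ₗ
    ((symMk 𝒱).toLinearMap.quotKerEquivOfSurjective hs).symm.toLinearMap, fun x => ?_⟩
  · rw [LinearMap.mem_ker] at hx ⊢
    rw [h2 x 0 (by simpa using hx), map_zero]
  · have : ((symMk 𝒱).toLinearMap.quotKerEquivOfSurjective hs).symm (symMk 𝒱 x) =
        Submodule.Quotient.mk x := by
      rw [LinearEquiv.symm_apply_eq]
      rfl
    rw [LinearMap.comp_apply, LinearEquiv.coe_coe, this]
    rfl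

variable [DirectSum.Decomposition 𝒱]

theorem span_tprod_homogeneous : Submodule.span k {x : TensorAlgebra k V |
    ∃ (n : ℕ) (d : Fin n → ℤ) (v : Fin n → V), (∀ t, v t ∈ 𝒱 (d t)) ∧
      x = TensorAlgebra.tprod k V n v} = ⊤ := by
  refine tensor_induction (Submodule.subset_span ⟨0, Fin.elim0, Fin.elim0, fun t => t.elim0,
    (tprod_zero _).symm⟩) (fun v x hx => ?_)
  induction v using DirectSum.Decomposition.inductionOn 𝒱 with
  | zero => simp
  | add v w hv hw =>
    rw [map_add, add_mul]
    exact add_mem hv hw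
  | @homogeneous i v =>
    induction hx using Submodule.span_induction with
    | mem x hx =>
      obtain ⟨n, d, w, hw, rfl⟩ := hx
      refine Submodule.subset_span ⟨n + 1, Fin.cons i d, Fin.cons v w, ?_, ?_⟩
      · intro t
        refine Fin.cases ?_ (fun t => ?_) t <;> simp [hw]
      · rw [tprod_succ]
        rfl
    | zero => simp
    | add x y _ _ hx hy =>
      rw [mul_add]
      exact add_mem hx hy
    | smul r x _ hx =>
      rw [mul_smul_comm]
      exact Submodule.smul_mem _ _ hx

/-- A family of graded symmetric multilinear maps descends to the graded symmetric algebra. -/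
theorem exists_symLift (F : ∀ n : ℕ, MultilinearMap k (fun _ : Fin n => V) W)
    (hF : ∀ (n : ℕ) (d : Fin n → ℤ) (v : Fin n → V) (σ : Equiv.Perm (Fin n)),
      (∀ t, v t ∈ 𝒱 (d t)) → F n v = ((permSign d σ : ℤ) : k) • F n (fun t => v (σ t))) :
    ∃ G : Sym 𝒱 →ₗ[k] W, ∀ (n : ℕ) (v : Fin n → V), G (wedge 𝒱 v) = F n v := by
  suffices h : ∀ i j x y, x ∈ 𝒱 i → y ∈ 𝒱 j → ∀ a b,
      tensorLift F (a * (TensorAlgebra.ι k x * TensorAlgebra.ι k y) * b) =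
        sgn k (i * j) • tensorLift F (a * (TensorAlgebra.ι k y * TensorAlgebra.ι k x) * b) by
    obtain ⟨G, hG⟩ := exists_descend 𝒱 (tensorLift F) h
    exact ⟨G, fun n v => (hG _).trans (tensorLift_tprod F v)⟩
  intro i j x y hx hy a b
  have ha : a ∈ Submodule.span k {x : TensorAlgebra k V |
    ∃ (n : ℕ) (d : Fin n → ℤ) (v : Fin n → V), (∀ t, v t ∈ 𝒱 (d t)) ∧
      x = TensorAlgebra.tprod k V n v} := by rw [span_tprod_homogeneous]; trivial
  have hb : b ∈ Submodule.span k {x : TensorAlgebra k V |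
    ∃ (n : ℕ) (d : Fin n → ℤ) (v : Fin n → V), (∀ t, v t ∈ 𝒱 (d t)) ∧
      x = TensorAlgebra.tprod k V n v} := by rw [span_tprod_homogeneous]; trivial
  induction ha, hb using Submodule.span_induction₂ with
  | zero_left => simp
  | zero_right => simp
  | add_left x y z _ _ _ h1 h2 => simp only [add_mul, map_add, smul_add, h1, h2]
  | add_right x y z _ _ _ h1 h2 => simp only [mul_add, map_add, smul_add, h1, h2]
  | smul_left r x y _ _ h => simp only [smul_mul_assoc, map_smul, h, smul_comm r]
  | smul_right r x y _ _ h => simp only [mul_smul_comm, map_smul, h, smul_comm r]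
  | mem_mem a b ha hb =>
    obtain ⟨m, d, v, hv, rfl⟩ := ha
    obtain ⟨n, e, w, hw, rfl⟩ := hb
    have h2 : ∀ x y : V, TensorAlgebra.ι k x * TensorAlgebra.ι k y =
        TensorAlgebra.tprod k V 2 ![x, y] := by
      intro x y
      simp [TensorAlgebra.tprod_apply]
    rw [h2, h2, tprod_mul_tprod, tprod_mul_tprod, tprod_mul_tprod, tprod_mul_tprod,
      tensorLift_tprod, tensorLift_tprod]
    -- p and q are the adjacent positions of x and y in the word a x y b; exchanging them is a
    -- transposition to which the symmetry of F applies.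
    let p : Fin (m + 2 + n) := Fin.castAdd n (Fin.natAdd m 0)
    let q : Fin (m + 2 + n) := Fin.castAdd n (Fin.natAdd m 1)
    rw [hF _ (Fin.append (Fin.append d ![i, j]) e) _ (Equiv.swap p q), permSign_swap]
    · congr 1
      · simp [p, q]
      · congr 1
        funext t
        refine Fin.addCases (fun t => ?_) (fun t => ?_) t
        · refine Fin.addCases (fun t => ?_) (fun t => ?_) t
          · rw [Equiv.swap_apply_of_ne_of_ne]
            · simp
            · exact fun h => absurd (congrArg Fin.val h) (by simp [p]; omega)
            · exact fun h => absurd (congrArg Fin.val h) (by simp [q]; omega)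
          · fin_cases t
            · change Fin.append _ _ (Equiv.swap p q p) = _
              rw [Equiv.swap_apply_left]
              simp [q]
            · change Fin.append _ _ (Equiv.swap p q q) = _
              rw [Equiv.swap_apply_right]
              simp [p]
        · rw [Equiv.swap_apply_of_ne_of_ne]
          · simp
          · exact fun h => absurd (congrArg Fin.val h) (by simp [p]; omega)
          · exact fun h => absurd (congrArg Fin.val h) (by simp [q]; omega)
    · simp [p, q]
    · intro t
      refine Fin.addCases (fun t => ?_) (fun t => ?_) t
      · refine Fin.addCases (fun t => ?_) (fun t => ?_) t
        · simp [hv]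
        · fin_cases t <;> simp [hx, hy]
      · simp [hw]

end Lifts

end OCHA

namespace OCHA

/-! ### Closed and open extensions of components -/

namespace OpCoalgebra

variable {k C : Type*} [Field k] [CharZero k] [AddCommGroup C] [Module k C] (A : OpCoalgebra k C)
  {W : Type*} [AddCommGroup W] [Module k W] (𝒟 : ℤ → Submodule k W) [DirectSum.Decomposition 𝒟]

/-- With even and odd parts of the left factor and the parity of w, the twist by (-1)^{|w|} becomes
linear in w, so homogeneous w suffice. The result is the form of the recursion used by `Δ_extend`.
-/
theorem Δ_family (M : W →ₗ[k] C →ₗ[k] C) (q : C →ₗ[k] C)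
    (hM : ∀ i, ∀ w ∈ 𝒟 i, A.IsGen (M w) (sgn k i) q) (w : W) (x : C) :
    A.Δ (M w x) = TensorProduct.map (M w) LinearMap.id (A.Δ x) +
      (TensorProduct.map (evenPart A.θ ∘ₗ q) (M w) (A.Δ x) +
        TensorProduct.map (oddPart A.θ ∘ₗ q) (M (parity 𝒟 w)) (A.Δ x)) := by
  induction w using DirectSum.Decomposition.inductionOn 𝒟 with
  | zero => simp
  | add v w hv hw =>
    simp only [map_add, LinearMap.add_apply, hv, hw, TensorProduct.map_add_left,
      TensorProduct.map_add_right]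
    abel
  | @homogeneous i w =>
    rw [A.Δ_gen (hM i w w.2), parity_apply _ w.2, map_smul]
    congr 1
    generalize A.Δ x = z
    induction z with
    | zero => simp
    | add a b ha hb =>
      simp only [map_add] at ha hb ⊢
      rw [ha, hb]
      abel
    | tmul a b =>
      simp only [TensorProduct.map_tmul, LinearMap.comp_apply, twist_apply,
        LinearMap.smul_apply, TensorProduct.add_tmul, ← TensorProduct.smul_tmul',
        TensorProduct.tmul_smul]

/-- Since f = f ∘ e, the exchange of the first two factors is covered by `cocomm_left`. -/
theorem Δ_extend_closed (M : W →ₗ[k] C →ₗ[k] C) (f : C →ₗ[k] W)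
    (hM : ∀ i, ∀ w ∈ 𝒟 i, A.IsGen (M w) (sgn k i) LinearMap.id)
    (hf : ∀ x, parity 𝒟 (f x) = - f (A.θ x)) (hfe : ∀ x, f (A.e x) = f x) (x : C) :
    A.Δ (A.extend M f x) = TensorProduct.map (A.extend M f) LinearMap.id (A.Δ x) +
      TensorProduct.map A.θ (A.extend M f) (A.Δ x) := by
  refine A.Δ_extend (parity 𝒟) M LinearMap.id f (A.Δ_family 𝒟 M _ hM) hf (fun _ => rfl)
    (fun x => ?_) x
  have h : ∀ z : C ⊗[k] C, TensorProduct.map f LinearMap.id z =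
      TensorProduct.map f LinearMap.id
        (TensorProduct.map A.e (LinearMap.id (M := C) (R := k)) z) := by
    intro z
    induction z with
    | zero => simp
    | add a b ha hb => simp only [map_add, ← ha, ← hb]
    | tmul a b => simp [hfe]
  rw [h, A.cocomm_left, ← h]

/-- Here f is unrestricted, and it is q = e on the other factor that allows the exchange, by
`cocomm_right`. The price is the e in the conclusion. -/
theorem Δ_extend_open (M : W →ₗ[k] C →ₗ[k] C) (f : C →ₗ[k] W)
    (hM : ∀ i, ∀ w ∈ 𝒟 i, A.IsGen (M w) (sgn k i) A.e)
    (hf : ∀ x, parity 𝒟 (f x) = - f (A.θ x)) (x : C) :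
    A.Δ (A.extend M f x) = TensorProduct.map (A.extend M f) LinearMap.id (A.Δ x) +
      TensorProduct.map (A.θ ∘ₗ A.e) (A.extend M f) (A.Δ x) := by
  refine A.Δ_extend (parity 𝒟) M A.e f (A.Δ_family 𝒟 M _ hM) hf (fun x => (A.θ_e x).symm)
    (fun x => ?_) x
  have h : ∀ z : C ⊗[k] C, TensorProduct.map f A.e z =
      TensorProduct.map f LinearMap.id (TensorProduct.map LinearMap.id A.e z) := by
    intro z
    induction z with
    | zero => simp
    | add a b ha hb => simp only [map_add, ha, hb]
    | tmul a b => simp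
  rw [h, A.cocomm_right, ← h]

end OpCoalgebra

/-! ### Coderivations with prescribed closed or open component -/

section Lift

variable {k Hc Ho : Type*} [Field k] [CharZero k] [AddCommGroup Hc] [Module k Hc]
  [AddCommGroup Ho] [Module k Ho] (𝒜 : ℤ → Submodule k Hc) (ℬ : ℤ → Submodule k Ho)
  [DirectSum.Decomposition 𝒜] [DirectSum.Decomposition ℬ]

/-- The projection of `Λᶜ Hc ⊗ Tᶜ Ho` to `Tᶜ Ho`. -/
def openProj : OC 𝒜 ℬ →ₗ[k] TensorAlgebra k Ho :=
  (TensorProduct.lid k _).toLinearMap ∘ₗ TensorProduct.map (symCounit 𝒜) LinearMap.id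

theorem openProj_tmul (x : Sym 𝒜) (t : TensorAlgebra k Ho) :
    openProj 𝒜 ℬ (x ⊗ₜ[k] t) = symCounit 𝒜 x • t := rfl

theorem ocCounit_tmul (x : Sym 𝒜) (t : TensorAlgebra k Ho) :
    ocCounit 𝒜 ℬ (x ⊗ₜ[k] t) = symCounit 𝒜 x * TensorAlgebra.algebraMapInv t := rfl

/-- The map `x ↦ f(x₁) · x₂` for `f : Λᶜ Hc ⊗ Tᶜ Ho → Hc`. -/
def closedExtend (f : OC 𝒜 ℬ →ₗ[k] Hc) : OC 𝒜 ℬ →ₗ[k] OC 𝒜 ℬ :=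
  (ocCoalgebra 𝒜 ℬ).extend (closedMul 𝒜 ℬ) f

/-- The map `x ↦ f(x₁) · x₂` for `f : Λᶜ Hc ⊗ Tᶜ Ho → Ho`. -/
def openInsert (f : OC 𝒜 ℬ →ₗ[k] Ho) : OC 𝒜 ℬ →ₗ[k] OC 𝒜 ℬ :=
  (ocCoalgebra 𝒜 ℬ).extend (openMul 𝒜 ℬ ∘ₗ TensorAlgebra.ι k) f

/-- The map `x ↦ ± x₁ · f(x₂) · x₃` for `f : Λᶜ Hc ⊗ Tᶜ Ho → Ho`, with `x₁` projected to
`Tᶜ Ho`. -/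
def openExtend (f : OC 𝒜 ℬ →ₗ[k] Ho) : OC 𝒜 ℬ →ₗ[k] OC 𝒜 ℬ :=
  TensorProduct.lift (openMul 𝒜 ℬ) ∘ₗ
    TensorProduct.map (parity (tensorDeg ℬ) ∘ₗ openProj 𝒜 ℬ) (openInsert 𝒜 ℬ f) ∘ₗ
      ocComul 𝒜 ℬ

theorem symCounit_parity (x : Sym 𝒜) : symCounit 𝒜 (parity (symDeg 𝒜) x) = symCounit 𝒜 x := by
  have := sym_induction (P := LinearMap.eqLocus (symCounit 𝒜 ∘ₗ parity (symDeg 𝒜)) (symCounit 𝒜))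
    (by simp [parity_one])
    (fun v x hx => by
      simp only [LinearMap.mem_eqLocus, LinearMap.comp_apply] at hx ⊢
      induction v using DirectSum.Decomposition.inductionOn 𝒜 with
      | zero => simp
      | add v w hv hw => simp only [map_add, add_mul, hv, hw]
      | homogeneous v =>
        rw [parity_symι_mul 𝒜 v.2, map_smul, symCounit_symι_mul, symCounit_symι_mul, smul_zero])
  exact LinearMap.mem_eqLocus.1 (this ▸ Submodule.mem_top : x ∈ _)

theorem algebraMapInv_parity (t : TensorAlgebra k Ho) :
    TensorAlgebra.algebraMapInv (parity (tensorDeg ℬ) t) = TensorAlgebra.algebraMapInv t := by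
  have h := congrArg TensorAlgebra.algebraMapInv (parity_tensorUnit ℬ t)
  rw [tensorUnit_apply, tensorUnit_apply, map_smul, parity_one] at h
  simpa using h.symm

theorem openMul_one (x : OC 𝒜 ℬ) : openMul 𝒜 ℬ 1 x = x := by
  induction x using TensorProduct.induction_on with
  | zero => simp
  | add a b ha hb => rw [map_add, ha, hb]
  | tmul x t =>
    rw [openMul_tmul, parity_one, one_mul, ← TensorProduct.add_tmul, evenPart_add_oddPart]

theorem openMul_mul (s t : TensorAlgebra k Ho) (x : OC 𝒜 ℬ) :
    openMul 𝒜 ℬ (s * t) x = openMul 𝒜 ℬ s (openMul 𝒜 ℬ t x) := by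
  induction x using TensorProduct.induction_on with
  | zero => simp
  | add a b ha hb => simp only [map_add, ha, hb]
  | tmul x y =>
    simp only [openMul_tmul, map_add, parity_mul, evenPart_apply', oddPart_apply', map_smul,
      parity_parity, TensorProduct.add_tmul, ← TensorProduct.smul_tmul', mul_assoc]
    module

theorem closedPart_openMul (s : TensorAlgebra k Ho) (x : OC 𝒜 ℬ) :
    closedPart 𝒜 ℬ (openMul 𝒜 ℬ s x) =
      TensorAlgebra.algebraMapInv s • closedPart 𝒜 ℬ x := by
  induction x using TensorProduct.induction_on with
  | zero => simp
  | add a b ha hb => simp only [map_add, ha, hb, smul_add]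
  | tmul x y =>
    rw [openMul_tmul, map_add, closedPart_tmul, closedPart_tmul, closedPart_tmul,
      tensorUnit_apply, tensorUnit_apply, tensorUnit_apply, map_mul, map_mul,
      algebraMapInv_parity, ← TensorProduct.add_tmul, evenPart_add_oddPart, mul_smul,
      TensorProduct.tmul_smul]

theorem closedPart_openInsert (f : OC 𝒜 ℬ →ₗ[k] Ho) (x : OC 𝒜 ℬ) :
    closedPart 𝒜 ℬ (openInsert 𝒜 ℬ f x) = 0 := by
  rw [openInsert, OpCoalgebra.extend_apply]
  generalize (ocCoalgebra 𝒜 ℬ).Δ x = z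
  induction z using TensorProduct.induction_on with
  | zero => simp
  | add a b ha hb => simp only [map_add, ha, hb, add_zero]
  | tmul x y =>
    rw [TensorProduct.map_tmul, TensorProduct.lift.tmul, LinearMap.comp_apply, closedPart_openMul]
    simp [TensorAlgebra.algebraMapInv]

theorem openProj_closedPart (x : OC 𝒜 ℬ) :
    openProj 𝒜 ℬ (closedPart 𝒜 ℬ x) = ocCounit 𝒜 ℬ x • 1 := by
  induction x using TensorProduct.induction_on with
  | zero => simp
  | add a b ha hb => simp only [map_add, ha, hb, add_smul]
  | tmul x y => rw [closedPart_tmul, openProj_tmul, tensorUnit_apply, ocCounit_tmul, smul_smul]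

theorem openProj_ocParity (x : OC 𝒜 ℬ) :
    openProj 𝒜 ℬ (ocParity 𝒜 ℬ x) = parity (tensorDeg ℬ) (openProj 𝒜 ℬ x) := by
  induction x using TensorProduct.induction_on with
  | zero => simp
  | add a b ha hb => simp only [map_add, ha, hb]
  | tmul x y => rw [ocParity_tmul, openProj_tmul, openProj_tmul, symCounit_parity, map_smul]

theorem openProj_openMul {j : ℤ} {a : Ho} (ha : a ∈ ℬ j) (x : OC 𝒜 ℬ) :
    openProj 𝒜 ℬ (openMul 𝒜 ℬ (TensorAlgebra.ι k a) x) =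
      TensorAlgebra.ι k a * openProj 𝒜 ℬ x := by
  induction x using TensorProduct.induction_on with
  | zero => simp
  | add a b ha hb => simp only [map_add, ha, hb, mul_add]
  | tmul x y =>
    have h : symCounit 𝒜 (twist (parity (symDeg 𝒜)) (sgn k j) x) = symCounit 𝒜 x := by
      rcases sgn_eq k j with h | h <;> rw [h]
      · simp [twist_one]
      · rw [twist_neg_one, symCounit_parity]
    rw [openMul_ι_tmul 𝒜 ℬ ha, openProj_tmul, openProj_tmul, mul_smul_comm, h]

/-- Insertion of a counit in the second factor. -/
theorem lift_counit (g : OC 𝒜 ℬ →ₗ[k] OC 𝒜 ℬ) (h : OC 𝒜 ℬ →ₗ[k] TensorAlgebra k Ho)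
    (hh : ∀ x, h x = ocCounit 𝒜 ℬ x • 1) (x : OC 𝒜 ℬ) :
    TensorProduct.lift (openMul 𝒜 ℬ) (TensorProduct.map h g (ocComul 𝒜 ℬ x)) = g x := by
  have h1 : ∀ z : OC 𝒜 ℬ ⊗[k] OC 𝒜 ℬ,
      TensorProduct.lift (openMul 𝒜 ℬ) (TensorProduct.map h g z) =
      g (TensorProduct.lid k (OC 𝒜 ℬ) (TensorProduct.map (ocCounit 𝒜 ℬ) LinearMap.id z)) := by
    intro z
    induction z using TensorProduct.induction_on with
    | zero => simp
    | add a b ha hb => simp only [map_add, ha, hb]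
    | tmul x y => simp [hh, openMul_one]
  rw [h1]
  exact congrArg g ((ocCoalgebra 𝒜 ℬ).counit_left x)

/-- Without open letters the only prefix is empty, and the sum over places reduces to the single
leftmost insertion. -/
theorem openExtend_closedPart (f : OC 𝒜 ℬ →ₗ[k] Ho) (x : OC 𝒜 ℬ) :
    openExtend 𝒜 ℬ f (closedPart 𝒜 ℬ x) = openInsert 𝒜 ℬ f (closedPart 𝒜 ℬ x) := by
  have h := lift_counit 𝒜 ℬ (openInsert 𝒜 ℬ f ∘ₗ closedPart 𝒜 ℬ)
    (parity (tensorDeg ℬ) ∘ₗ openProj 𝒜 ℬ ∘ₗ closedPart 𝒜 ℬ) (fun x => by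
      rw [LinearMap.comp_apply, LinearMap.comp_apply, openProj_closedPart, map_smul, parity_one]) x
  refine Eq.trans ?_ h
  have h2 : ocComul 𝒜 ℬ (closedPart 𝒜 ℬ x) =
      TensorProduct.map (closedPart 𝒜 ℬ) (closedPart 𝒜 ℬ) (ocComul 𝒜 ℬ x) :=
    (ocCoalgebra 𝒜 ℬ).Δ_e x
  rw [openExtend, LinearMap.comp_apply, LinearMap.comp_apply, h2,
    ← LinearMap.comp_apply (TensorProduct.map _ _), ← TensorProduct.map_comp]
  rfl

theorem closedPart_openExtend (f : OC 𝒜 ℬ →ₗ[k] Ho) (x : OC 𝒜 ℬ) :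
    closedPart 𝒜 ℬ (openExtend 𝒜 ℬ f x) = 0 := by
  rw [openExtend, LinearMap.comp_apply, LinearMap.comp_apply]
  generalize ocComul 𝒜 ℬ x = z
  induction z using TensorProduct.induction_on with
  | zero => simp
  | add a b ha hb => simp only [map_add, ha, hb, add_zero]
  | tmul x y =>
    rw [TensorProduct.map_tmul, TensorProduct.lift.tmul, closedPart_openMul,
      closedPart_openInsert, smul_zero]

/-- A prefix of a · x is either empty, which gives the leftmost insertion, or starts with a, which
gives a times an insertion into x; in the latter case the odd map f passes a, whence the sign. -/
theorem openExtend_openMul (f : OC 𝒜 ℬ →ₗ[k] Ho) {j : ℤ} {a : Ho} (ha : a ∈ ℬ j) (x : OC 𝒜 ℬ) :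
    openExtend 𝒜 ℬ f (openMul 𝒜 ℬ (TensorAlgebra.ι k a) x) =
      sgn k j • openMul 𝒜 ℬ (TensorAlgebra.ι k a) (openExtend 𝒜 ℬ f x) +
        openInsert 𝒜 ℬ f (openMul 𝒜 ℬ (TensorAlgebra.ι k a) x) := by
  have h := lift_counit 𝒜 ℬ (openInsert 𝒜 ℬ f ∘ₗ openMul 𝒜 ℬ (TensorAlgebra.ι k a))
    (parity (tensorDeg ℬ) ∘ₗ openProj 𝒜 ℬ ∘ₗ ocTwist 𝒜 ℬ (sgn k j) ∘ₗ closedPart 𝒜 ℬ) (fun x => by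
      simp only [LinearMap.comp_apply]
      rcases sgn_eq k j with h | h <;> rw [h, ocTwist]
      · rw [twist_one, LinearMap.id_apply, openProj_closedPart, map_smul, parity_one]
      · rw [twist_neg_one, openProj_ocParity, openProj_closedPart, map_smul, map_smul, parity_one,
          parity_one]) x
  rw [LinearMap.comp_apply] at h
  rw [← h, openExtend, LinearMap.comp_apply, LinearMap.comp_apply, LinearMap.comp_apply,
    LinearMap.comp_apply, ocComul_openMul 𝒜 ℬ ha]
  generalize ocComul 𝒜 ℬ x = z
  induction z using TensorProduct.induction_on with
  | zero => simp
  | add a b ha hb =>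
    simp only [map_add, smul_add] at ha hb ⊢
    rw [add_add_add_comm, ha, hb]
    abel
  | tmul x y =>
    simp only [map_add, TensorProduct.map_tmul, TensorProduct.lift.tmul, LinearMap.comp_apply,
      LinearMap.id_apply, openProj_openMul 𝒜 ℬ ha, parity_ι_mul ℬ ha, map_smul,
      LinearMap.smul_apply, openMul_mul]

theorem oc_induction {P : Submodule k (OC 𝒜 ℬ)} (he : ∀ x, closedPart 𝒜 ℬ x ∈ P)
    (hP : ∀ j, ∀ a ∈ ℬ j, ∀ x ∈ P, openMul 𝒜 ℬ (TensorAlgebra.ι k a) x ∈ P) : P = ⊤ := by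
  rw [eq_top_iff, ← TensorProduct.span_tmul_eq_top, Submodule.span_le]
  rintro _ ⟨x, t, rfl⟩
  have := tensor_induction (P := ⨅ x : Sym 𝒜, P.comap (TensorProduct.mk k (Sym 𝒜)
    (TensorAlgebra k Ho) x)) (by
      simp only [Submodule.mem_iInf, Submodule.mem_comap, TensorProduct.mk_apply]
      intro x
      simpa [closedPart_tmul, tensorUnit_one] using he (x ⊗ₜ[k] 1)) (fun v t ht => by
      simp only [Submodule.mem_iInf, Submodule.mem_comap, TensorProduct.mk_apply] at ht ⊢
      intro x
      induction v using DirectSum.Decomposition.inductionOn ℬ with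
      | zero => simp
      | add v w hv hw =>
        simp only [map_add, add_mul, TensorProduct.tmul_add]
        exact add_mem hv hw
      | @homogeneous j v =>
        -- Left multiplication by v twists the closed factor; applying the hypothesis to the already
        -- twisted factor undoes this. For this reason the induction is over all closed factors at
        -- once.
        have := hP j v v.2 _ (ht (twist (parity (symDeg 𝒜)) (sgn k j) x))
        rw [openMul_ι_tmul 𝒜 ℬ v.2] at this
        convert this using 2
        rcases sgn_eq k j with h | h <;> rw [h] <;> simp [twist_one, twist_neg_one, parity_parity])
  have ht : t ∈ ⨅ x : Sym 𝒜, P.comap (TensorProduct.mk k (Sym 𝒜) (TensorAlgebra k Ho) x) :=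
    this ▸ Submodule.mem_top
  simp only [Submodule.mem_iInf, Submodule.mem_comap, TensorProduct.mk_apply] at ht
  exact ht x

theorem ocComul_openExtend (f : OC 𝒜 ℬ →ₗ[k] Ho)
    (hf : ∀ x, parity ℬ (f x) = - f (ocParity 𝒜 ℬ x)) (x : OC 𝒜 ℬ) :
    ocComul 𝒜 ℬ (openExtend 𝒜 ℬ f x) =
      TensorProduct.map (openExtend 𝒜 ℬ f) LinearMap.id (ocComul 𝒜 ℬ x) +
        TensorProduct.map (ocParity 𝒜 ℬ) (openExtend 𝒜 ℬ f) (ocComul 𝒜 ℬ x) := by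
  refine (ocCoalgebra 𝒜 ℬ).Δ_of_recursion (openInsert 𝒜 ℬ f) (openExtend 𝒜 ℬ f) ?_ ?_
    (openExtend_closedPart 𝒜 ℬ f) (closedPart_openExtend 𝒜 ℬ f) ?_ x
  · intro P he hP
    exact oc_induction 𝒜 ℬ he (fun j a ha x hx => hP (Or.inr ⟨j, a, ha, rfl, rfl, rfl⟩)
      (fun y => by
        refine (closedPart_openMul 𝒜 ℬ _ y).trans ?_
        simp [TensorAlgebra.algebraMapInv]) x hx)
  · exact (ocCoalgebra 𝒜 ℬ).Δ_extend_open ℬ _ f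
      (fun i w hw => Or.inr ⟨i, w, hw, rfl, rfl, rfl⟩) hf
  · rintro g s (⟨i, v, hv, rfl, rfl, hq⟩ | ⟨j, a, ha, rfl, rfl, hq⟩) he x
    -- A closed letter meets the hypotheses only if e is the identity, and then e g = 0 forces g =
    -- 0.
    · have h0 : ∀ x, closedMul 𝒜 ℬ v x = 0 := fun x => by
        rw [← he x, hq]
        rfl
      rw [h0, h0, map_zero, map_zero, smul_zero, add_zero]
    · exact openExtend_openMul 𝒜 ℬ f ha x

theorem ocComul_closedExtend (f : OC 𝒜 ℬ →ₗ[k] Hc)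
    (hf : ∀ x, parity 𝒜 (f x) = - f (ocParity 𝒜 ℬ x))
    (hfe : ∀ x, f (closedPart 𝒜 ℬ x) = f x) (x : OC 𝒜 ℬ) :
    ocComul 𝒜 ℬ (closedExtend 𝒜 ℬ f x) =
      TensorProduct.map (closedExtend 𝒜 ℬ f) LinearMap.id (ocComul 𝒜 ℬ x) +
        TensorProduct.map (ocParity 𝒜 ℬ) (closedExtend 𝒜 ℬ f) (ocComul 𝒜 ℬ x) :=
  (ocCoalgebra 𝒜 ℬ).Δ_extend_closed 𝒜 _ f
      (fun i w hw => Or.inl ⟨i, w, hw, rfl, rfl, rfl⟩) hf hfe x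

end Lift

end OCHA

namespace OCHA

/-! ### Unshuffle formulas for the extensions -/

section Signs

variable {n : ℕ}

theorem sum_mul_negOnePow {ι : Type*} (s : Finset ι) (c : ι → ℤ) (x : ℤ) :
    ((∑ i ∈ s, c i) * x).negOnePow = ∏ i ∈ s, (c i * x).negOnePow := by
  classical
  induction s using Finset.induction_on with
  | empty => simp
  | insert a s ha ih =>
    rw [Finset.sum_insert ha, Finset.prod_insert ha, add_mul, Int.negOnePow_add, ih]

/-- Each pair of an index in S and one outside S is an inversion for exactly one of S and Sᶜ. -/
theorem unshuffleSign_compl (d : Fin n → ℤ) (S : Finset (Fin n)) :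
    unshuffleSign d Sᶜ = unshuffleSign d S *
      ((∑ i ∈ S, d i) * ∑ i ∈ Sᶜ, d i).negOnePow := by
  have h : unshuffleSign d Sᶜ * unshuffleSign d S =
      ((∑ i ∈ S, d i) * ∑ i ∈ Sᶜ, d i).negOnePow := by
    rw [unshuffleSign, unshuffleSign, compl_compl, Finset.prod_comm, ← Finset.prod_mul_distrib,
      sum_mul_negOnePow]
    refine Finset.prod_congr rfl fun i hi => ?_
    rw [← Finset.prod_mul_distrib, mul_comm, sum_mul_negOnePow]
    refine Finset.prod_congr rfl fun j hj => ?_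
    have hne : i ≠ j := fun h => (Finset.mem_compl.1 hj) (h ▸ hi)
    rcases lt_or_gt_of_ne hne with h | h
    · simp [h, h.not_gt]
    · simp [h, h.not_gt, mul_comm]
  rw [← h, mul_comm (unshuffleSign d Sᶜ), ← mul_assoc, Int.units_mul_self, one_mul]

theorem unshuffleSign_empty (d : Fin n → ℤ) : unshuffleSign d ∅ = 1 := by
  simp [unshuffleSign]

theorem sum_filter_val_lt {M : Type*} [AddCommMonoid M] {m : ℕ} (e : Fin m → M) (j : ℕ)
    (hj : j ≤ m) : ∑ t with t.val < j, e t = ∑ t : Fin j, e ⟨t, by omega⟩ := by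
  symm
  refine Finset.sum_bij' (fun t _ => ⟨t, by omega⟩)
    (fun t ht => ⟨t, by simpa using ht⟩) ?_ ?_ ?_ ?_ ?_ <;> simp

theorem sum_compl_comm {M : Type*} [AddCommMonoid M]
    (G : Finset (Fin n) → Finset (Fin n) → M) : ∑ S, G S Sᶜ = ∑ S, G Sᶜ S :=
  Fintype.sum_equiv (Equiv.mk compl compl compl_compl compl_compl) _ _
    (fun S => (congrArg (fun T => G T Sᶜ) (compl_compl S)).symm)

theorem tprod_congr {k V : Type*} [Field k] [AddCommGroup V] [Module k V] {m n : ℕ} (h : m = n)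
    {v : Fin m → V} {w : Fin n → V} (hv : ∀ t : Fin m, v t = w (Fin.cast h t)) :
    TensorAlgebra.tprod k V m v = TensorAlgebra.tprod k V n w := by
  subst h
  exact congrArg _ (funext hv)

theorem wedge_block_univ {k V : Type*} [Field k] [AddCommGroup V] [Module k V]
    (𝒱 : ℤ → Submodule k V) (v : Fin n → V) : wedge 𝒱 (block v Finset.univ) = wedge 𝒱 v := by
  rw [wedge_block, Fin.sort_univ, wedge, TensorAlgebra.tprod_apply, map_list_prod,
    List.ofFn_eq_map, List.map_map]
  rfl

end Signs

section Counits

variable {k V : Type*} [Field k] [AddCommGroup V] [Module k V] (𝒱 : ℤ → Submodule k V)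

theorem algebraMapInv_tprod {n : ℕ} (v : Fin n → V) :
    TensorAlgebra.algebraMapInv (TensorAlgebra.tprod k V n v) = if n = 0 then 1 else 0 := by
  cases n with
  | zero => simp [tprod_zero]
  | succ n => simp [tprod_succ, TensorAlgebra.algebraMapInv]

theorem symCounit_wedge [DirectSum.Decomposition 𝒱] {n : ℕ} (v : Fin n → V) :
    symCounit 𝒱 (wedge 𝒱 v) = if n = 0 then 1 else 0 := by
  cases n with
  | zero => rw [wedge_zero, symCounit_one, if_pos rfl]
  | succ n => rw [wedge_succ, symCounit_symι_mul, if_neg (Nat.succ_ne_zero n)]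

end Counits

section Components

variable {k Hc Ho : Type*} [Field k] [AddCommGroup Hc] [Module k Hc]
  [AddCommGroup Ho] [Module k Ho] {𝒜 : ℤ → Submodule k Hc} {ℬ : ℤ → Submodule k Ho}
  [DirectSum.Decomposition 𝒜]

/-- The extension of l by zero to words with open letters is how the OCHA constraint appears at the
level of components. -/
theorem Operations.exists_closedComponent (O : Operations 𝒜 ℬ) :
    ∃ f : OC 𝒜 ℬ →ₗ[k] Hc, ∀ {p q : ℕ} (u : Fin p → Hc) (a : Fin q → Ho),
      f (ocMk 𝒜 ℬ u a) = if q = 0 then O.l p u else 0 := by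
  obtain ⟨G, hG⟩ := exists_symLift 𝒜 O.l (fun n d v σ hv => O.l_symm n d v σ hv)
  refine ⟨(TensorProduct.rid k Hc).toLinearMap ∘ₗ
    TensorProduct.map G (TensorAlgebra.algebraMapInv (M := Ho)).toLinearMap, fun {p q} u a => ?_⟩
  rw [LinearMap.comp_apply, ocMk, TensorProduct.map_tmul, LinearEquiv.coe_coe,
    TensorProduct.rid_tmul, hG, AlgHom.toLinearMap_apply, algebraMapInv_tprod]
  split_ifs <;> simp

theorem Operations.exists_openComponent (O : Operations 𝒜 ℬ) :
    ∃ f : OC 𝒜 ℬ →ₗ[k] Ho, ∀ {p q : ℕ} (u : Fin p → Hc) (a : Fin q → Ho),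
      f (ocMk 𝒜 ℬ u a) = O.n p q u a := by
  obtain ⟨G, hG⟩ := exists_symLift 𝒜
    (fun p => tensorLift.compMultilinearMap (MultilinearMap.pi (fun q => O.n p q)))
    (fun p d v σ hv => by
      rw [LinearMap.compMultilinearMap_apply, LinearMap.compMultilinearMap_apply, ← map_smul]
      refine congrArg _ (funext fun q => MultilinearMap.ext fun a => ?_)
      exact O.n_symm p q d v a σ hv)
  refine ⟨TensorProduct.lift G, fun {p q} u a => ?_⟩
  rw [ocMk, TensorProduct.lift.tmul, hG, LinearMap.compMultilinearMap_apply, tensorLift_tprod]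
  rfl

end Components

section Formulas

variable {k Hc Ho : Type*} [Field k] [CharZero k] [AddCommGroup Hc] [Module k Hc]
  [AddCommGroup Ho] [Module k Ho] {𝒜 : ℤ → Submodule k Hc} {ℬ : ℤ → Submodule k Ho}
  [DirectSum.Decomposition 𝒜] [DirectSum.Decomposition ℬ]

theorem openMul_tmul_of_mem {i j : ℤ} {s : TensorAlgebra k Ho} (hs : s ∈ tensorDeg ℬ j)
    {x : Sym 𝒜} (hx : x ∈ symDeg 𝒜 i) (t : TensorAlgebra k Ho) :
    openMul 𝒜 ℬ s (x ⊗ₜ[k] t) = sgn k (j * i) • (x ⊗ₜ[k] (s * t)) := by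
  rw [openMul_tmul, parity_apply _ hs, TensorProduct.smul_tmul', sgn_mul_eq_twist (symDeg 𝒜) j hx,
    smul_mul_assoc, TensorProduct.tmul_smul, TensorProduct.smul_tmul', ← TensorProduct.add_tmul,
    twist_apply]

theorem closedExtend_ocMk (O : Operations 𝒜 ℬ) {f : OC 𝒜 ℬ →ₗ[k] Hc}
    (hf : ∀ {p q : ℕ} (u : Fin p → Hc) (a : Fin q → Ho),
      f (ocMk 𝒜 ℬ u a) = if q = 0 then O.l p u else 0)
    {r m : ℕ} (d : Fin r → ℤ) (e : Fin m → ℤ) (u : Fin r → Hc) (a : Fin m → Ho)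
    (hu : ∀ t, u t ∈ 𝒜 (d t)) (ha : ∀ t, a t ∈ ℬ (e t)) :
    closedExtend 𝒜 ℬ f (ocMk 𝒜 ℬ u a) =
      ∑ S : Finset (Fin r), ((unshuffleSign d S : ℤ) : k) •
        ocMk 𝒜 ℬ (Matrix.vecCons (O.l S.card (block u S)) (block u Sᶜ)) a := by
  have h : closedExtend 𝒜 ℬ f (ocMk 𝒜 ℬ u a) = TensorProduct.lift (closedMul 𝒜 ℬ)
      (TensorProduct.map f LinearMap.id (ocComul 𝒜 ℬ (ocMk 𝒜 ℬ u a))) := rfl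
  rw [h, ocComul_mk 𝒜 ℬ d e u a hu ha, map_sum, map_sum]
  refine Finset.sum_congr rfl fun S _ => ?_
  -- Only i = 0 survives, because f vanishes when the left factor of the coproduct has an open
  -- letter.
  rw [map_sum, map_sum, Finset.sum_eq_single 0]
  · rw [map_smul, map_smul, TensorProduct.map_tmul, TensorProduct.lift.tmul, hf, if_pos (by simp)]
    refine congrArg₂ _ ?_ ?_
    · have h0 : ∑ t : Fin ((0 : Fin (m + 1)) : ℕ), e ⟨t, by omega⟩ = 0 := Fin.sum_univ_zero _
      rw [h0, mul_zero, Int.negOnePow_zero, mul_one]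
    · rw [LinearMap.id_apply, ocMk, ocMk, closedMul_tmul, wedge_succ]
      refine congrArg₂ _ ?_ ?_
      · simp
      · exact tprod_congr (by simp) (fun t => congrArg a (Fin.ext (Nat.zero_add _)))
  · intro i _ hi
    rw [map_smul, map_smul, TensorProduct.map_tmul, hf, if_neg, TensorProduct.zero_tmul, map_zero,
      smul_zero]
    exact fun h => hi (Fin.ext h)
  · simp

theorem openInsert_ocMk (O : Operations 𝒜 ℬ) {f : OC 𝒜 ℬ →ₗ[k] Ho}
    (hf : ∀ {p q : ℕ} (u : Fin p → Hc) (a : Fin q → Ho), f (ocMk 𝒜 ℬ u a) = O.n p q u a)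
    {r m : ℕ} (d : Fin r → ℤ) (e : Fin m → ℤ) (u : Fin r → Hc) (a : Fin m → Ho)
    (hu : ∀ t, u t ∈ 𝒜 (d t)) (ha : ∀ t, a t ∈ ℬ (e t)) :
    openInsert 𝒜 ℬ f (ocMk 𝒜 ℬ u a) = ∑ S : Finset (Fin r), ∑ s : Fin (m + 1),
      ((unshuffleSign d S : ℤ) : k) • sgn k (∑ i ∈ S, d i) • (wedge 𝒜 (block u S) ⊗ₜ[k]
        (TensorAlgebra.ι k (O.n Sᶜ.card s (block u Sᶜ) (fun t : Fin s => a ⟨t, by omega⟩)) *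
          TensorAlgebra.tprod k Ho (m - s) (fun t => a ⟨s + t, by omega⟩))) := by
  have h : openInsert 𝒜 ℬ f (ocMk 𝒜 ℬ u a) =
      TensorProduct.lift (openMul 𝒜 ℬ ∘ₗ TensorAlgebra.ι k)
      (TensorProduct.map f LinearMap.id (ocComul 𝒜 ℬ (ocMk 𝒜 ℬ u a))) := rfl
  -- The coproduct feeds the left block u_S to f, whereas the formula to be proved feeds u_{Sᶜ}; the
  -- sum is reindexed by complements.
  have h2 := sum_compl_comm (fun S T : Finset (Fin r) => ∑ s : Fin (m + 1),
    (((unshuffleSign d S * ((∑ j ∈ T, d j) * ∑ t : Fin s, e ⟨t, by omega⟩).negOnePow *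
      ((∑ j ∈ S, d j + ∑ t : Fin s, e ⟨t, by omega⟩ + 1) * ∑ j ∈ T, d j).negOnePow : ℤˣ) : ℤ) : k) •
      (wedge 𝒜 (block u T) ⊗ₜ[k]
        (TensorAlgebra.ι k (O.n S.card s (block u S) (fun t : Fin s => a ⟨t, by omega⟩)) *
          TensorAlgebra.tprod k Ho (m - s) (fun t => a ⟨s + t, by omega⟩))))
  rw [h, ocComul_mk 𝒜 ℬ d e u a hu ha, map_sum, map_sum]
  refine Eq.trans (Finset.sum_congr rfl fun S _ => ?_) (h2.trans (Finset.sum_congr rfl fun S _ =>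
    Finset.sum_congr rfl fun s _ => ?_))
  · rw [map_sum, map_sum]
    refine Finset.sum_congr rfl fun s _ => ?_
    have hn : O.n S.card s (block u S) (fun t : Fin s => a ⟨t, by omega⟩) ∈
        ℬ (∑ j ∈ S, d j + ∑ t : Fin s, e ⟨t, by omega⟩ + 1) := by
      have := O.n_degree S.card s (block d S) (fun t : Fin s => e ⟨t, by omega⟩) (block u S)
        (fun t : Fin s => a ⟨t, by omega⟩) (fun t => hu _) (fun t => ha _)
      have hs : ∑ t, block d S t = ∑ i ∈ S, d i := by
        conv_rhs => rw [← Finset.map_orderEmbOfFin_univ S rfl, Finset.sum_map]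
        rfl
      rwa [hs] at this
    rw [map_smul, map_smul, TensorProduct.map_tmul, TensorProduct.lift.tmul, hf,
      LinearMap.comp_apply, LinearMap.id_apply, ocMk,
      openMul_tmul_of_mem (ι_mem_tensorDeg hn) (wedge_block_mem 𝒜 hu Sᶜ), smul_smul,
      Units.val_mul (_ * _), Int.cast_mul]
  · rw [smul_smul, ← Int.cast_mul, ← Units.val_mul]
    refine congrArg (fun w : ℤˣ => ((w : ℤ) : k) • _) ?_
    -- The exponents |u_S||u_{Sᶜ}| and |u_S||a₁ ⋯ a_s| each occur twice, so only |u_S|, from the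
    -- degree of the operation, is left.
    rw [unshuffleSign_compl, mul_assoc, mul_assoc, ← Int.negOnePow_add, ← Int.negOnePow_add]
    refine congrArg (unshuffleSign d S * ·) ?_
    rw [Int.negOnePow_eq_iff]
    ring_nf
    rw [show ∀ x y z : ℤ, (x * y * 2 + x * z * 2 : ℤ) = 2 * (x * y + x * z) by intros; ring]
    exact even_two_mul _

end Formulas

end OCHA

namespace OCHA

section Formulas

variable {k Hc Ho : Type*} [Field k] [CharZero k] [AddCommGroup Hc] [Module k Hc]
  [AddCommGroup Ho] [Module k Ho] {𝒜 : ℤ → Submodule k Hc} {ℬ : ℤ → Submodule k Ho}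
  [DirectSum.Decomposition 𝒜] [DirectSum.Decomposition ℬ]

theorem tprod_insertAt {m : ℕ} (a : Fin m → Ho) (j s : ℕ) (h : j + s ≤ m) (x : Ho) :
    TensorAlgebra.tprod k Ho _ (insertAt a j s h x) =
      TensorAlgebra.tprod k Ho j (fun t => a ⟨t, by omega⟩) * (TensorAlgebra.ι k x *
        TensorAlgebra.tprod k Ho (m - (j + s)) (fun t => a ⟨j + s + t, by omega⟩)) := by
  rw [insertAt, ← tprod_mul_tprod, ← tprod_mul_tprod, tprod_one, mul_assoc]

theorem openExtend_ocMk (O : Operations 𝒜 ℬ) {f : OC 𝒜 ℬ →ₗ[k] Ho}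
    (hf : ∀ {p q : ℕ} (u : Fin p → Hc) (a : Fin q → Ho), f (ocMk 𝒜 ℬ u a) = O.n p q u a)
    {r m : ℕ} (d : Fin r → ℤ) (e : Fin m → ℤ) (u : Fin r → Hc) (a : Fin m → Ho)
    (hu : ∀ t, u t ∈ 𝒜 (d t)) (ha : ∀ t, a t ∈ ℬ (e t)) :
    openExtend 𝒜 ℬ f (ocMk 𝒜 ℬ u a) =
      ∑ S : Finset (Fin r), ∑ j : Fin (m + 1), ∑ s : Fin (m + 1 - j),
        ((openSign d e S j : ℤ) : k) •
        ocMk 𝒜 ℬ (block u S)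
          (insertAt a j s (by omega)
            (O.n Sᶜ.card s (block u Sᶜ) (segment a j s (by omega)))) := by
  have h : openExtend 𝒜 ℬ f (ocMk 𝒜 ℬ u a) = TensorProduct.lift (openMul 𝒜 ℬ)
      (TensorProduct.map (parity (tensorDeg ℬ) ∘ₗ openProj 𝒜 ℬ) (openInsert 𝒜 ℬ f)
        (ocComul 𝒜 ℬ (ocMk 𝒜 ℬ u a))) := rfl
  -- The counit on Λᶜ in `openProj` leaves only the terms whose left factor is a bare prefix a₁ ⋯
  -- a_j.
  rw [h, ocComul_mk 𝒜 ℬ d e u a hu ha, map_sum, map_sum, Finset.sum_eq_single ∅]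
  · refine Eq.trans ?_ Finset.sum_comm
    rw [map_sum, map_sum]
    refine Finset.sum_congr rfl fun j _ => ?_
    have h0 : openProj 𝒜 ℬ (ocMk 𝒜 ℬ (block u ∅) fun t : Fin j => a ⟨t, by omega⟩) =
        TensorAlgebra.tprod k Ho j (fun t => a ⟨t, by omega⟩) := by
      rw [ocMk, openProj_tmul, symCounit_wedge, if_pos Finset.card_empty, one_smul]
    have h1 : ∀ b : Fin (m - j) → Ho, ocMk 𝒜 ℬ (block u ∅ᶜ) b = ocMk 𝒜 ℬ u b := by
      intro b
      rw [Finset.compl_empty, ocMk, wedge_block_univ]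
      rfl
    have hm := tprod_mem_tensorDeg ℬ (d := fun t : Fin j => e ⟨t, by omega⟩)
      (v := fun t : Fin j => a ⟨t, by omega⟩) (fun t => ha _)
    rw [map_smul, map_smul, TensorProduct.map_tmul, TensorProduct.lift.tmul, LinearMap.comp_apply,
      h0, h1, parity_apply _ hm, map_smul, LinearMap.smul_apply,
      openInsert_ocMk O hf d (fun t : Fin (m - j) => e ⟨j + t, by omega⟩) u _ hu (fun t => ha _),
      map_sum, Finset.smul_sum, Finset.smul_sum]
    refine Finset.sum_congr rfl fun S _ => ?_
    rw [map_sum, Finset.smul_sum, Finset.smul_sum]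
    refine Fintype.sum_equiv (finCongr (by omega)) _ _ fun s => ?_
    rw [map_smul, map_smul, openMul_tmul_of_mem hm (wedge_block_mem 𝒜 hu S), ocMk, tprod_insertAt,
      smul_smul, smul_smul, smul_smul, smul_smul]
    refine congrArg₂ _ ?_ (congrArg₂ _ rfl (congrArg₂ _ rfl (congrArg₂ _ rfl ?_)))
    -- With E the degree of the prefix, the exponents |u|E (coproduct), E (parity), E|u_S| (left
    -- multiplication) and |u_S| (insertion) add up to that of `openSign`, as |u| = |u_S| +
    -- |u_{Sᶜ}|.
    · rw [openSign, sum_filter_val_lt e j (by omega), unshuffleSign_empty, one_mul,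
        Finset.compl_empty, ← Finset.sum_add_sum_compl S d]
      generalize (∑ t : Fin (j : ℕ), e ⟨t, _⟩) = E
      simp only [sgn, ← Int.cast_mul, ← Units.val_mul]
      refine congrArg (fun w : ℤˣ => ((w : ℤ) : k)) ?_
      rw [mul_comm _ (unshuffleSign d S), mul_assoc, mul_assoc, mul_assoc]
      simp only [← Int.negOnePow_add]
      refine congrArg (unshuffleSign d S * ·) ?_
      rw [Int.negOnePow_eq_iff]
      ring_nf
      exact even_two.mul_left _
    · exact tprod_congr (by simp; omega) (fun t => congrArg a (Fin.ext (Nat.add_assoc _ _ _).symm))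
  · intro S _ hS
    rw [map_sum, map_sum]
    refine Finset.sum_eq_zero fun i _ => ?_
    rw [map_smul, map_smul, TensorProduct.map_tmul, LinearMap.comp_apply, ocMk, openProj_tmul,
      symCounit_wedge, if_neg (Finset.card_ne_zero.2 (Finset.nonempty_iff_ne_empty.2 hS)), zero_smul,
      map_zero, TensorProduct.zero_tmul, map_zero, smul_zero]
  · simp

end Formulas

end OCHA

namespace OCHA

section Span

variable {k V : Type*} [Field k] [AddCommGroup V] [Module k V] (𝒱 : ℤ → Submodule k V)
  [DirectSum.Decomposition 𝒱]

theorem span_wedge_homogeneous : Submodule.span k {x : Sym 𝒱 |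
    ∃ (n : ℕ) (d : Fin n → ℤ) (v : Fin n → V), (∀ t, v t ∈ 𝒱 (d t)) ∧ x = wedge 𝒱 v} = ⊤ := by
  have h := congrArg (Submodule.map (symMk 𝒱).toLinearMap) (span_tprod_homogeneous 𝒱)
  rw [Submodule.map_span, Submodule.map_top,
    LinearMap.range_eq_top.2 (RingQuot.mkAlgHom_surjective k (SymRel 𝒱))] at h
  refine h ▸ congrArg _ (Set.ext fun x => ⟨?_, ?_⟩)
  · rintro ⟨n, d, v, hv, rfl⟩
    exact ⟨_, ⟨n, d, v, hv, rfl⟩, rfl⟩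
  · rintro ⟨_, ⟨n, d, v, hv, rfl⟩, rfl⟩
    exact ⟨n, d, v, hv, rfl⟩

end Span

/-! ### Reduction to homogeneous words, and degree one maps -/

section Degree

variable {k Hc Ho : Type*} [Field k] [CharZero k] [AddCommGroup Hc] [Module k Hc]
  [AddCommGroup Ho] [Module k Ho] {𝒜 : ℤ → Submodule k Hc} {ℬ : ℤ → Submodule k Ho}

theorem ocMk_mem_ocDeg {p q : ℕ} {d : Fin p → ℤ} {e : Fin q → ℤ} {u : Fin p → Hc}
    {a : Fin q → Ho} (hu : ∀ t, u t ∈ 𝒜 (d t)) (ha : ∀ t, a t ∈ ℬ (e t)) :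
    ocMk 𝒜 ℬ u a ∈ ocDeg 𝒜 ℬ (∑ t, d t + ∑ t, e t) :=
  Submodule.subset_span ⟨_, _, rfl, _, symMk_mem_symDeg (tprod_mem_tensorDeg 𝒜 hu), _,
    tprod_mem_tensorDeg ℬ ha, rfl⟩

theorem ocDeg_le {i : ℤ} {P : Submodule k (OC 𝒜 ℬ)}
    (h : ∀ (p q : ℕ) (d : Fin p → ℤ) (e : Fin q → ℤ) (u : Fin p → Hc) (a : Fin q → Ho),
      (∀ t, u t ∈ 𝒜 (d t)) → (∀ t, a t ∈ ℬ (e t)) → ∑ t, d t + ∑ t, e t = i →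
      ocMk 𝒜 ℬ u a ∈ P) : ocDeg 𝒜 ℬ i ≤ P := by
  rw [ocDeg, Submodule.span_le]
  rintro _ ⟨b, c, hbc, _, ⟨s, hs, rfl⟩, t, ht, rfl⟩
  have h1 : tensorDeg 𝒜 b ≤ P.comap ((TensorProduct.mk k (Sym 𝒜) (TensorAlgebra k Ho)).flip t ∘ₗ
      (symMk 𝒜).toLinearMap) := by
    rw [tensorDeg, Submodule.span_le]
    rintro _ ⟨p, d, u, hu, hd, rfl⟩
    have h2 : tensorDeg ℬ c ≤ P.comap (TensorProduct.mk k (Sym 𝒜) (TensorAlgebra k Ho)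
        (wedge 𝒜 u)) := by
      rw [tensorDeg, Submodule.span_le]
      rintro _ ⟨q, e, a, ha, he, rfl⟩
      exact h p q d e u a hu ha (by rw [hd, he, hbc])
    exact h2 ht
  exact h1 hs

variable [DirectSum.Decomposition 𝒜] [DirectSum.Decomposition ℬ]

theorem oc_ext {W : Type*} [AddCommMonoid W] [Module k W] {F G : OC 𝒜 ℬ →ₗ[k] W}
    (h : ∀ (p q : ℕ) (d : Fin p → ℤ) (e : Fin q → ℤ) (u : Fin p → Hc) (a : Fin q → Ho),
      (∀ t, u t ∈ 𝒜 (d t)) → (∀ t, a t ∈ ℬ (e t)) →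
      F (ocMk 𝒜 ℬ u a) = G (ocMk 𝒜 ℬ u a)) : F = G := by
  refine TensorProduct.ext (LinearMap.ext_on (span_wedge_homogeneous 𝒜) ?_)
  rintro _ ⟨p, d, u, hu, rfl⟩
  refine LinearMap.ext_on (span_tprod_homogeneous ℬ) ?_
  rintro _ ⟨q, e, a, ha, rfl⟩
  exact h p q d e u a hu ha

theorem ocParity_of_mem {i : ℤ} {x : OC 𝒜 ℬ} (hx : x ∈ ocDeg 𝒜 ℬ i) :
    ocParity 𝒜 ℬ x = sgn k i • x := by
  have h : ocDeg 𝒜 ℬ i ≤ LinearMap.eqLocus (ocParity 𝒜 ℬ) (sgn k i • LinearMap.id) := by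
    refine ocDeg_le fun p q d e u a hu ha hi => ?_
    have h1 : parity (symDeg 𝒜) (wedge 𝒜 u) = sgn k (∑ t, d t) • wedge 𝒜 u :=
      parity_apply _ (symMk_mem_symDeg (tprod_mem_tensorDeg 𝒜 hu))
    rw [LinearMap.mem_eqLocus, ocMk, ocParity_tmul, h1,
      parity_apply _ (tprod_mem_tensorDeg ℬ ha), ← hi,
      TensorProduct.tmul_smul, ← TensorProduct.smul_tmul', smul_smul, mul_comm, ← sgn_add]
    rfl
  exact h hx

theorem map_ocParity_of_degree_one {W : Type*} [AddCommMonoid W] [Module k W]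
    {𝒟 : ℤ → Submodule k W} {θ : W →ₗ[k] W} (hθ : ∀ i, ∀ x ∈ 𝒟 i, θ x = sgn k i • x)
    {f : OC 𝒜 ℬ →ₗ[k] W} (hf : ∀ i, ∀ x ∈ ocDeg 𝒜 ℬ i, f x ∈ 𝒟 (i + 1)) (x : OC 𝒜 ℬ) :
    θ (f x) = (-1 : k) • f (ocParity 𝒜 ℬ x) := by
  have h : θ ∘ₗ f = (-1 : k) • (f ∘ₗ ocParity 𝒜 ℬ) := by
    refine oc_ext fun p q d e u a hu ha => ?_
    have hm := ocMk_mem_ocDeg hu ha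
    rw [LinearMap.comp_apply, LinearMap.smul_apply, LinearMap.comp_apply, ocParity_of_mem hm,
      hθ _ _ (hf _ _ hm), map_smul, sgn_add]
    have h1 : sgn k 1 = -1 := by simp [sgn]
    rw [h1, smul_smul, mul_comm]
  exact LinearMap.congr_fun h x

end Degree

/-! ### Every family of operations lifts to a coderivation -/

section Lifts

variable {k Hc Ho : Type*} [Field k] [CharZero k] [AddCommGroup Hc] [Module k Hc]
  [AddCommGroup Ho] [Module k Ho] {𝒜 : ℤ → Submodule k Hc} {ℬ : ℤ → Submodule k Ho}

theorem sum_block {M : Type*} [AddCommMonoid M] {n : ℕ} (d : Fin n → M) (S : Finset (Fin n)) :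
    ∑ t, block d S t = ∑ i ∈ S, d i := by
  conv_rhs => rw [← Finset.map_orderEmbOfFin_univ S rfl, Finset.sum_map]
  rfl

theorem sum_insertAt {M : Type*} [AddCommMonoid M] {m : ℕ} (e : Fin m → M) (j s : ℕ)
    (h : j + s ≤ m) (x : M) :
    ∑ t, insertAt e j s h x t + ∑ t, segment e j s h t = ∑ t, e t + x := by
  have h1 : ∑ t, e t = ∑ t : Fin j, e ⟨t, by omega⟩ + ∑ t, segment e j s h t +
      ∑ t : Fin (m - (j + s)), e ⟨j + s + t, by omega⟩ := by
    have h2 : ∑ t, e t = ∑ t : Fin (j + s + (m - (j + s))), e (Fin.cast (by omega) t) :=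
      (Fintype.sum_equiv (finCongr (by omega)) _ _ fun t => rfl)
    rw [h2, Fin.sum_univ_add, Fin.sum_univ_add]
    rfl
  rw [h1, insertAt, Fin.sum_univ_add, Fin.sum_univ_add]
  simp only [Fin.append_left, Fin.append_right, Finset.univ_unique, Finset.sum_singleton]
  abel

theorem insertAt_mem {m : ℕ} {e : Fin m → ℤ} {a : Fin m → Ho} (ha : ∀ t, a t ∈ ℬ (e t))
    (j s : ℕ) (h : j + s ≤ m) {i : ℤ} {x : Ho} (hx : x ∈ ℬ i)
    (t : Fin (j + 1 + (m - (j + s)))) : insertAt a j s h x t ∈ ℬ (insertAt e j s h i t) := by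
  refine Fin.addCases (fun t => ?_) (fun t => ?_) t
  · refine Fin.addCases (fun t => ?_) (fun t => ?_) t
    · simpa [insertAt] using ha _
    · simpa [insertAt] using hx
  · simpa [insertAt] using ha _

theorem vecCons_mem {n : ℕ} {d : Fin n → ℤ} {u : Fin n → Hc} (hu : ∀ t, u t ∈ 𝒜 (d t))
    {i : ℤ} {x : Hc} (hx : x ∈ 𝒜 i) (t : Fin (n + 1)) :
    Matrix.vecCons x u t ∈ 𝒜 (Matrix.vecCons i d t) := by
  refine Fin.cases ?_ (fun t => ?_) t
  · exact hx
  · exact hu t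

theorem ocMk_vecCons_zero {p q : ℕ} (u : Fin p → Hc) (a : Fin q → Ho) :
    ocMk 𝒜 ℬ (Matrix.vecCons 0 u) a = 0 := by
  rw [ocMk, wedge_succ, Matrix.cons_val_zero, map_zero, zero_mul, TensorProduct.zero_tmul]

theorem ocMk_insertAt_zero {p m : ℕ} (u : Fin p → Hc) (a : Fin m → Ho) (j s : ℕ)
    (h : j + s ≤ m) : ocMk 𝒜 ℬ u (insertAt a j s h 0) = 0 := by
  rw [ocMk, tprod_insertAt, map_zero, zero_mul, mul_zero, TensorProduct.tmul_zero]

theorem Operations.l_eq_zero (O : Operations 𝒜 ℬ) {p : ℕ} (hp : p = 0) (u : Fin p → Hc) :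
    O.l p u = 0 := by
  subst hp
  rw [O.l_zero]
  rfl

theorem Operations.n_eq_zero (O : Operations 𝒜 ℬ) {p q : ℕ} (hp : p = 0) (hq : q = 0)
    (u : Fin p → Hc) (a : Fin q → Ho) : O.n p q u a = 0 := by
  subst hp hq
  rw [O.n_zero]
  rfl

theorem Operations.l_block_mem (O : Operations 𝒜 ℬ) {p : ℕ} {d : Fin p → ℤ} {u : Fin p → Hc}
    (hu : ∀ t, u t ∈ 𝒜 (d t)) (S : Finset (Fin p)) :
    O.l S.card (block u S) ∈ 𝒜 (∑ i ∈ S, d i + 1) := by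
  rw [← sum_block]
  exact O.l_degree _ _ _ fun t => hu _

theorem Operations.n_block_mem (O : Operations 𝒜 ℬ) {p q : ℕ} {d : Fin p → ℤ} {e : Fin q → ℤ}
    {u : Fin p → Hc} {a : Fin q → Ho}
    (hu : ∀ t, u t ∈ 𝒜 (d t)) (ha : ∀ t, a t ∈ ℬ (e t)) (S : Finset (Fin p)) (j s : ℕ)
    (h : j + s ≤ q) :
    O.n S.card s (block u S) (segment a j s h) ∈
      ℬ (∑ i ∈ S, d i + ∑ t, segment e j s h t + 1) := by
  rw [← sum_block]
  exact O.n_degree _ _ _ _ _ _ (fun t => hu _) fun t => ha _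

variable [DirectSum.Decomposition 𝒜] [DirectSum.Decomposition ℬ]

theorem Operations.IsLift.unique {O : Operations 𝒜 ℬ} {D E : OC 𝒜 ℬ →ₗ[k] OC 𝒜 ℬ}
    (hD : O.IsLift D) (hE : O.IsLift E) : D = E :=
  oc_ext fun p q d e u a hu ha => (hD p q d e u a hu ha).trans (hE p q d e u a hu ha).symm

theorem Operations.IsLift.degree_one {O : Operations 𝒜 ℬ} {D : OC 𝒜 ℬ →ₗ[k] OC 𝒜 ℬ}
    (hD : O.IsLift D) (i : ℤ) (x : OC 𝒜 ℬ) (hx : x ∈ ocDeg 𝒜 ℬ i) :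
    D x ∈ ocDeg 𝒜 ℬ (i + 1) := by
  have h : ocDeg 𝒜 ℬ i ≤ (ocDeg 𝒜 ℬ (i + 1)).comap D := by
    refine ocDeg_le fun p q d e u a hu ha hi => ?_
    rw [Submodule.mem_comap, hD p q d e u a hu ha]
    refine add_mem (sum_mem fun S _ => Submodule.smul_mem _ _ ?_)
      (sum_mem fun S _ => sum_mem fun j _ => sum_mem fun s _ => Submodule.smul_mem _ _ ?_)
    · have h1 := ocMk_mem_ocDeg (vecCons_mem (d := block d Sᶜ) (u := block u Sᶜ) (fun t => hu _)
        (O.l_block_mem hu S)) ha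
      convert h1 using 2
      rw [Fin.sum_univ_succ]
      simp only [Matrix.cons_val_zero, Matrix.cons_val_succ]
      rw [sum_block, ← hi, ← Finset.sum_add_sum_compl S d]
      ring
    · have h1 := ocMk_mem_ocDeg (d := block d S) (u := block u S) (fun t => hu _)
        (insertAt_mem ha j s (by omega) (O.n_block_mem hu ha Sᶜ j s (by omega)))
      have h2 := sum_insertAt e j s (by omega)
        (∑ i ∈ Sᶜ, d i + ∑ t, segment e j s (by omega) t + 1)
      convert h1 using 2
      rw [sum_block, ← hi, ← Finset.sum_add_sum_compl S d]
      linarith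
  exact h hx

/-- Each term of the lift contains a letter, namely the output of the operation. -/
theorem Operations.IsLift.counit {O : Operations 𝒜 ℬ} {D : OC 𝒜 ℬ →ₗ[k] OC 𝒜 ℬ}
    (hD : O.IsLift D) : ocCounit 𝒜 ℬ ∘ₗ D = 0 := by
  refine oc_ext fun p q d e u a hu ha => ?_
  rw [LinearMap.comp_apply, hD p q d e u a hu ha, map_add, map_sum, map_sum,
    Finset.sum_eq_zero, Finset.sum_eq_zero, add_zero, LinearMap.zero_apply]
  · intro S _
    rw [map_sum]
    refine Finset.sum_eq_zero fun j _ => ?_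
    rw [map_sum]
    refine Finset.sum_eq_zero fun s _ => ?_
    rw [map_smul, ocMk, ocCounit_tmul, algebraMapInv_tprod, if_neg (by omega), mul_zero, smul_zero]
  · intro S _
    rw [map_smul, ocMk, ocCounit_tmul, symCounit_wedge, if_neg (Nat.succ_ne_zero _), zero_mul,
      smul_zero]

/-- On the empty word only l₀ and n_{0,0} could contribute, and both are zero. -/
theorem Operations.IsLift.map_one {O : Operations 𝒜 ℬ} {D : OC 𝒜 ℬ →ₗ[k] OC 𝒜 ℬ}
    (hD : O.IsLift D) : D (1 ⊗ₜ[k] 1) = 0 := by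
  have h : (1 : Sym 𝒜) ⊗ₜ[k] (1 : TensorAlgebra k Ho) = ocMk 𝒜 ℬ Fin.elim0 Fin.elim0 := by
    rw [ocMk, wedge_zero, tprod_zero]
  rw [h, hD 0 0 Fin.elim0 Fin.elim0 Fin.elim0 Fin.elim0 (fun t => t.elim0) (fun t => t.elim0),
    Finset.sum_eq_zero, Finset.sum_eq_zero, add_zero]
  · intro S _
    refine Finset.sum_eq_zero fun j _ => Finset.sum_eq_zero fun s _ => ?_
    rw [O.n_eq_zero (by simpa using Finset.card_le_univ Sᶜ) (by omega), ocMk_insertAt_zero,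
      smul_zero]
  · intro S _
    rw [O.l_eq_zero (by simpa using Finset.card_le_univ S), ocMk_vecCons_zero, smul_zero]

/-- The lift is the sum of the closed and the open extension of the two components. Both are
coderivations because the components are odd and the closed one factors through the projection to Λᶜ
Hc ⊗ T⁰ Ho (`hfe`). -/
theorem Operations.exists_isLift (O : Operations 𝒜 ℬ) :
    ∃ D : OC 𝒜 ℬ →ₗ[k] OC 𝒜 ℬ, O.IsLift D ∧ IsCoderivation 𝒜 ℬ D := by
  obtain ⟨f, hf⟩ := O.exists_closedComponent
  obtain ⟨g, hg⟩ := O.exists_openComponent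
  have hD : O.IsLift (closedExtend 𝒜 ℬ f + openExtend 𝒜 ℬ g) := fun r m d e u a hu ha => by
    rw [LinearMap.add_apply, closedExtend_ocMk O hf d e u a hu ha,
      openExtend_ocMk O hg d e u a hu ha]
  have hfd : ∀ i, ∀ x ∈ ocDeg 𝒜 ℬ i, f x ∈ 𝒜 (i + 1) := fun i x hx =>
    (ocDeg_le (P := (𝒜 (i + 1)).comap f) fun p q d e u a hu ha hi => by
      rw [Submodule.mem_comap, hf]
      split_ifs with hq
      · subst hq
        have := O.l_degree p d u hu
        rwa [← hi, Fin.sum_univ_zero, add_zero]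
      · exact zero_mem _) hx
  have hgd : ∀ i, ∀ x ∈ ocDeg 𝒜 ℬ i, g x ∈ ℬ (i + 1) := fun i x hx =>
    (ocDeg_le (P := (ℬ (i + 1)).comap g) fun p q d e u a hu ha hi => by
      rw [Submodule.mem_comap, hg, ← hi]
      exact O.n_degree p q d e u a hu ha) hx
  have hfe : ∀ x, f (closedPart 𝒜 ℬ x) = f x := fun x => by
    refine LinearMap.congr_fun (f := f ∘ₗ closedPart 𝒜 ℬ) (oc_ext fun p q d e u a hu ha => ?_) x
    rw [LinearMap.comp_apply, ocMk, closedPart_tmul, tensorUnit_apply, algebraMapInv_tprod]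
    split_ifs with hq
    · subst hq
      rw [one_smul, tprod_zero]
    · rw [zero_smul, TensorProduct.tmul_zero, map_zero]
      exact ((hf u a).trans (if_neg hq)).symm
  refine ⟨_, hD, hD.degree_one, ?_, hD.counit, hD.map_one⟩
  refine LinearMap.ext fun x => ?_
  have h1 := ocComul_closedExtend 𝒜 ℬ f
    (fun x => (map_ocParity_of_degree_one (fun i x hx => parity_apply 𝒜 hx) hfd x).trans
      (neg_one_smul k _)) hfe x
  have h2 := ocComul_openExtend 𝒜 ℬ g
    (fun x => (map_ocParity_of_degree_one (fun i x hx => parity_apply ℬ hx) hgd x).trans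
      (neg_one_smul k _)) x
  rw [LinearMap.comp_apply, LinearMap.comp_apply, LinearMap.add_apply (closedExtend 𝒜 ℬ f),
    map_add, h1, h2, TensorProduct.map_add_left, TensorProduct.map_add_right]
  simp only [LinearMap.add_apply]
  abel

end Lifts

end OCHA

namespace OCHA

/-! ### Cogenerators and Euler operators: uniqueness -/

section Primitive

variable {k V : Type*} [Field k] [AddCommGroup V] [Module k V]

variable (k V) in
/-- The family of multilinear maps which is the identity of `V` in arity one and zero in all other
arities. -/
def primFamily : ∀ n : ℕ, MultilinearMap k (fun _ : Fin n => V) V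
  | 1 => MultilinearMap.ofSubsingleton k V V (0 : Fin 1) LinearMap.id
  | _ => 0

theorem primFamily_one (v : Fin 1 → V) : primFamily k V 1 v = v 0 := rfl

theorem primFamily_of_eq {n : ℕ} (hn : n = 1) (v : Fin n → V) :
    primFamily k V n v = v ⟨0, by omega⟩ := by
  subst hn
  rfl

theorem primFamily_of_ne {n : ℕ} (hn : n ≠ 1) (v : Fin n → V) : primFamily k V n v = 0 := by
  match n, hn with
  | 0, _ => rfl
  | n + 2, _ => rfl

theorem primFamily_mem {𝒱 : ℤ → Submodule k V} {n : ℕ} {d : Fin n → ℤ} {v : Fin n → V}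
    (hv : ∀ t, v t ∈ 𝒱 (d t)) : primFamily k V n v ∈ 𝒱 (∑ t, d t) := by
  by_cases hn : n = 1
  · subst hn
    rw [primFamily_one, Fin.sum_univ_one]
    exact hv 0
  · rw [primFamily_of_ne hn]
    exact zero_mem _

theorem exists_symPrim (𝒱 : ℤ → Submodule k V) [DirectSum.Decomposition 𝒱] :
    ∃ G : Sym 𝒱 →ₗ[k] V, ∀ (n : ℕ) (v : Fin n → V), G (wedge 𝒱 v) = primFamily k V n v := by
  refine exists_symLift 𝒱 (primFamily k V) fun n d v σ hv => ?_
  by_cases hn : n = 1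
  · subst hn
    obtain rfl : σ = 1 := Subsingleton.elim _ _
    simp [permSign_one]
  · rw [primFamily_of_ne hn, primFamily_of_ne hn, smul_zero]

/-- Scaling of `Λⁿ V` by `c n`. -/
theorem exists_symScale (𝒱 : ℤ → Submodule k V) [DirectSum.Decomposition 𝒱] (c : ℕ → k) :
    ∃ G : Sym 𝒱 →ₗ[k] Sym 𝒱, ∀ (n : ℕ) (v : Fin n → V),
      G (wedge 𝒱 v) = c n • wedge 𝒱 v := by
  refine exists_symLift 𝒱
    (fun n => c n • (symMk 𝒱).toLinearMap.compMultilinearMap (TensorAlgebra.tprod k V n))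
    fun n d v σ hv => ?_
  have h := wedge_perm 𝒱 hv σ
  rw [smul_apply, smul_apply, smul_comm]
  exact congrArg _ h

end Primitive

section Cogenerators

variable {k Hc Ho : Type*} [Field k] [CharZero k] [AddCommGroup Hc] [Module k Hc]
  [AddCommGroup Ho] [Module k Ho] (𝒜 : ℤ → Submodule k Hc) (ℬ : ℤ → Submodule k Ho)
  [DirectSum.Decomposition 𝒜] [DirectSum.Decomposition ℬ]

/-- The projection of `Λᶜ Hc ⊗ Tᶜ Ho` to `Λ¹ Hc ⊗ T⁰ Ho = Hc`. -/
def closedPrim : OC 𝒜 ℬ →ₗ[k] Hc :=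
  (TensorProduct.rid k Hc).toLinearMap ∘ₗ
    TensorProduct.map (exists_symPrim 𝒜).choose (TensorAlgebra.algebraMapInv (M := Ho)).toLinearMap

/-- The projection of `Λᶜ Hc ⊗ Tᶜ Ho` to `Λ⁰ Hc ⊗ T¹ Ho = Ho`. -/
def openPrim : OC 𝒜 ℬ →ₗ[k] Ho := tensorLift (primFamily k Ho) ∘ₗ openProj 𝒜 ℬ

variable {p q : ℕ} (u : Fin p → Hc) (a : Fin q → Ho)

theorem closedPrim_ocMk :
    closedPrim 𝒜 ℬ (ocMk 𝒜 ℬ u a) = if q = 0 then primFamily k Hc p u else 0 := by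
  rw [closedPrim, LinearMap.comp_apply, ocMk, TensorProduct.map_tmul, LinearEquiv.coe_coe,
    TensorProduct.rid_tmul, (exists_symPrim 𝒜).choose_spec, AlgHom.toLinearMap_apply,
    algebraMapInv_tprod]
  split_ifs <;> simp

theorem openPrim_ocMk :
    openPrim 𝒜 ℬ (ocMk 𝒜 ℬ u a) = if p = 0 then primFamily k Ho q a else 0 := by
  rw [openPrim, LinearMap.comp_apply, ocMk, openProj_tmul, symCounit_wedge]
  split_ifs with h
  · rw [one_smul, tensorLift_tprod]
  · rw [zero_smul, map_zero]

theorem ocCounit_ocMk : ocCounit 𝒜 ℬ (ocMk 𝒜 ℬ u a) = if p = 0 ∧ q = 0 then 1 else 0 := by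
  rw [ocMk, ocCounit_tmul, symCounit_wedge, algebraMapInv_tprod]
  split_ifs <;> simp_all

theorem closedPart_ocMk :
    closedPart 𝒜 ℬ (ocMk 𝒜 ℬ u a) = if q = 0 then ocMk 𝒜 ℬ u a else 0 := by
  rw [ocMk, closedPart_tmul, tensorUnit_apply, algebraMapInv_tprod]
  split_ifs with hq
  · subst hq
    rw [one_smul, tprod_zero]
  · rw [zero_smul, TensorProduct.tmul_zero]

theorem ocMk_succ {p : ℕ} (u : Fin (p + 1) → Hc) :
    ocMk 𝒜 ℬ u a = closedMul 𝒜 ℬ (u 0) (ocMk 𝒜 ℬ (fun t => u t.succ) a) := by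
  rw [ocMk, ocMk, closedMul_tmul, wedge_succ]

theorem closedPrim_closedPart (x : OC 𝒜 ℬ) :
    closedPrim 𝒜 ℬ (closedPart 𝒜 ℬ x) = closedPrim 𝒜 ℬ x := by
  refine LinearMap.congr_fun (f := closedPrim 𝒜 ℬ ∘ₗ closedPart 𝒜 ℬ)
    (oc_ext fun p q d e u a hu ha => ?_) x
  rw [LinearMap.comp_apply, closedPart_ocMk, closedPrim_ocMk]
  split_ifs with hq
  · rw [closedPrim_ocMk, if_pos hq]
  · rw [map_zero]

theorem closedPrim_mem {i : ℤ} {x : OC 𝒜 ℬ} (hx : x ∈ ocDeg 𝒜 ℬ i) : closedPrim 𝒜 ℬ x ∈ 𝒜 i := by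
  have h : ocDeg 𝒜 ℬ i ≤ (𝒜 i).comap (closedPrim 𝒜 ℬ) := by
    refine ocDeg_le fun p q d e u a hu ha hi => ?_
    rw [Submodule.mem_comap, closedPrim_ocMk]
    split_ifs with hq
    · subst hq
      rw [← hi, Fin.sum_univ_zero, add_zero]
      exact primFamily_mem hu
    · exact zero_mem _
  exact h hx

theorem openPrim_mem {i : ℤ} {x : OC 𝒜 ℬ} (hx : x ∈ ocDeg 𝒜 ℬ i) : openPrim 𝒜 ℬ x ∈ ℬ i := by
  have h : ocDeg 𝒜 ℬ i ≤ (ℬ i).comap (openPrim 𝒜 ℬ) := by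
    refine ocDeg_le fun p q d e u a hu ha hi => ?_
    rw [Submodule.mem_comap, openPrim_ocMk]
    split_ifs with hp
    · subst hp
      rw [← hi, Fin.sum_univ_zero, zero_add]
      exact primFamily_mem ha
    · exact zero_mem _
  exact h hx

variable {𝒜 ℬ} in
theorem map_ocParity_of_degree_zero {W : Type*} [AddCommGroup W] [Module k W]
    {𝒟 : ℤ → Submodule k W} {θ : W →ₗ[k] W} (hθ : ∀ i, ∀ x ∈ 𝒟 i, θ x = sgn k i • x)
    {f : OC 𝒜 ℬ →ₗ[k] W} (hf : ∀ i, ∀ x ∈ ocDeg 𝒜 ℬ i, f x ∈ 𝒟 i) (x : OC 𝒜 ℬ) :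
    f (ocParity 𝒜 ℬ x) = θ (f x) := by
  have h : f ∘ₗ ocParity 𝒜 ℬ = θ ∘ₗ f := by
    refine oc_ext fun p q d e u a hu ha => ?_
    have hm := ocMk_mem_ocDeg hu ha
    rw [LinearMap.comp_apply, LinearMap.comp_apply, ocParity_of_mem hm,
      hθ _ _ (hf _ _ hm), map_smul]
  exact LinearMap.congr_fun h x

theorem closedPrim_ocParity (x : OC 𝒜 ℬ) :
    closedPrim 𝒜 ℬ (ocParity 𝒜 ℬ x) = parity 𝒜 (closedPrim 𝒜 ℬ x) :=
  map_ocParity_of_degree_zero (fun i x hx => parity_apply 𝒜 hx) (fun i x hx => closedPrim_mem 𝒜 ℬ hx) x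

theorem openPrim_ocParity (x : OC 𝒜 ℬ) :
    openPrim 𝒜 ℬ (ocParity 𝒜 ℬ x) = parity ℬ (openPrim 𝒜 ℬ x) :=
  map_ocParity_of_degree_zero (fun i x hx => parity_apply ℬ hx) (fun i x hx => openPrim_mem 𝒜 ℬ hx) x

theorem closedPrim_closedMul (v : Hc) (x : OC 𝒜 ℬ) :
    closedPrim 𝒜 ℬ (closedMul 𝒜 ℬ v x) = ocCounit 𝒜 ℬ x • v := by
  refine LinearMap.congr_fun (f := closedPrim 𝒜 ℬ ∘ₗ closedMul 𝒜 ℬ v)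
    (g := (ocCounit 𝒜 ℬ).smulRight v) (oc_ext fun p q d e u a hu ha => ?_) x
  have h := ocMk_succ 𝒜 ℬ a (Fin.cons v u : Fin (p + 1) → Hc)
  rw [Fin.cons_zero] at h
  simp only [Fin.cons_succ] at h
  rw [LinearMap.comp_apply, ← h, closedPrim_ocMk, LinearMap.smulRight_apply, ocCounit_ocMk]
  by_cases hq : q = 0
  · by_cases hp : p = 0
    · subst hp
      rw [if_pos hq, if_pos ⟨rfl, hq⟩, one_smul]
      rfl
    · rw [if_pos hq, if_neg (fun h => hp h.1), zero_smul, primFamily_of_ne (by omega)]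
  · rw [if_neg hq, if_neg (fun h => hq h.2), zero_smul]

/-- Graded commutativity of Λᶜ, with the sign absorbed in a twist so that w need not be homogeneous.
-/
theorem closedMul_twist_comm {i : ℤ} {v : Hc} (hv : v ∈ 𝒜 i) (w : Hc) (x : OC 𝒜 ℬ) :
    closedMul 𝒜 ℬ (twist (parity 𝒜) (sgn k i) w) (closedMul 𝒜 ℬ v x) =
      closedMul 𝒜 ℬ v (closedMul 𝒜 ℬ w x) := by
  induction x using TensorProduct.induction_on with
  | zero => simp
  | add a b ha hb => simp only [map_add, ha, hb]
  | tmul x t =>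
    rw [closedMul_tmul, closedMul_tmul, closedMul_tmul, closedMul_tmul, ← mul_assoc, ← mul_assoc]
    refine congrArg (fun y => (y * x) ⊗ₜ[k] t) ?_
    induction w using DirectSum.Decomposition.inductionOn 𝒜 with
    | zero => simp
    | add a b ha hb => simp only [map_add, add_mul, mul_add, ha, hb]
    | @homogeneous j w =>
      rw [← sgn_mul_eq_twist 𝒜 i w.2, symι_mul_symι hv w.2, map_smul, smul_mul_assoc,
        units_smul_eq (k := k)]

/-- The Euler operator for closed inputs. -/
theorem closedExtend_closedPrim {d : Fin p → ℤ} {e : Fin q → ℤ}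
    (hu : ∀ t, u t ∈ 𝒜 (d t)) (ha : ∀ t, a t ∈ ℬ (e t)) :
    closedExtend 𝒜 ℬ (closedPrim 𝒜 ℬ) (ocMk 𝒜 ℬ u a) = (p : k) • ocMk 𝒜 ℬ u a := by
  have hE : ∀ x, closedExtend 𝒜 ℬ (closedPrim 𝒜 ℬ) x = TensorProduct.lift (closedMul 𝒜 ℬ)
      (TensorProduct.map (closedPrim 𝒜 ℬ) LinearMap.id (ocComul 𝒜 ℬ x)) := fun x => rfl
  induction p with
  | zero =>
    rw [hE, ocComul_mk 𝒜 ℬ d e u a hu ha, map_sum, map_sum, Nat.cast_zero, zero_smul]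
    refine Finset.sum_eq_zero fun S _ => ?_
    rw [map_sum, map_sum]
    refine Finset.sum_eq_zero fun i _ => ?_
    have hS : S.card ≠ 1 := by
      have := Finset.card_le_univ S
      simp at this
      simp [this]
    rw [map_smul, map_smul, TensorProduct.map_tmul, closedPrim_ocMk, primFamily_of_ne hS, ite_self,
      TensorProduct.zero_tmul, map_zero, smul_zero]
  | succ p ih =>
    have ih := ih (fun t => u t.succ) (fun t => hu t.succ)
    rw [ocMk_succ]
    generalize hx : ocMk 𝒜 ℬ (fun t => u t.succ) a = x at ih ⊢
    have h1 : ∀ z : OC 𝒜 ℬ ⊗[k] OC 𝒜 ℬ, TensorProduct.lift (closedMul 𝒜 ℬ)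
        (TensorProduct.map (closedPrim 𝒜 ℬ) LinearMap.id
          (TensorProduct.map (closedMul 𝒜 ℬ (u 0)) LinearMap.id z)) =
        closedMul 𝒜 ℬ (u 0) (TensorProduct.lid k (OC 𝒜 ℬ)
          (TensorProduct.map (ocCounit 𝒜 ℬ) LinearMap.id z)) := by
      intro z
      induction z using TensorProduct.induction_on with
      | zero => simp
      | add a b ha hb => simp only [map_add, ha, hb]
      | tmul a b => simp [closedPrim_closedMul]
    have h2 : ∀ z : OC 𝒜 ℬ ⊗[k] OC 𝒜 ℬ, TensorProduct.lift (closedMul 𝒜 ℬ)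
        (TensorProduct.map (closedPrim 𝒜 ℬ) LinearMap.id
          (TensorProduct.map (ocTwist 𝒜 ℬ (sgn k (d 0))) (closedMul 𝒜 ℬ (u 0)) z)) =
        closedMul 𝒜 ℬ (u 0) (TensorProduct.lift (closedMul 𝒜 ℬ)
          (TensorProduct.map (closedPrim 𝒜 ℬ) LinearMap.id z)) := by
      intro z
      induction z using TensorProduct.induction_on with
      | zero => simp
      | add a b ha hb => simp only [map_add, ha, hb]
      | tmul a b =>
        have h3 : closedPrim 𝒜 ℬ (ocTwist 𝒜 ℬ (sgn k (d 0)) a) =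
            twist (parity 𝒜) (sgn k (d 0)) (closedPrim 𝒜 ℬ a) := by
          rcases sgn_eq k (d 0) with h | h <;> rw [h, ocTwist]
          · rw [twist_one, twist_one, LinearMap.id_apply, LinearMap.id_apply]
          · rw [twist_neg_one, twist_neg_one, closedPrim_ocParity]
        simp only [TensorProduct.map_tmul, TensorProduct.lift.tmul, LinearMap.id_apply, h3]
        exact closedMul_twist_comm 𝒜 ℬ (hu 0) _ _
    have h4 : TensorProduct.lid k (OC 𝒜 ℬ)
          (TensorProduct.map (ocCounit 𝒜 ℬ) LinearMap.id (ocComul 𝒜 ℬ x)) = x :=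
      (ocCoalgebra 𝒜 ℬ).counit_left x
    -- The term with u₀ on the left gives u₀ ∧ x by the counit axiom, the other one u₀ ∧ (p x) by
    -- induction.
    rw [hE, ocComul_closedMul 𝒜 ℬ (hu 0), map_add, map_add, h1, h2, h4, ← hE, ih, map_smul,
      Nat.cast_succ, add_smul, one_smul, add_comm]

/-- The analogue of the Euler operator for open inputs. -/
theorem openInsert_openPrim {d : Fin p → ℤ} {e : Fin q → ℤ}
    (hu : ∀ t, u t ∈ 𝒜 (d t)) (ha : ∀ t, a t ∈ ℬ (e t)) :
    openInsert 𝒜 ℬ (openPrim 𝒜 ℬ) (ocMk 𝒜 ℬ u a) = if q = 0 then 0 else ocMk 𝒜 ℬ u a := by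
  have hE : openInsert 𝒜 ℬ (openPrim 𝒜 ℬ) (ocMk 𝒜 ℬ u a) =
      TensorProduct.lift (openMul 𝒜 ℬ ∘ₗ TensorAlgebra.ι k)
      (TensorProduct.map (openPrim 𝒜 ℬ) LinearMap.id (ocComul 𝒜 ℬ (ocMk 𝒜 ℬ u a))) := rfl
  rw [hE, ocComul_mk 𝒜 ℬ d e u a hu ha, map_sum, map_sum, Finset.sum_eq_single ∅]
  · rw [map_sum, map_sum]
    cases q with
    | zero =>
      refine Finset.sum_eq_zero fun i _ => ?_
      rw [map_smul, map_smul, TensorProduct.map_tmul, openPrim_ocMk, primFamily_of_ne (by omega),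
        ite_self, TensorProduct.zero_tmul, map_zero, smul_zero]
    | succ q =>
      rw [if_neg (Nat.succ_ne_zero q), Finset.sum_eq_single 1]
      · have hb : ∀ b : Fin (q + 1 - ((1 : Fin (q + 1 + 1)) : ℕ)) → Ho,
            ocMk 𝒜 ℬ (block u ∅ᶜ) b = ocMk 𝒜 ℬ u b := by
          intro b
          rw [Finset.compl_empty, ocMk, wedge_block_univ]
          rfl
        have h0 : ∑ t : Fin ((1 : Fin (q + 1 + 1)) : ℕ), e ⟨t, by omega⟩ = e 0 :=
          Fin.sum_univ_one _
        have hw : wedge 𝒜 u ∈ symDeg 𝒜 (∑ t, d t) :=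
          symMk_mem_symDeg (tprod_mem_tensorDeg 𝒜 hu)
        rw [map_smul, map_smul, TensorProduct.map_tmul, openPrim_ocMk, if_pos Finset.card_empty,
          primFamily_of_eq (by simp), TensorProduct.lift.tmul, hb, LinearMap.comp_apply,
          LinearMap.id_apply, ocMk, h0, unshuffleSign_empty, one_mul, Finset.compl_empty]
        refine (congrArg _ (openMul_tmul_of_mem (ι_mem_tensorDeg (ha 0)) hw _)).trans ?_
        -- The coproduct moves a₁ to the left of u and the multiplication moves it back; the two
        -- signs cancel.
        rw [mul_comm (∑ j, d j), smul_smul, sgn_mul_self, one_smul, ocMk, tprod_succ]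
        refine congrArg (fun y => wedge 𝒜 u ⊗ₜ[k] (TensorAlgebra.ι k (a 0) * y)) ?_
        exact tprod_congr (by simp) (fun t => congrArg a (Fin.ext (Nat.add_comm _ _)))
      · intro i _ hi
        rw [map_smul, map_smul, TensorProduct.map_tmul, openPrim_ocMk, primFamily_of_ne,
          ite_self, TensorProduct.zero_tmul, map_zero, smul_zero]
        exact fun h => hi (Fin.ext h)
      · simp
  · intro S _ hS
    rw [map_sum, map_sum]
    refine Finset.sum_eq_zero fun i _ => ?_
    rw [map_smul, map_smul, TensorProduct.map_tmul, openPrim_ocMk,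
      if_neg (Finset.card_ne_zero.2 (Finset.nonempty_iff_ne_empty.2 hS)),
      TensorProduct.zero_tmul, map_zero, smul_zero]
  · simp

/-- The scalars are inverse to the eigenvalues p (for q = 0) and p + 1 (for q > 0) of the sum of the
Euler operators. At p = q = 0 the value is 0⁻¹ = 0; this is the one word not recovered, and the
counit accounts for it. -/
theorem exists_inverseEuler : ∃ R : OC 𝒜 ℬ →ₗ[k] OC 𝒜 ℬ, ∀ {p q : ℕ} (u : Fin p → Hc)
    (a : Fin q → Ho),
    R (ocMk 𝒜 ℬ u a) = (if q = 0 then (p : k)⁻¹ else ((p : k) + 1)⁻¹) • ocMk 𝒜 ℬ u a := by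
  obtain ⟨G, hG⟩ := exists_symScale 𝒜 (fun n => (n : k)⁻¹)
  obtain ⟨H, hH⟩ := exists_symScale 𝒜 (fun n => ((n : k) + 1)⁻¹)
  refine ⟨G.rTensor (TensorAlgebra k Ho) ∘ₗ closedPart 𝒜 ℬ +
    (H.rTensor (TensorAlgebra k Ho) + (-1 : k) • (H.rTensor (TensorAlgebra k Ho) ∘ₗ closedPart 𝒜 ℬ)), fun {p q} u a => ?_⟩
  have hGm : G.rTensor (TensorAlgebra k Ho) (ocMk 𝒜 ℬ u a) = (p : k)⁻¹ • ocMk 𝒜 ℬ u a := by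
    rw [ocMk, LinearMap.rTensor_tmul, hG, TensorProduct.smul_tmul']
  have hHm : H.rTensor (TensorAlgebra k Ho) (ocMk 𝒜 ℬ u a) =
      ((p : k) + 1)⁻¹ • ocMk 𝒜 ℬ u a := by
    rw [ocMk, LinearMap.rTensor_tmul, hH, TensorProduct.smul_tmul']
  simp only [LinearMap.add_apply, LinearMap.comp_apply, LinearMap.smul_apply,
    closedPart_ocMk, hHm]
  split_ifs
  · rw [hGm, hHm, smul_smul, ← add_smul, ← add_smul]
    congr 1
    ring
  · rw [map_zero, map_zero, zero_add, smul_zero, add_zero]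

/-- The common kernel of the two Euler operators consists of multiples of the unit. -/
theorem eq_counit_of_euler {y : OC 𝒜 ℬ}
    (hy : closedExtend 𝒜 ℬ (closedPrim 𝒜 ℬ) y + openInsert 𝒜 ℬ (openPrim 𝒜 ℬ) y = 0) :
    y = ocCounit 𝒜 ℬ y • ((1 : Sym 𝒜) ⊗ₜ[k] (1 : TensorAlgebra k Ho)) := by
  obtain ⟨R, hRm⟩ := exists_inverseEuler 𝒜 ℬ
  have hR : R ∘ₗ (closedExtend 𝒜 ℬ (closedPrim 𝒜 ℬ) + openInsert 𝒜 ℬ (openPrim 𝒜 ℬ)) +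
      (ocCounit 𝒜 ℬ).smulRight ((1 : Sym 𝒜) ⊗ₜ[k] (1 : TensorAlgebra k Ho)) = LinearMap.id := by
    refine oc_ext fun p q d e u a hu ha => ?_
    have hp1 : (p : k) + 1 ≠ 0 := Nat.cast_add_one_ne_zero p
    rw [LinearMap.add_apply, LinearMap.comp_apply, LinearMap.add_apply,
      closedExtend_closedPrim 𝒜 ℬ u a hu ha, openInsert_openPrim 𝒜 ℬ u a hu ha,
      LinearMap.smulRight_apply, ocCounit_ocMk, LinearMap.id_apply]
    by_cases hq : q = 0
    · rw [if_pos hq, add_zero, map_smul, hRm, if_pos hq]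
      by_cases hp : p = 0
      · rw [if_pos ⟨hp, hq⟩]
        subst hp hq
        rw [ocMk, wedge_zero, tprod_zero, Nat.cast_zero, zero_smul, zero_add, one_smul]
      · rw [if_neg (fun h => hp h.1), zero_smul, add_zero, smul_smul,
          mul_inv_cancel₀ (Nat.cast_ne_zero.2 hp), one_smul]
    · rw [if_neg hq, if_neg (fun h => hq h.2), zero_smul, add_zero, map_add, map_smul, hRm,
        if_neg hq, smul_smul, ← add_smul]
      rw [show (p : k) * ((p : k) + 1)⁻¹ + ((p : k) + 1)⁻¹ = 1 by field_simp, one_smul]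
  have h := LinearMap.congr_fun hR y
  rw [LinearMap.add_apply, LinearMap.comp_apply, LinearMap.add_apply, hy, map_zero, zero_add] at h
  exact h.symm

variable {𝒜 ℬ} in
-- Of the two co-Leibniz terms, the one with E on the left dies by `hf`. In the other, either the
-- left factor is a scalar, which f kills, or the right factor is a shorter word, which E kills by
-- induction. Later ϑ is the parity operator for a difference of odd coderivations and the identity
-- for a square.
theorem lift_map_comul_eq_zero {W : Type*} [AddCommGroup W] [Module k W]
    {E ϑ : OC 𝒜 ℬ →ₗ[k] OC 𝒜 ℬ}
    (hΔ : ∀ x, ocComul 𝒜 ℬ (E x) = TensorProduct.map E LinearMap.id (ocComul 𝒜 ℬ x) +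
      TensorProduct.map ϑ E (ocComul 𝒜 ℬ x))
    (f : OC 𝒜 ℬ →ₗ[k] W) (M : W →ₗ[k] OC 𝒜 ℬ →ₗ[k] OC 𝒜 ℬ) (hf : ∀ x, f (E x) = 0)
    (hϑ : ∀ x, f x = 0 → f (ϑ x) = 0)
    (h0 : ∀ (p q : ℕ) (u : Fin p → Hc) (a : Fin q → Ho), p = 0 → q = 0 → f (ocMk 𝒜 ℬ u a) = 0)
    {d : Fin p → ℤ} {e : Fin q → ℤ} {u : Fin p → Hc} {a : Fin q → Ho}
    (hu : ∀ t, u t ∈ 𝒜 (d t)) (ha : ∀ t, a t ∈ ℬ (e t))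
    (ih : ∀ (p' q' : ℕ) (d : Fin p' → ℤ) (e : Fin q' → ℤ) (u : Fin p' → Hc) (a : Fin q' → Ho),
      (∀ t, u t ∈ 𝒜 (d t)) → (∀ t, a t ∈ ℬ (e t)) → p' + q' < p + q → E (ocMk 𝒜 ℬ u a) = 0) :
    TensorProduct.lift M (TensorProduct.map f LinearMap.id
      (ocComul 𝒜 ℬ (E (ocMk 𝒜 ℬ u a)))) = 0 := by
  have h1 : ∀ z : OC 𝒜 ℬ ⊗[k] OC 𝒜 ℬ, TensorProduct.map f LinearMap.id
      (TensorProduct.map E LinearMap.id z) = 0 := by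
    intro z
    induction z using TensorProduct.induction_on with
    | zero => simp
    | add a b ha hb => simp only [map_add, ha, hb, add_zero]
    | tmul a b => simp [hf]
  rw [hΔ, map_add, map_add, h1, map_zero, zero_add, ocComul_mk 𝒜 ℬ d e u a hu ha]
  simp only [map_sum, map_smul]
  refine Finset.sum_eq_zero fun S _ => Finset.sum_eq_zero fun i _ => ?_
  rw [TensorProduct.map_tmul, TensorProduct.map_tmul]
  have hS := Finset.card_add_card_compl S
  rw [Fintype.card_fin] at hS
  by_cases hS0 : S.card = 0 ∧ i.val = 0
  · rw [hϑ _ (h0 _ _ _ _ hS0.1 hS0.2), TensorProduct.zero_tmul, map_zero, smul_zero]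
  · have h2 := ih Sᶜ.card (q - i) (block d Sᶜ) (fun t => e ⟨i + t, by omega⟩) (block u Sᶜ)
      (fun t => a ⟨i + t, by omega⟩) (fun t => hu _) (fun t => ha _) (by omega)
    rw [h2, map_zero, TensorProduct.tmul_zero, map_zero, smul_zero]

variable {𝒜 ℬ} in
/-- A (twisted) coderivation is determined by its components. -/
theorem eq_zero_of_components {E ϑ : OC 𝒜 ℬ →ₗ[k] OC 𝒜 ℬ}
    (hΔ : ∀ x, ocComul 𝒜 ℬ (E x) = TensorProduct.map E LinearMap.id (ocComul 𝒜 ℬ x) +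
      TensorProduct.map ϑ E (ocComul 𝒜 ℬ x))
    (hε : ∀ x, ocCounit 𝒜 ℬ (E x) = 0)
    (hϑc : ∀ x, closedPrim 𝒜 ℬ x = 0 → closedPrim 𝒜 ℬ (ϑ x) = 0)
    (hϑo : ∀ x, openPrim 𝒜 ℬ x = 0 → openPrim 𝒜 ℬ (ϑ x) = 0)
    (hc : ∀ x, closedPrim 𝒜 ℬ (E x) = 0) (ho : ∀ x, openPrim 𝒜 ℬ (E x) = 0) : E = 0 := by
  -- Induction on the total word length: both Euler operators kill E x, so E x is a multiple of 1,
  -- and its counit is zero.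
  have key : ∀ (N p q : ℕ) (d : Fin p → ℤ) (e : Fin q → ℤ) (u : Fin p → Hc) (a : Fin q → Ho),
      (∀ t, u t ∈ 𝒜 (d t)) → (∀ t, a t ∈ ℬ (e t)) → p + q = N → E (ocMk 𝒜 ℬ u a) = 0 := by
    intro N
    induction N using Nat.strong_induction_on with
    | _ N ih =>
      intro p q d e u a hu ha hN
      have ih' : ∀ (p' q' : ℕ) (d : Fin p' → ℤ) (e : Fin q' → ℤ) (u : Fin p' → Hc)
          (a : Fin q' → Ho), (∀ t, u t ∈ 𝒜 (d t)) → (∀ t, a t ∈ ℬ (e t)) → p' + q' < p + q →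
          E (ocMk 𝒜 ℬ u a) = 0 :=
        fun p' q' d e u a hu ha h => ih _ (hN ▸ h) p' q' d e u a hu ha rfl
      have hz : closedExtend 𝒜 ℬ (closedPrim 𝒜 ℬ) (E (ocMk 𝒜 ℬ u a)) +
          openInsert 𝒜 ℬ (openPrim 𝒜 ℬ) (E (ocMk 𝒜 ℬ u a)) = 0 := by
        have h1 : closedExtend 𝒜 ℬ (closedPrim 𝒜 ℬ) (E (ocMk 𝒜 ℬ u a)) = 0 :=
          lift_map_comul_eq_zero hΔ (closedPrim 𝒜 ℬ) (closedMul 𝒜 ℬ) hc hϑc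
            (fun p q u a hp hq => by
              rw [closedPrim_ocMk, primFamily_of_ne (by omega), ite_self]) hu ha ih'
        have h2 : openInsert 𝒜 ℬ (openPrim 𝒜 ℬ) (E (ocMk 𝒜 ℬ u a)) = 0 :=
          lift_map_comul_eq_zero hΔ (openPrim 𝒜 ℬ) (openMul 𝒜 ℬ ∘ₗ TensorAlgebra.ι k) ho hϑo
            (fun p q u a hp hq => by
              rw [openPrim_ocMk, primFamily_of_ne (by omega), ite_self]) hu ha ih'
        rw [h1, h2, add_zero]
      rw [eq_counit_of_euler 𝒜 ℬ hz, hε, zero_smul]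
  exact oc_ext fun p q d e u a hu ha => key _ p q d e u a hu ha rfl

end Cogenerators

end OCHA

namespace OCHA

/-! ### Square zero is equivalent to the OCHA relations -/

section Relations

variable {k Hc Ho : Type*} [Field k] [CharZero k] [AddCommGroup Hc] [Module k Hc]
  [AddCommGroup Ho] [Module k Ho] {𝒜 : ℤ → Submodule k Hc} {ℬ : ℤ → Submodule k Ho}
  [DirectSum.Decomposition 𝒜] [DirectSum.Decomposition ℬ]

theorem unshuffleSign_univ {n : ℕ} (d : Fin n → ℤ) : unshuffleSign d Finset.univ = 1 := by
  simp [unshuffleSign]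

theorem ocMk_block_univ {p q : ℕ} (u : Fin p → Hc) (a : Fin q → Ho) :
    ocMk 𝒜 ℬ (block u Finset.univ) a = ocMk 𝒜 ℬ u a := by
  rw [ocMk, wedge_block_univ]
  rfl

theorem insertAt_self {X : Type*} {m : ℕ} (a : Fin m → X) (j s : ℕ) (h : j + s ≤ m) (x : X) :
    insertAt a j s h x ⟨j, by omega⟩ = x := by
  have h1 : (⟨j, by omega⟩ : Fin (j + 1 + (m - (j + s)))) =
      Fin.castAdd (m - (j + s)) (Fin.natAdd j (0 : Fin 1)) := rfl
  rw [h1, insertAt, Fin.append_left, Fin.append_right]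

variable {O : Operations 𝒜 ℬ} {D : OC 𝒜 ℬ →ₗ[k] OC 𝒜 ℬ}

/-- A single closed letter without open ones remains only if lₚ consumes all closed inputs, that is,
for S = univ. -/
theorem Operations.IsLift.closedPrim_comp (hD : O.IsLift D) {f : OC 𝒜 ℬ →ₗ[k] Hc}
    (hf : ∀ {p q : ℕ} (u : Fin p → Hc) (a : Fin q → Ho),
      f (ocMk 𝒜 ℬ u a) = if q = 0 then O.l p u else 0) : closedPrim 𝒜 ℬ ∘ₗ D = f := by
  refine oc_ext fun p q d e u a hu ha => ?_
  rw [LinearMap.comp_apply, hD p q d e u a hu ha, map_add, map_sum, map_sum,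
    Finset.sum_eq_single Finset.univ, Finset.sum_eq_zero, add_zero, map_smul, closedPrim_ocMk,
    unshuffleSign_univ, Units.val_one, Int.cast_one, one_smul, hf]
  · refine if_congr Iff.rfl ?_ rfl
    rw [primFamily_of_eq (by simp)]
    have h := hf (block u Finset.univ) (Fin.elim0 : Fin 0 → Ho)
    rw [ocMk_block_univ, hf, if_pos rfl, if_pos rfl] at h
    exact h.symm
  · intro S _
    rw [map_sum]
    refine Finset.sum_eq_zero fun j _ => ?_
    rw [map_sum]
    refine Finset.sum_eq_zero fun s _ => ?_
    rw [map_smul, closedPrim_ocMk, if_neg (by omega), smul_zero]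
  · intro S _ hS
    have hS : Sᶜ.card ≠ 0 := by
      rwa [Finset.card_ne_zero, Finset.nonempty_iff_ne_empty, ne_eq, Finset.compl_eq_empty_iff]
    rw [map_smul, closedPrim_ocMk, primFamily_of_ne (by omega), ite_self, smul_zero]
  · simp

/-- A single open letter remains only if n consumes everything: S = ∅, no prefix (j = 0) and s = q.
-/
theorem Operations.IsLift.openPrim_comp (hD : O.IsLift D) {g : OC 𝒜 ℬ →ₗ[k] Ho}
    (hg : ∀ {p q : ℕ} (u : Fin p → Hc) (a : Fin q → Ho), g (ocMk 𝒜 ℬ u a) = O.n p q u a) :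
    openPrim 𝒜 ℬ ∘ₗ D = g := by
  refine oc_ext fun p q d e u a hu ha => ?_
  rw [LinearMap.comp_apply, hD p q d e u a hu ha, map_add, map_sum, map_sum,
    Finset.sum_eq_zero, zero_add, Finset.sum_eq_single ∅, map_sum, Finset.sum_eq_single 0, map_sum,
    Finset.sum_eq_single
      (⟨q, by simp⟩ : Fin (q + 1 - ((0 : Fin (q + 1)) : ℕ))), map_smul, openPrim_ocMk]
  · have hs : openSign d e ∅ ((0 : Fin (q + 1)) : ℕ) = 1 := by simp [openSign, unshuffleSign_empty]
    have hu : ∀ (S : Finset (Fin p)) (b : Fin q → Ho), S = Finset.univ →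
        ocMk 𝒜 ℬ (block u S) b = ocMk 𝒜 ℬ u b := by
      rintro _ b rfl
      exact ocMk_block_univ u b
    rw [if_pos Finset.card_empty, primFamily_of_eq (by simp), hs, Units.val_one, Int.cast_one,
      one_smul]
    refine (insertAt_self a 0 q (by omega) _).trans ?_
    rw [← hg, hu _ _ Finset.compl_empty]
    exact congrArg _ (congrArg _ (funext fun t => congrArg a (Fin.ext (Nat.zero_add _))))
  · intro s _ hs
    have hs : s.val ≠ q := fun h => hs (Fin.ext h)
    rw [map_smul, openPrim_ocMk, primFamily_of_ne, ite_self, smul_zero]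
    have := s.2
    simp at this ⊢
    omega
  · exact fun h => absurd (Finset.mem_univ _) h
  · intro j _ hj
    have hj : j.val ≠ 0 := fun h => hj (Fin.ext h)
    rw [map_sum]
    refine Finset.sum_eq_zero fun s _ => ?_
    rw [map_smul, openPrim_ocMk, primFamily_of_ne (by omega), ite_self, smul_zero]
  · simp
  · intro S _ hS
    have hS : S.card ≠ 0 := Finset.card_ne_zero.2 (Finset.nonempty_iff_ne_empty.2 hS)
    rw [map_sum]
    refine Finset.sum_eq_zero fun j _ => ?_
    rw [map_sum]
    refine Finset.sum_eq_zero fun s _ => ?_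
    rw [map_smul, openPrim_ocMk, if_neg hS, smul_zero]
  · simp
  · intro S _
    rw [map_smul, openPrim_ocMk, if_neg (Nat.succ_ne_zero _), smul_zero]

theorem IsCoderivation.ocComul_apply (hD : IsCoderivation 𝒜 ℬ D) (x : OC 𝒜 ℬ) :
    ocComul 𝒜 ℬ (D x) = TensorProduct.map D LinearMap.id (ocComul 𝒜 ℬ x) +
      TensorProduct.map (ocParity 𝒜 ℬ) D (ocComul 𝒜 ℬ x) :=
  (LinearMap.congr_fun hD.coleibniz x).symm

theorem IsCoderivation.ocParity_apply (hD : IsCoderivation 𝒜 ℬ D) (x : OC 𝒜 ℬ) :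
    ocParity 𝒜 ℬ (D x) = (-1 : k) • D (ocParity 𝒜 ℬ x) :=
  map_ocParity_of_degree_one (fun _ _ hx => ocParity_of_mem hx) hD.degree_one x

/-- A degree one coderivation is determined by its components. -/
theorem IsCoderivation.ext {E : OC 𝒜 ℬ →ₗ[k] OC 𝒜 ℬ} (hD : IsCoderivation 𝒜 ℬ D)
    (hE : IsCoderivation 𝒜 ℬ E) (hc : closedPrim 𝒜 ℬ ∘ₗ D = closedPrim 𝒜 ℬ ∘ₗ E)
    (ho : openPrim 𝒜 ℬ ∘ₗ D = openPrim 𝒜 ℬ ∘ₗ E) : D = E := by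
  have h : D + (-1 : k) • E = 0 := by
    refine eq_zero_of_components (ϑ := ocParity 𝒜 ℬ) ?_ ?_ ?_ ?_ ?_ ?_
    · intro x
      rw [LinearMap.add_apply, LinearMap.smul_apply, map_add, map_smul, hD.ocComul_apply,
        hE.ocComul_apply, TensorProduct.map_add_left, TensorProduct.map_add_right,
        TensorProduct.map_smul_left, TensorProduct.map_smul_right, smul_add]
      simp only [LinearMap.add_apply, LinearMap.smul_apply]
      abel
    · intro x
      have h1 := LinearMap.congr_fun hD.counit x
      have h2 := LinearMap.congr_fun hE.counit x
      rw [LinearMap.comp_apply, LinearMap.zero_apply] at h1 h2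
      rw [LinearMap.add_apply, LinearMap.smul_apply, map_add, map_smul, h1, h2, smul_zero, add_zero]
    · intro x hx
      rw [closedPrim_ocParity, hx, map_zero]
    · intro x hx
      rw [openPrim_ocParity, hx, map_zero]
    · intro x
      have h1 := LinearMap.congr_fun hc x
      rw [LinearMap.comp_apply, LinearMap.comp_apply] at h1
      rw [LinearMap.add_apply, LinearMap.smul_apply, map_add, map_smul, h1, neg_one_smul,
        add_neg_cancel]
    · intro x
      have h1 := LinearMap.congr_fun ho x
      rw [LinearMap.comp_apply, LinearMap.comp_apply] at h1
      rw [LinearMap.add_apply, LinearMap.smul_apply, map_add, map_smul, h1, neg_one_smul,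
        add_neg_cancel]
  have h2 : (-1 : k) • E + E = 0 := by
    nth_rw 2 [← one_smul k E]
    rw [← add_smul, neg_add_cancel, zero_smul]
  rw [← add_zero D, ← h2, ← add_assoc, h, zero_add]

/-- The square of an odd coderivation is a coderivation without signs, so uniqueness applies with ϑ
= id. -/
theorem IsCoderivation.square_eq_zero (hD : IsCoderivation 𝒜 ℬ D)
    (hc : closedPrim 𝒜 ℬ ∘ₗ D ∘ₗ D = 0) (ho : openPrim 𝒜 ℬ ∘ₗ D ∘ₗ D = 0) : D ∘ₗ D = 0 := by
  refine eq_zero_of_components (ϑ := LinearMap.id) (fun x => ?_) (fun x => ?_) (fun x hx => hx)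
    (fun x hx => hx) (LinearMap.congr_fun hc) (LinearMap.congr_fun ho)
  · exact (ocCoalgebra 𝒜 ℬ).Δ_sq D hD.ocComul_apply hD.ocParity_apply x
  · exact LinearMap.congr_fun hD.counit (D x)

/-- By `closedPrim_comp` this is the Hc-component of D ∘ D. The terms from n contain an open letter,
so f drops them and the left side of the L∞ relation remains. -/
theorem Operations.IsLift.closedComponent_apply (hD : O.IsLift D) {f : OC 𝒜 ℬ →ₗ[k] Hc}
    (hf : ∀ {p q : ℕ} (u : Fin p → Hc) (a : Fin q → Ho),
      f (ocMk 𝒜 ℬ u a) = if q = 0 then O.l p u else 0)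
    {p q : ℕ} {d : Fin p → ℤ} {e : Fin q → ℤ} {u : Fin p → Hc} {a : Fin q → Ho}
    (hu : ∀ t, u t ∈ 𝒜 (d t)) (ha : ∀ t, a t ∈ ℬ (e t)) :
    f (D (ocMk 𝒜 ℬ u a)) = if q = 0 then
      ∑ S : Finset (Fin p), ((unshuffleSign d S : ℤ) : k) •
        O.l (Sᶜ.card + 1) (Matrix.vecCons (O.l S.card (block u S)) (block u Sᶜ)) else 0 := by
  have h2 : ∀ S : Finset (Fin p), ∀ j : Fin (q + 1), ∀ s : Fin (q + 1 - j),
      f (ocMk 𝒜 ℬ (block u S) (insertAt a j s (by omega)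
        (O.n Sᶜ.card s (block u Sᶜ) (segment a j s (by omega))))) = 0 := by
    intro S j s
    rw [hf, if_neg (by omega)]
  rw [hD p q d e u a hu ha]
  simp only [map_add, map_sum, map_smul, h2, smul_zero, Finset.sum_const_zero, add_zero]
  simp only [hf]
  split_ifs <;> simp

theorem Operations.IsLift.openComponent_apply (hD : O.IsLift D) {g : OC 𝒜 ℬ →ₗ[k] Ho}
    (hg : ∀ {p q : ℕ} (u : Fin p → Hc) (a : Fin q → Ho), g (ocMk 𝒜 ℬ u a) = O.n p q u a)
    {p q : ℕ} {d : Fin p → ℤ} {e : Fin q → ℤ} {u : Fin p → Hc} {a : Fin q → Ho}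
    (hu : ∀ t, u t ∈ 𝒜 (d t)) (ha : ∀ t, a t ∈ ℬ (e t)) :
    g (D (ocMk 𝒜 ℬ u a)) =
      ∑ S : Finset (Fin p), ((unshuffleSign d S : ℤ) : k) •
        O.n (Sᶜ.card + 1) q (Matrix.vecCons (O.l S.card (block u S)) (block u Sᶜ)) a +
      ∑ S : Finset (Fin p), ∑ j : Fin (q + 1), ∑ s : Fin (q + 1 - j),
        ((openSign d e S j : ℤ) : k) •
        O.n S.card (j + 1 + (q - (j + s))) (block u S)
          (insertAt a j s (by omega)
            (O.n Sᶜ.card s (block u Sᶜ) (segment a j s (by omega)))) := by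
  rw [hD p q d e u a hu ha]
  simp only [map_add, map_sum, map_smul, hg]

theorem OCHAStructure.isCoderivationDifferential (O : OCHAStructure 𝒜 ℬ)
    (hD : O.IsLift D) (hcod : IsCoderivation 𝒜 ℬ D) : IsCoderivationDifferential 𝒜 ℬ D := by
  obtain ⟨f, hf⟩ := O.exists_closedComponent
  obtain ⟨g, hg⟩ := O.exists_openComponent
  refine ⟨hcod, hcod.square_eq_zero ?_ ?_⟩
  · rw [← LinearMap.comp_assoc, hD.closedPrim_comp hf]
    refine oc_ext fun p q d e u a hu ha => ?_
    rw [LinearMap.comp_apply, hD.closedComponent_apply hf hu ha, O.l_rel p d u hu, ite_self]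
    rfl
  · rw [← LinearMap.comp_assoc, hD.openPrim_comp hg]
    refine oc_ext fun p q d e u a hu ha => ?_
    rw [LinearMap.comp_apply, hD.openComponent_apply hg hu ha, O.n_rel p q d e u a hu ha]
    rfl

theorem Operations.IsLift.exists_OCHAStructure (hD : O.IsLift D) (hsq : D ∘ₗ D = 0) :
    ∃ O' : OCHAStructure 𝒜 ℬ, O'.toOperations = O := by
  obtain ⟨f, hf⟩ := O.exists_closedComponent
  obtain ⟨g, hg⟩ := O.exists_openComponent
  refine ⟨⟨O, ?_, ?_⟩, rfl⟩
  · intro p d u hu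
    -- The L∞ relations are read off on words without open letters.
    have h := hD.closedComponent_apply hf hu (e := Fin.elim0) (a := Fin.elim0) (fun t => t.elim0)
    rw [if_pos rfl] at h
    rw [← h, ← hD.closedPrim_comp hf, LinearMap.comp_apply, ← LinearMap.comp_apply D D, hsq,
      LinearMap.zero_apply, map_zero]
  · intro p q d e u a hu ha
    rw [← hD.openComponent_apply hg hu ha, ← hD.openPrim_comp hg, LinearMap.comp_apply,
      ← LinearMap.comp_apply D D, hsq, LinearMap.zero_apply, map_zero]

theorem Operations.IsLift.operations_unique {O' : Operations 𝒜 ℬ} (hD : O.IsLift D)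
    (hD' : O'.IsLift D) : O = O' := by
  obtain ⟨f, hf⟩ := O.exists_closedComponent
  obtain ⟨g, hg⟩ := O.exists_openComponent
  obtain ⟨f', hf'⟩ := O'.exists_closedComponent
  obtain ⟨g', hg'⟩ := O'.exists_openComponent
  have hff : f = f' := (hD.closedPrim_comp hf).symm.trans (hD'.closedPrim_comp hf')
  have hgg : g = g' := (hD.openPrim_comp hg).symm.trans (hD'.openPrim_comp hg')
  have hl : O.l = O'.l := by
    funext p
    refine MultilinearMap.ext fun u => ?_
    have h1 := hf u (Fin.elim0 : Fin 0 → Ho)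
    rw [hff, hf', if_pos rfl, if_pos rfl] at h1
    exact h1.symm
  have hn : O.n = O'.n := by
    funext p q
    refine MultilinearMap.ext fun u => MultilinearMap.ext fun a => ?_
    rw [← hg, hgg, hg']
  cases O
  cases O'
  subst hl hn
  rfl

/-- The predicate P is kept abstract so that one argument serves both bijections: in the second, the
OCHA constraint is implied rather than imposed. -/
theorem exists_equiv_differentials (P : (OC 𝒜 ℬ →ₗ[k] OC 𝒜 ℬ) → Prop)
    (hP : ∀ D, P D ↔ IsCoderivationDifferential 𝒜 ℬ D ∧ SatisfiesOCHAConstraint 𝒜 ℬ D) :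
    ∃ Φ : OCHAStructure 𝒜 ℬ ≃ {D : OC 𝒜 ℬ →ₗ[k] OC 𝒜 ℬ // P D},
      ∀ O : OCHAStructure 𝒜 ℬ, O.toOperations.IsLift (Φ O).1 := by
  have h : ∀ O : OCHAStructure 𝒜 ℬ, ∃ D : {D : OC 𝒜 ℬ →ₗ[k] OC 𝒜 ℬ // P D}, O.IsLift D.1 := by
    intro O
    obtain ⟨D, hD, hcod⟩ := O.exists_isLift
    exact ⟨⟨D, (hP D).2 ⟨O.isCoderivationDifferential hD hcod, O.toOperations, hD⟩⟩, hD⟩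
  choose φ hφ using h
  refine ⟨Equiv.ofBijective φ ⟨fun O O' hOO => ?_, fun D => ?_⟩, hφ⟩
  · have h1 := hφ O'
    rw [← hOO] at h1
    have h2 := (hφ O).operations_unique h1
    cases O
    cases O'
    cases h2
    rfl
  · obtain ⟨hD, O, hO⟩ := (hP D.1).1 D.2
    obtain ⟨O', rfl⟩ := hO.exists_OCHAStructure hD.square_zero
    exact ⟨O', Subtype.ext ((hφ O').unique hO)⟩

end Relations

end OCHA

namespace OCHA

/-! ### The OCHA constraint is automatic if dim Ho ≠ 1 or Hc = 0 -/

section Constraint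

variable {k Hc Ho : Type*} [Field k] [CharZero k] [AddCommGroup Hc] [Module k Hc]
  [AddCommGroup Ho] [Module k Ho] {𝒜 : ℤ → Submodule k Hc} {ℬ : ℤ → Submodule k Ho}
  [DirectSum.Decomposition 𝒜] [DirectSum.Decomposition ℬ]
  {D : OC 𝒜 ℬ →ₗ[k] OC 𝒜 ℬ}

/-- If a functional separates a further open input `b` from the first one, then the component in
`Hc` of a coderivation vanishes. -/
theorem IsCoderivation.closedPrim_eq_zero_of_functional (hD : IsCoderivation 𝒜 ℬ D) {p m : ℕ}
    {d : Fin p → ℤ} {e : Fin (m + 1) → ℤ} {u : Fin p → Hc} {a : Fin (m + 1) → Ho}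
    (hu : ∀ t, u t ∈ 𝒜 (d t)) (ha : ∀ t, a t ∈ ℬ (e t)) {i : ℤ} {b : Ho} (hb : b ∈ ℬ i)
    (f : Ho →ₗ[k] k) (hf0 : f (a 0) = 0) (hf1 : f b = 1) :
    closedPrim 𝒜 ℬ (D (ocMk 𝒜 ℬ u a)) = 0 := by
  let c : Fin (m + 2) → Ho := Fin.snoc a b
  let ec : Fin (m + 2) → ℤ := Fin.snoc e i
  have hc : ∀ t, c t ∈ ℬ (ec t) := by
    intro t
    refine Fin.lastCases ?_ (fun t => ?_) t
    · simpa [c, ec] using hb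
    · simpa [c, ec] using ha t
  have hc0 : c 0 = a 0 := by
    have : c (Fin.castSucc 0) = a 0 := by simp only [c, Fin.snoc_castSucc]
    exact this
  have hcl : c (Fin.last (m + 1)) = b := by simp only [c, Fin.snoc_last]
  -- Applied to the longer word c = (a, b): the functional may be evaluated on either factor of the
  -- coproduct.
  have hsw := (ocCoalgebra 𝒜 ℬ).map_comp_swap D hD.ocComul_apply hD.ocParity_apply
    (closedPrim 𝒜 ℬ) (f ∘ₗ openPrim 𝒜 ℬ) (closedPrim_closedPart 𝒜 ℬ) (ocMk 𝒜 ℬ u c)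
  have hΔ : (ocCoalgebra 𝒜 ℬ).Δ (ocMk 𝒜 ℬ u c) = _ := ocComul_mk 𝒜 ℬ d ec u c hu hc
  rw [hΔ] at hsw
  simp only [map_sum, map_smul] at hsw
  -- On the flipped side the functional can only see the first letter a₀, where it vanishes. On the
  -- other side it sees only the last letter b, which leaves the single term S = univ with prefix of
  -- length m + 1.
  rw [Finset.sum_eq_zero, eq_comm, Finset.sum_eq_single Finset.univ,
    Finset.sum_eq_single ⟨m + 1, by omega⟩, TensorProduct.map_tmul] at hsw
  · have h1 : closedPrim 𝒜 ℬ (D (ocMk 𝒜 ℬ (block u Finset.univ)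
        fun t : Fin (m + 1) => c ⟨t, by omega⟩)) = closedPrim 𝒜 ℬ (D (ocMk 𝒜 ℬ u a)) := by
      rw [ocMk_block_univ]
      refine congrArg (fun y => closedPrim 𝒜 ℬ (D (ocMk 𝒜 ℬ u y))) (funext fun t => ?_)
      have : c (Fin.castSucc t) = a t := by simp only [c, Fin.snoc_castSucc]
      exact this
    have h2 : f (openPrim 𝒜 ℬ (ocMk 𝒜 ℬ (block u Finset.univᶜ)
        fun t : Fin (m + 1 + 1 - (m + 1)) => c ⟨m + 1 + t, by omega⟩)) = 1 := by
      rw [openPrim_ocMk, if_pos (by simp), primFamily_of_eq (by omega)]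
      exact (congrArg f hcl).trans hf1
    have h3 : (∑ j ∈ Finset.univᶜ, d j) = 0 := by simp
    rw [unshuffleSign_univ, h3, zero_mul, Int.negOnePow_zero, mul_one, Units.val_one, Int.cast_one,
      one_smul, LinearMap.comp_apply, LinearMap.comp_apply] at hsw
    have h4 := congrArg (TensorProduct.rid k Hc) hsw
    rw [TensorProduct.rid_tmul, map_zero] at h4
    exact (h1.symm.trans (one_smul k _).symm).trans ((congrArg (· • _) h2.symm).trans h4)
  · intro j _ hj
    have hj : j.val ≠ m + 1 := fun h => hj (Fin.ext h)
    rw [TensorProduct.map_tmul, LinearMap.comp_apply f, openPrim_ocMk, primFamily_of_ne (by omega),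
      ite_self, map_zero, TensorProduct.tmul_zero, smul_zero]
  · exact fun h => absurd (Finset.mem_univ _) h
  · intro S _ hS
    have hS : Sᶜ.card ≠ 0 := by
      rwa [Finset.card_ne_zero, Finset.nonempty_iff_ne_empty, ne_eq, Finset.compl_eq_empty_iff]
    refine Finset.sum_eq_zero fun j _ => ?_
    rw [TensorProduct.map_tmul, LinearMap.comp_apply f, openPrim_ocMk, if_neg hS, map_zero,
      TensorProduct.tmul_zero, smul_zero]
  · exact fun h => absurd (Finset.mem_univ _) h
  · intro S _
    refine Finset.sum_eq_zero fun j _ => ?_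
    have h0 : f (openPrim 𝒜 ℬ (ocMk 𝒜 ℬ (block u S) fun t : Fin j => c ⟨t, by omega⟩)) = 0 := by
      rw [openPrim_ocMk]
      split_ifs
      · by_cases hj : j.val = 1
        · rw [primFamily_of_eq hj]
          exact (congrArg f hc0).trans hf0
        · rw [primFamily_of_ne hj, map_zero]
      · rw [map_zero]
    have hm := ocMk_mem_ocDeg (𝒜 := 𝒜) (ℬ := ℬ) (d := block d S) (u := block u S)
      (e := fun t : Fin j => ec ⟨t, by omega⟩) (a := fun t : Fin j => c ⟨t, by omega⟩)
      (fun t => hu _) (fun t => hc _)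
    have h1 := ocParity_of_mem hm
    rw [signedSwap_tmul, map_add, TensorProduct.map_tmul, TensorProduct.map_tmul,
      LinearMap.comp_apply f, LinearMap.comp_apply f, h0, TensorProduct.tmul_zero, zero_add]
    have h2 : f (openPrim 𝒜 ℬ ((ocCoalgebra 𝒜 ℬ).θ (ocMk 𝒜 ℬ (block u S)
        fun t : Fin j => c ⟨t, by omega⟩))) = 0 := by
      refine (congrArg (fun y => f (openPrim 𝒜 ℬ y)) h1).trans ?_
      rw [map_smul, map_smul, h0, smul_zero]
    rw [h2, TensorProduct.tmul_zero, smul_zero]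

/-- If every homogeneous element lay on the line of x, so would all of Ho, and its dimension would
be one. Infinite-dimensional Ho is included, as its `finrank` is 0. -/
theorem exists_functional (ℬ : ℤ → Submodule k Ho) [DirectSum.Decomposition ℬ]
    (h : Module.finrank k Ho ≠ 1) {x : Ho} (hx : x ≠ 0) :
    ∃ i, ∃ b ∈ ℬ i, ∃ f : Ho →ₗ[k] k, f x = 0 ∧ f b = 1 := by
  have h1 : ∃ i, ∃ b ∈ ℬ i, b ∉ Submodule.span k {x} := by
    by_contra! hcon
    refine h (finrank_eq_one x hx fun w => ?_)
    have hw : w ∈ Submodule.span k {x} := by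
      induction w using DirectSum.Decomposition.inductionOn ℬ with
      | zero => exact zero_mem _
      | homogeneous w => exact hcon _ w w.2
      | add v w hv hw => exact add_mem hv hw
    exact Submodule.mem_span_singleton.1 hw
  obtain ⟨i, b, hb, hbx⟩ := h1
  obtain ⟨f, hf, hfx⟩ := Submodule.exists_le_ker_of_notMem hbx
  refine ⟨i, b, hb, (f b)⁻¹ • f, ?_, ?_⟩
  · rw [LinearMap.smul_apply, hfx (Submodule.mem_span_singleton_self x), smul_zero]
  · rw [LinearMap.smul_apply, smul_eq_mul, inv_mul_cancel₀ hf]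

theorem ocMk_eq_zero {p q : ℕ} (u : Fin p → Hc) {a : Fin q → Ho} {t : Fin q} (h : a t = 0) :
    ocMk 𝒜 ℬ u a = 0 := by
  rw [ocMk, MultilinearMap.map_coord_zero _ t h, TensorProduct.tmul_zero]

theorem IsCoderivation.closedPrim_eq_zero (hD : IsCoderivation 𝒜 ℬ D)
    (h : Module.finrank k Ho ≠ 1 ∨ Subsingleton Hc) {p q : ℕ} (hq : q ≠ 0)
    {d : Fin p → ℤ} {e : Fin q → ℤ} {u : Fin p → Hc} {a : Fin q → Ho}
    (hu : ∀ t, u t ∈ 𝒜 (d t)) (ha : ∀ t, a t ∈ ℬ (e t)) :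
    closedPrim 𝒜 ℬ (D (ocMk 𝒜 ℬ u a)) = 0 := by
  rcases h with h | h
  · obtain ⟨m, rfl⟩ := Nat.exists_eq_succ_of_ne_zero hq
    by_cases h0 : a 0 = 0
    · rw [ocMk_eq_zero u h0, map_zero, map_zero]
    · obtain ⟨i, b, hb, f, hf0, hf1⟩ := exists_functional ℬ h h0
      exact hD.closedPrim_eq_zero_of_functional hu ha hb f hf0 hf1
  · exact Subsingleton.elim _ _

/-- Restriction of a linear map on the tensor algebra to tensors of length `q`. -/
def tensorRestrict {W : Type*} [AddCommGroup W] [Module k W] (q : ℕ) :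
    (TensorAlgebra k Ho →ₗ[k] W) →ₗ[k] MultilinearMap k (fun _ : Fin q => Ho) W where
  toFun g := g.compMultilinearMap (TensorAlgebra.tprod k Ho q)
  map_add' _ _ := rfl
  map_smul' _ _ := rfl

/-- The operations given by the components of a coderivation. -/
def IsCoderivation.operations (hD : IsCoderivation 𝒜 ℬ D) : Operations 𝒜 ℬ where
  l p := (closedPrim 𝒜 ℬ ∘ₗ D ∘ₗ (TensorProduct.mk k (Sym 𝒜) (TensorAlgebra k Ho)).flip 1 ∘ₗ
    (symMk 𝒜).toLinearMap).compMultilinearMap (TensorAlgebra.tprod k Hc p)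
  n p q := (tensorRestrict q ∘ₗ TensorProduct.curry (openPrim 𝒜 ℬ ∘ₗ D) ∘ₗ
    (symMk 𝒜).toLinearMap).compMultilinearMap (TensorAlgebra.tprod k Hc p)
  l_zero := by
    refine MultilinearMap.ext fun u => ?_
    change closedPrim 𝒜 ℬ (D (wedge 𝒜 u ⊗ₜ[k] 1)) = 0
    rw [wedge_zero, hD.map_one, map_zero]
  n_zero := by
    refine MultilinearMap.ext fun u => MultilinearMap.ext fun a => ?_
    change openPrim 𝒜 ℬ (D (wedge 𝒜 u ⊗ₜ[k] TensorAlgebra.tprod k Ho 0 a)) = 0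
    rw [wedge_zero, tprod_zero, hD.map_one, map_zero]
  l_degree p d u hu := by
    change closedPrim 𝒜 ℬ (D (wedge 𝒜 u ⊗ₜ[k] 1)) ∈ _
    have h := ocMk_mem_ocDeg (ℬ := ℬ) (e := Fin.elim0) (a := Fin.elim0) hu (fun t => t.elim0)
    rw [ocMk, tprod_zero, Fin.sum_univ_zero, add_zero] at h
    exact closedPrim_mem 𝒜 ℬ (hD.degree_one _ _ h)
  n_degree p q d e u a hu ha :=
    openPrim_mem 𝒜 ℬ (hD.degree_one _ _ (ocMk_mem_ocDeg hu ha))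
  l_symm p d u σ hu := by
    change closedPrim 𝒜 ℬ (D (wedge 𝒜 u ⊗ₜ[k] 1)) =
      _ • closedPrim 𝒜 ℬ (D (wedge 𝒜 (fun t => u (σ t)) ⊗ₜ[k] 1))
    rw [wedge_perm 𝒜 hu σ, ← TensorProduct.smul_tmul', map_smul, map_smul]
  n_symm p q d u a σ hu := by
    change openPrim 𝒜 ℬ (D (wedge 𝒜 u ⊗ₜ[k] TensorAlgebra.tprod k Ho q a)) =
      _ • openPrim 𝒜 ℬ (D (wedge 𝒜 (fun t => u (σ t)) ⊗ₜ[k] TensorAlgebra.tprod k Ho q a))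
    rw [wedge_perm 𝒜 hu σ, ← TensorProduct.smul_tmul', map_smul, map_smul]

/-- The lift E of the operations extracted from D has the same components as D: by construction on
Ho and on words without open letters, and on the remaining words by `closedPrim_eq_zero`. Hence D =
E by uniqueness. -/
theorem IsCoderivation.satisfiesOCHAConstraint (hD : IsCoderivation 𝒜 ℬ D)
    (h : Module.finrank k Ho ≠ 1 ∨ Subsingleton Hc) : SatisfiesOCHAConstraint 𝒜 ℬ D := by
  obtain ⟨E, hE, hEcod⟩ := hD.operations.exists_isLift
  obtain ⟨f, hf⟩ := hD.operations.exists_closedComponent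
  obtain ⟨g, hg⟩ := hD.operations.exists_openComponent
  suffices hDE : D = E from hDE ▸ ⟨hD.operations, hE⟩
  refine hD.ext hEcod ?_ ?_
  · rw [hE.closedPrim_comp hf]
    refine oc_ext fun p q d e u a hu ha => ?_
    rw [hf, LinearMap.comp_apply]
    split_ifs with hq
    · subst hq
      rw [ocMk, tprod_zero]
      rfl
    · exact hD.closedPrim_eq_zero h hq hu ha
  · rw [hE.openPrim_comp hg]
    refine oc_ext fun p q d e u a hu ha => ?_
    rw [hg]
    rfl

end Constraint

end OCHA

end

theorem mainTheorem2 {k Hc Ho : Type*} [Field k] [CharZero k]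
    [AddCommGroup Hc] [Module k Hc] [AddCommGroup Ho] [Module k Ho]
    (𝒜 : ℤ → Submodule k Hc) (ℬ : ℤ → Submodule k Ho)
    [DirectSum.Decomposition 𝒜] [DirectSum.Decomposition ℬ] :
    (∃ Φ : OCHA.OCHAStructure 𝒜 ℬ ≃
        {D : OCHA.OC 𝒜 ℬ →ₗ[k] OCHA.OC 𝒜 ℬ //
          OCHA.IsCoderivationDifferential 𝒜 ℬ D ∧ OCHA.SatisfiesOCHAConstraint 𝒜 ℬ D},
      ∀ O : OCHA.OCHAStructure 𝒜 ℬ, O.toOperations.IsLift (Φ O).1) ∧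
    (Module.finrank k Ho ≠ 1 ∨ Subsingleton Hc →
      ∃ Φ : OCHA.OCHAStructure 𝒜 ℬ ≃
        {D : OCHA.OC 𝒜 ℬ →ₗ[k] OCHA.OC 𝒜 ℬ // OCHA.IsCoderivationDifferential 𝒜 ℬ D},
      ∀ O : OCHA.OCHAStructure 𝒜 ℬ, O.toOperations.IsLift (Φ O).1) :=
  ⟨OCHA.exists_equiv_differentials _ fun _ => Iff.rfl,
    fun h => OCHA.exists_equiv_differentials _ fun _ =>
      ⟨fun hD => ⟨hD, hD.toIsCoderivation.satisfiesOCHAConstraint h⟩, fun hD => hD.1⟩⟩
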